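/- \textbf{Definitions.} A permutation $\pi$ of $\{1,\dots,n\}$, $n\ge 1$, is \emph{Baxter} if there are no $i<j<k$ with $\pi(j+1)<\pi(i)<\pi(k)<\pi(j)$ or $\pi(j)<\pi(k)<\pi(i)<\pi(j+1)$. An \emph{ascent} of $\pi$ is an $a\in\{1,\dots,n-1\}$ with $\pi(a)<\pi(a+1)$. The value $\pi(i)$ is an \emph{lr-maximum} if $\pi(i)>\pi(j)$ for all $j<i$, an \emph{rl-maximum} if $\pi(i)>\pi(j)$ for all $j>i$; \emph{lr-minima} and \emph{rl-minima} are defined in the same way with $\pi(i)<\pi(j)$. A \emph{plane bipolar orientation} is an acyclic orientation of a planar map (a connected graph, possibly with multiple edges, embedded in the plane without edge-crossings, up to continuous deformation) with a unique source and a unique sink (the poles), both on the outer face. Its \emph{left} (resp. \emph{right}) \emph{border} is the oriented path from the source to the sink that has the outer face on its left (resp. right), and the length of this path is the left (resp. right) \emph{outer degree}. For a Baxter permutation $\pi$ of $\{1,\dots,n\}$, let the \emph{black} points be $b_i=(i,\pi(i))$, $1\le i\le n$, and let the \emph{white} points be $w_0=(\tfrac12,\tfrac12)$, $w_n=(n+\tfrac12,n+\tfrac12)$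 and, for each ascent $a$, $w_a=(a+\tfrac12,\ell_a+\tfrac12)$ with $\ell_a=\max\{\pi(i): i<a+1,\ \pi(i)<\pi(a+1)\}$. Let $\phi(\pi)$ be the Hasse diagram of the set of all these points for the product order on $\mathbb R^2$, drawn with straight edges oriented from the smaller to the larger point. \textbf{Theorem.} Let $n\ge 1$. For every Baxter permutation $\pi$ of size $n$, no two edges of $\phi(\pi)$ cross, every edge of $\phi(\pi)$ joins a black point and a white point, and every black point has indegree and outdegree $1$. Erasing the black points (so that the two edges at each black point merge into one edge) therefore turns $\phi(\pi)$ into an embedded digraph $\Phi(\pi)$ whose vertices are the white points and whose edges correspond to the black points, and $\Phi(\pi)$ is a plane bipolar orientation with $n$ edges, source $w_0$ and sink $w_n$. The map $\Phi$ is a bijection from the Baxter permutations of size $n$ to the plane bipolar orientations with $n$ edges. Moreover, for every Baxter permutation $\pi$ of size $n$: (i) the number of ascents of $\pi$ is the number of non-polar vertices of $\Phi(\pi)$; (ii) the left border of $\Phi(\pi)$ exists and is unique, and the number of lr-maxima of $\pi$ is the left outer degree of $\Phi(\pi)$; (iii) the right border of $\Phi(\pi)$ exists and is unique, and the number of rl-minima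 of $\pi$ is the right outer degree of $\Phi(\pi)$; (iv) the number of rl-maxima of $\pi$ is the degree of the sink of $\Phi(\pi)$; (v) the number of lr-minima of $\pi$ is the degree of the source of $\Phi(\pi)$. -/

import Mathlib

open Equiv

/-! ### Permutations

A permutation of `{1, …, n}` is an element of `Perm (Fin n)`; the element `i : Fin n` stands for
the integer `i + 1`. -/

section Permutations

variable {n : ℕ}

/-- Baxter permutations: there are no `i < j < k` with
`π (j + 1) < π i < π k < π j` or `π j < π k < π i < π (j + 1)`. -/
def IsBaxter (π : Perm (Fin n)) : Prop :=
  ¬ ∃ i j j' k : Fin n, i < j ∧ j < k ∧ j'.val = j.val + 1 ∧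
    ((π j' < π i ∧ π i < π k ∧ π k < π j) ∨ (π j < π k ∧ π k < π i ∧ π i < π j'))

/-- The positions of the ascents, `π i < π (i + 1)`. -/
def ascents (π : Perm (Fin n)) : Finset (Fin n) :=
  {i | ∃ j : Fin n, j.val = i.val + 1 ∧ π i < π j}

/-- The positions of the left-to-right maxima. -/
def lrMaxima (π : Perm (Fin n)) : Finset (Fin n) := {i | ∀ j, j < i → π j < π i}

/-- The positions of the right-to-left maxima. -/
def rlMaxima (π : Perm (Fin n)) : Finset (Fin n) := {i | ∀ j, i < j → π j < π i}

/-- The positions of the left-to-right minima. -/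
def lrMinima (π : Perm (Fin n)) : Finset (Fin n) := {i | ∀ j, j < i → π i < π j}

/-- The positions of the right-to-left minima. -/
def rlMinima (π : Perm (Fin n)) : Finset (Fin n) := {i | ∀ j, i < j → π i < π j}

end Permutations

/-! ### The embedded digraph of a permutation -/

noncomputable section Drawing

variable {n : ℕ}

/-- The black points: the diagram of the permutation. -/
def blackPoint (π : Perm (Fin n)) (i : Fin n) : ℝ × ℝ :=
  (((i : ℕ) : ℝ) + 1, ((π i : ℕ) : ℝ) + 1)

/-- For an ascent `a`, the number `ℓ_a = max {π i : i < a + 1 and π i < π (a + 1)}`. -/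
def ascentLevel (π : Perm (Fin n)) (a : Fin n) : ℕ :=
  Finset.sup {i : Fin n | i ≤ a ∧ ∃ j : Fin n, j.val = a.val + 1 ∧ π i < π j}
    (fun i => (π i : ℕ) + 1)

/-- The white point `w_a = (a + 1/2, ℓ_a + 1/2)` of an ascent `a`. -/
def ascentPoint (π : Perm (Fin n)) (a : Fin n) : ℝ × ℝ :=
  (((a : ℕ) : ℝ) + 1 + 1 / 2, (ascentLevel π a : ℝ) + 1 / 2)

/-- The white point `w_0 = (1/2, 1/2)`. -/
def firstPoint : ℝ × ℝ := (1 / 2, 1 / 2)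

/-- The white point `w_n = (n + 1/2, n + 1/2)`. -/
def lastPoint (n : ℕ) : ℝ × ℝ := ((n : ℝ) + 1 / 2, (n : ℝ) + 1 / 2)

def blackPoints (π : Perm (Fin n)) : Set (ℝ × ℝ) := Set.range (blackPoint π)

def whitePoints (π : Perm (Fin n)) : Set (ℝ × ℝ) :=
  {firstPoint, lastPoint n} ∪ ascentPoint π '' (ascents π : Set (Fin n))

/-- The edges `p → q` of the embedded digraph `φ(π)`: the point `q` covers the point `p` among the
black and white points, for the product order on the plane. -/
def HasseEdge (π : Perm (Fin n)) (p q : ℝ × ℝ) : Prop :=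
  p ∈ blackPoints π ∪ whitePoints π ∧ q ∈ blackPoints π ∪ whitePoints π ∧ p < q ∧
    ∀ r ∈ blackPoints π ∪ whitePoints π, ¬ (p < r ∧ r < q)

/-- Two distinct edges of `φ(π)`, drawn as straight segments, meet at most at common endpoints. -/
def HasNoCrossing (π : Perm (Fin n)) : Prop :=
  ∀ p q p' q', HasseEdge π p q → HasseEdge π p' q' → (p, q) ≠ (p', q') →
    segment ℝ p q ∩ segment ℝ p' q' ⊆ {p, q} ∩ {p', q'}

/-- Every edge of `φ(π)` joins a black point and a white point. -/
def IsBicolored (π : Perm (Fin n)) : Prop :=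
  ∀ p q, HasseEdge π p q →
    (p ∈ blackPoints π ∧ q ∈ whitePoints π) ∨ (p ∈ whitePoints π ∧ q ∈ blackPoints π)

/-- The argument of the vector from `p` to `q`. -/
def directionArg (p q : ℝ × ℝ) : ℝ := Complex.arg ⟨q.1 - p.1, q.2 - p.2⟩

/-- The angle in `(0, 2π]` of the counterclockwise rotation that takes a direction of argument `α`
to a direction of argument `β` (a full turn if the directions agree). -/
def ccwAngle (α β : ℝ) : ℝ := toIocMod Real.two_pi_pos 0 (β - α)

end Drawing

/-! ### Plane bipolar orientations

Oriented plane maps, up to continuous deformation, are represented by combinatorial maps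
(rotation systems) of genus zero with a distinguished outer face, up to isomorphism. -/

/-- The two half-edges of the edge `e` are `(e, true)`, at the tail of `e`, and `(e, false)`, at
the head of `e`. -/
abbrev HalfEdge (n : ℕ) : Type := Fin n × Bool

/-- The exchange of the two halves of each edge. -/
def oppositeHalf (n : ℕ) : Perm (HalfEdge n) :=
  Equiv.prodCongr (Equiv.refl (Fin n)) Equiv.boolNot

/-- An oriented combinatorial map with edges labelled by `Fin n`. The permutation `rot` sends a
half-edge to the next half-edge counterclockwise around the same vertex. Going along a half-edge
and then turning clockwise, that is, applying `rot⁻¹ * oppositeHalf n`, one follows the border of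
the face that lies to the left of the half-edge (seen from its vertex). -/
structure OrientedMap (n : ℕ) where
  rot : Perm (HalfEdge n)
  outer : Quotient (Perm.SameCycle.setoid (rot⁻¹ * oppositeHalf n))

namespace OrientedMap

variable {n : ℕ}

/-- The vertices are the cycles of `rot`. -/
def Vertex (M : OrientedMap n) : Type := Quotient (Perm.SameCycle.setoid M.rot)

/-- The faces are the cycles of `rot⁻¹ * oppositeHalf n`. -/
def Face (M : OrientedMap n) : Type :=
  Quotient (Perm.SameCycle.setoid (M.rot⁻¹ * oppositeHalf n))

/-- The vertex to which a half-edge is attached. -/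
def vertexOf (M : OrientedMap n) (d : HalfEdge n) : M.Vertex :=
  Quotient.mk (Perm.SameCycle.setoid M.rot) d

/-- The face to the left of a half-edge, seen from its vertex: the face that contains the corner
between `d` and `M.rot d`. -/
def faceOf (M : OrientedMap n) (d : HalfEdge n) : M.Face :=
  Quotient.mk (Perm.SameCycle.setoid (M.rot⁻¹ * oppositeHalf n)) d

def outerFace (M : OrientedMap n) : M.Face := M.outer

def tail (M : OrientedMap n) (e : Fin n) : M.Vertex := M.vertexOf (e, true)

def head (M : OrientedMap n) (e : Fin n) : M.Vertex := M.vertexOf (e, false)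

def leftFace (M : OrientedMap n) (e : Fin n) : M.Face := M.faceOf (e, true)

def rightFace (M : OrientedMap n) (e : Fin n) : M.Face := M.faceOf (e, false)

/-- There is an edge from `u` to `v`. -/
def Step (M : OrientedMap n) (u v : M.Vertex) : Prop := ∃ e, M.tail e = u ∧ M.head e = v

def IsSource (M : OrientedMap n) (v : M.Vertex) : Prop := ∀ e, M.head e ≠ v

def IsSink (M : OrientedMap n) (v : M.Vertex) : Prop := ∀ e, M.tail e ≠ v

/-- The vertex `v` is incident to the outer face. -/
def OnOuterFace (M : OrientedMap n) (v : M.Vertex) : Prop :=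
  ∃ d, M.vertexOf d = v ∧ M.faceOf d = M.outerFace

/-- Connected plane maps (Euler's relation expresses that the genus is zero), oriented without
directed cycles, with a unique source and a unique sink, both on the outer face. -/
structure IsPlaneBipolar (M : OrientedMap n) : Prop where
  connected : ∀ u v : M.Vertex, Relation.EqvGen M.Step u v
  euler : Nat.card M.Vertex + Nat.card M.Face = n + 2
  acyclic : ∀ v : M.Vertex, ¬ Relation.TransGen M.Step v v
  unique_source : ∃! v, M.IsSource v
  unique_sink : ∃! v, M.IsSink v
  source_outer : ∀ v, M.IsSource v → M.OnOuterFace v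
  sink_outer : ∀ v, M.IsSink v → M.OnOuterFace v

/-- The list of edges `p` is a directed path from `u` to `v`. -/
def IsPath (M : OrientedMap n) : M.Vertex → List (Fin n) → M.Vertex → Prop
  | u, [], v => u = v
  | u, e :: p, v => M.tail e = u ∧ M.IsPath (M.head e) p v

/-- A directed path from the source to the sink that has the outer face on its left. -/
def IsLeftBorder (M : OrientedMap n) (p : List (Fin n)) : Prop :=
  ∃ s t, M.IsSource s ∧ M.IsSink t ∧ M.IsPath s p t ∧ ∀ e ∈ p, M.leftFace e = M.outerFace

/-- A directed path from the source to the sink that has the outer face on its right. -/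
def IsRightBorder (M : OrientedMap n) (p : List (Fin n)) : Prop :=
  ∃ s t, M.IsSource s ∧ M.IsSink t ∧ M.IsPath s p t ∧ ∀ e ∈ p, M.rightFace e = M.outerFace

/-- The number of half-edges at `v`. -/
noncomputable def degree (M : OrientedMap n) (v : M.Vertex) : ℕ :=
  Nat.card {d : HalfEdge n // M.vertexOf d = v}

/-- The number of vertices other than the source and the sink. -/
noncomputable def nonPolarCount (M : OrientedMap n) : ℕ :=
  Nat.card {v : M.Vertex // ¬ M.IsSource v ∧ ¬ M.IsSink v}

/-- Equality of oriented plane maps up to the labels of the edges (and, since combinatorial maps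
are considered, up to deformation). -/
def Iso (M N : OrientedMap n) : Prop :=
  ∃ τ : Perm (Fin n),
    (∀ d, N.rot (Prod.map τ id d) = Prod.map τ id (M.rot d)) ∧
    ∀ d, M.faceOf d = M.outerFace ↔ N.faceOf (Prod.map τ id d) = N.outerFace

theorem Iso.refl (M : OrientedMap n) : Iso M M :=
  ⟨1, fun _ => rfl, fun _ => Iff.rfl⟩

theorem Iso.symm {M N : OrientedMap n} (h : Iso M N) : Iso N M := by
  obtain ⟨τ, h1, h2⟩ := h
  have key : ∀ d : HalfEdge n, Prod.map τ id (Prod.map τ.symm id d) = d := fun d => by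
    simp [Prod.map]
  have key' : ∀ d : HalfEdge n, Prod.map τ.symm id (Prod.map τ id d) = d := fun d => by
    simp [Prod.map]
  refine ⟨τ.symm, fun d => ?_, fun d => ?_⟩
  · have := h1 (Prod.map τ.symm id d)
    rw [key] at this
    rw [this, key']
  · have := h2 (Prod.map τ.symm id d)
    rw [key] at this
    exact this.symm

theorem Iso.trans {M N P : OrientedMap n} (h : Iso M N) (h' : Iso N P) : Iso M P := by
  obtain ⟨τ, h1, h2⟩ := h
  obtain ⟨σ, k1, k2⟩ := h'
  refine ⟨σ * τ, fun d => ?_, fun d => (h2 d).trans (k2 _)⟩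
  have := k1 (Prod.map τ id d)
  rw [h1] at this
  exact this

end OrientedMap

/-- Labelled plane bipolar orientations are identified when they differ by the labels only. -/
instance planeBipolarSetoid (n : ℕ) : Setoid {M : OrientedMap n // M.IsPlaneBipolar} where
  r M N := OrientedMap.Iso M.1 N.1
  iseqv := ⟨fun M => OrientedMap.Iso.refl M.1, OrientedMap.Iso.symm, OrientedMap.Iso.trans⟩

/-- Plane bipolar orientations with `n` edges. -/
def PlaneBipolarOrientation (n : ℕ) : Type := Quotient (planeBipolarSetoid n)

/-- The class of a labelled plane bipolar orientation. -/
def OrientedMap.IsPlaneBipolar.toOrientation {n : ℕ} {M : OrientedMap n} (h : M.IsPlaneBipolar) :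
    PlaneBipolarOrientation n :=
  Quotient.mk (planeBipolarSetoid n) ⟨M, h⟩

/-! ### Erasing the black points -/

/-- The oriented map `M` is what one gets from the drawing `φ(π)` by erasing the black points: the
vertices of `M` are the white points, the edges of `M` are the black points `b`, each going from
the white point covered by `b` to the white point covering `b`, the rotation of `M` is the
counterclockwise order of the segments around each white point, and the outer face of `M` is the
unbounded one. For the latter, note that `w_0` is smaller than all other points, so that the ray
from `w_0` towards the south-west lies in the unbounded face. -/
structure Realization {n : ℕ} (π : Perm (Fin n)) (M : OrientedMap n) where
  point : Fin n ≃ Fin n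
  position : M.Vertex ≃ whitePoints π
  covered_iff : ∀ (v : M.Vertex) (e : Fin n),
    HasseEdge π (position v) (blackPoint π (point e)) ↔ v = M.tail e
  covering_iff : ∀ (v : M.Vertex) (e : Fin n),
    HasseEdge π (blackPoint π (point e)) (position v) ↔ v = M.head e
  next_ccw : ∀ d d' : HalfEdge n, M.vertexOf d' = M.vertexOf d →
    ccwAngle (directionArg (position (M.vertexOf d)) (blackPoint π (point d.1)))
        (directionArg (position (M.vertexOf (M.rot d))) (blackPoint π (point (M.rot d).1))) ≤
      ccwAngle (directionArg (position (M.vertexOf d)) (blackPoint π (point d.1)))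
        (directionArg (position (M.vertexOf d')) (blackPoint π (point d'.1)))
  outer_corner : ∃ d : HalfEdge n,
    (position (M.vertexOf d) : ℝ × ℝ) = firstPoint ∧ M.faceOf d = M.outerFace ∧
    ccwAngle (directionArg (position (M.vertexOf d)) (blackPoint π (point d.1)))
        (directionArg (0, 0) (-1, -1)) <
      ccwAngle (directionArg (position (M.vertexOf d)) (blackPoint π (point d.1)))
        (directionArg (position (M.vertexOf (M.rot d))) (blackPoint π (point (M.rot d).1)))

/-! ### Gaps of a permutation

The gap `g ∈ {0, …, n}` is the place between the positions `g - 1` and `g` of a permutation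
of `Fin n`. -/

section Gaps

variable {n : ℕ}

/-! The whole drawing is encoded by the gaps `0, …, n` between consecutive positions. White points
sit at the two extreme gaps and at the ascents. From a black point `i`, the head is the first gap to
the right followed by a larger value, and the tail, the right face and the left face are found by
analogous searches. So ascents become vertices, descents become inner faces, and Euler's relation is
a count of gaps.

The Baxter condition makes this reading agree with the product order. By `gapLevel_le_iff`,
comparing a later value with the level of a white point amounts to comparing it with the value just
before the gap. It follows that each black point has one cover and covers one point, and
`exists_blackPoint_between` shows that white points never cover each other. Absence of crossings is
then a purely order-theoretic consequence. Around a white point the counterclockwise order is the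
order of positions, decreasing on outgoing edges and then increasing on incoming ones, which gives
an explicit rotation system `permMap`. The realizations of the drawing are exactly the maps
isomorphic to it, and the parameters are read off from gaps equal to `0` or `n`.

Injectivity: consecutive positions share a vertex (ascent) or an inner face (descent), and these
adjacencies always increase the position. Hence the map determines the labels of its edges
(`labels_unique`). For `i < j`, the relation `π i < π j` says that a directed path leads from the
head of `i` to the tail of `j`, so the map also determines the values.

Surjectivity: Euler's relation and acyclicity force every inner vertex to have its incoming edges in
a row and every face to be bounded by two directed paths (`corner_bijective`). On the edges one has
"above" (one edge leaves the head of the other) and "beside" (left and right of an inner face). The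
transitive closures of these relations are disjoint strict orders, and two distinct edges are
comparable in exactly one of them. The edges are therefore ranked by `τ` ("above or to the right")
and by `ρ` ("above or to the left"), and the permutation is `ρ * τ⁻¹`. It is Baxter because two
edges with consecutive `τ`-ranks share a vertex or an inner face, and a forbidden pattern could be
rerouted through it. Finally, both rotation systems go through each vertex with a single descent of
the key, so they agree. -/

theorem exists_nextGap (r : Fin n → Fin n → Prop) (i : Fin n) :
    ∃ g : ℕ, (i : ℕ) < g ∧ ∀ k : Fin n, (k : ℕ) = g → r i k :=
  ⟨n, i.2, fun k hk => absurd k.2 (by omega)⟩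

open Classical in
/-- The first gap after `i` that is followed by a position related to `i`, or the last gap. -/
noncomputable def nextGap (r : Fin n → Fin n → Prop) (i : Fin n) : ℕ :=
  Nat.find (exists_nextGap r i)

open Classical in
/-- The last gap before `i` that follows a position related to `i`, or the first gap. -/
noncomputable def prevGap (r : Fin n → Fin n → Prop) (i : Fin n) : ℕ :=
  Nat.findGreatest (fun g => ∀ k : Fin n, (k : ℕ) + 1 = g → r k i) i

theorem nextGap_eq_iff (r : Fin n → Fin n → Prop) (i : Fin n) (g : ℕ) :
    nextGap r i = g ↔ (i : ℕ) < g ∧ g ≤ n ∧ (∀ k : Fin n, (k : ℕ) = g → r i k) ∧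
      ∀ k : Fin n, i < k → (k : ℕ) < g → ¬ r i k := by
  classical
  unfold nextGap
  rw [Nat.find_eq_iff]
  constructor
  · rintro ⟨⟨h1, h2⟩, h3⟩
    refine ⟨h1, ?_, h2, fun k hk hkg hr => h3 k hkg ⟨hk, fun k' hk' => ?_⟩⟩
    · by_contra hg
      exact h3 n (by omega) ⟨i.2, fun k hk => absurd k.2 (by omega)⟩
    · rwa [Fin.ext hk']
  · rintro ⟨h1, h2, h3, h4⟩
    refine ⟨⟨h1, h3⟩, fun m hm hm' => ?_⟩
    exact h4 ⟨m, by omega⟩ hm'.1 hm (hm'.2 _ rfl)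

theorem prevGap_eq_iff (r : Fin n → Fin n → Prop) (i : Fin n) (g : ℕ) :
    prevGap r i = g ↔ g ≤ i ∧ (∀ k : Fin n, (k : ℕ) + 1 = g → r k i) ∧
      ∀ k : Fin n, k < i → g ≤ k → ¬ r k i := by
  classical
  unfold prevGap
  rw [Nat.findGreatest_eq_iff]
  constructor
  · rintro ⟨h1, h2, h3⟩
    refine ⟨h1, fun k hk => h2 (by omega) k hk, fun k hk hgk hr => ?_⟩
    refine h3 (n := k + 1) (by omega) hk (fun k' hk' => ?_)
    rwa [show k' = k from Fin.ext (by omega)]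
  · rintro ⟨h1, h2, h3⟩
    refine ⟨h1, fun _ => h2, fun m hm hmi hm' => ?_⟩
    have hi := i.2
    exact h3 ⟨m - 1, by omega⟩ (Fin.lt_def.2 (by simp; omega)) (by simp; omega)
      (hm' _ (by simp; omega))

/-- The gap of the head of the edge `i`. -/
noncomputable def headGap (π : Perm (Fin n)) : Fin n → ℕ := nextGap fun i k => π i < π k

/-- The gap of the tail of the edge `i`. -/
noncomputable def tailGap (π : Perm (Fin n)) : Fin n → ℕ := prevGap fun k i => π k < π i

/-- The gap of the face to the right of the edge `i`. -/
noncomputable def rightGap (π : Perm (Fin n)) : Fin n → ℕ := nextGap fun i k => π k < π i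

/-- The gap of the face to the left of the edge `i`. -/
noncomputable def leftGap (π : Perm (Fin n)) : Fin n → ℕ := prevGap fun k i => π i < π k

variable {π : Perm (Fin n)} {i j k : Fin n} {g h : ℕ}

theorem val_apply_ne (π : Perm (Fin n)) (h : (i : ℕ) ≠ k) : (π i : ℕ) ≠ π k :=
  fun h' => h (congrArg Fin.val (π.injective (Fin.ext h')))

/-- Injectivity of `π` turns "not larger" into "strictly smaller", and everything is stated in
natural numbers, so that later comparisons are linear arithmetic. -/
theorem headGap_eq_iff : headGap π i = g ↔ (i : ℕ) < g ∧ g ≤ n ∧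
    (∀ k : Fin n, (k : ℕ) = g → (π i : ℕ) < π k) ∧
    ∀ k : Fin n, (i : ℕ) < k → (k : ℕ) < g → (π k : ℕ) < π i := by
  unfold headGap
  rw [nextGap_eq_iff]
  refine and_congr_right fun _ => and_congr_right fun _ => and_congr_right fun _ =>
    forall_congr' fun k => imp_congr_right fun h => imp_congr_right fun _ => ?_
  have := val_apply_ne π (i := i) (k := k) (by simp only [Fin.lt_def] at h; omega)
  simp only [Fin.lt_def]
  omega

theorem rightGap_eq_iff : rightGap π i = g ↔ (i : ℕ) < g ∧ g ≤ n ∧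
    (∀ k : Fin n, (k : ℕ) = g → (π k : ℕ) < π i) ∧
    ∀ k : Fin n, (i : ℕ) < k → (k : ℕ) < g → (π i : ℕ) < π k := by
  unfold rightGap
  rw [nextGap_eq_iff]
  refine and_congr_right fun _ => and_congr_right fun _ => and_congr_right fun _ =>
    forall_congr' fun k => imp_congr_right fun h => imp_congr_right fun _ => ?_
  have := val_apply_ne π (i := i) (k := k) (by simp only [Fin.lt_def] at h; omega)
  simp only [Fin.lt_def]
  omega

theorem tailGap_eq_iff : tailGap π i = g ↔ g ≤ i ∧
    (∀ k : Fin n, (k : ℕ) + 1 = g → (π k : ℕ) < π i) ∧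
    ∀ k : Fin n, (k : ℕ) < i → g ≤ k → (π i : ℕ) < π k := by
  unfold tailGap
  rw [prevGap_eq_iff]
  refine and_congr_right fun _ => and_congr_right fun _ =>
    forall_congr' fun k => imp_congr_right fun h => imp_congr_right fun _ => ?_
  have := val_apply_ne π (i := i) (k := k) (by simp only [Fin.lt_def] at h; omega)
  simp only [Fin.lt_def]
  omega

theorem leftGap_eq_iff : leftGap π i = g ↔ g ≤ i ∧
    (∀ k : Fin n, (k : ℕ) + 1 = g → (π i : ℕ) < π k) ∧
    ∀ k : Fin n, (k : ℕ) < i → g ≤ k → (π k : ℕ) < π i := by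
  unfold leftGap
  rw [prevGap_eq_iff]
  refine and_congr_right fun _ => and_congr_right fun _ =>
    forall_congr' fun k => imp_congr_right fun h => imp_congr_right fun _ => ?_
  have := val_apply_ne π (i := i) (k := k) (by simp only [Fin.lt_def] at h; omega)
  simp only [Fin.lt_def]
  omega

/-- The gaps of the white points: the two extreme ones and the ascents. -/
def IsWhiteGap (π : Perm (Fin n)) (g : ℕ) : Prop :=
  g ≤ n ∧ (0 < g → ∀ a b : Fin n, (a : ℕ) + 1 = g → (b : ℕ) = g → (π a : ℕ) < π b)

/-- The value just before the head gap is `π i` or smaller, and a value just after it exceeds `π i`.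
-/
theorem isWhiteGap_headGap (π : Perm (Fin n)) (i : Fin n) : IsWhiteGap π (headGap π i) := by
  obtain ⟨h1, h2, h3, h4⟩ := headGap_eq_iff.1 (rfl : headGap π i = _)
  refine ⟨h2, fun _ a b ha hb => ?_⟩
  have := h3 b hb
  rcases Nat.lt_or_ge i a with h | h
  · have := h4 a h (by omega)
    omega
  · rwa [show a = i from Fin.ext (by omega)]

theorem isWhiteGap_tailGap (π : Perm (Fin n)) (i : Fin n) : IsWhiteGap π (tailGap π i) := by
  obtain ⟨h1, h2, h3⟩ := tailGap_eq_iff.1 (rfl : tailGap π i = _)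
  refine ⟨by omega, fun _ a b ha hb => ?_⟩
  have := h2 a ha
  rcases Nat.lt_or_ge b i with h | h
  · have := h3 b h (by omega)
    omega
  · rwa [show b = i from Fin.ext (by omega)]

theorem IsWhiteGap.headGap_eq (hg : IsWhiteGap π g) (hi : (i : ℕ) + 1 = g) : headGap π i = g :=
  headGap_eq_iff.2 ⟨by omega, hg.1, fun k hk => hg.2 (by omega) i k hi hk,
    fun k h1 h2 => by omega⟩

theorem IsWhiteGap.tailGap_eq (hg : IsWhiteGap π g) (hi : (i : ℕ) = g) : tailGap π i = g :=
  tailGap_eq_iff.2 ⟨by omega, fun k hk => hg.2 (by omega) k i hk hi, fun k h1 h2 => by omega⟩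

theorem isWhiteGap_zero (π : Perm (Fin n)) : IsWhiteGap π 0 := ⟨Nat.zero_le _, fun h => by omega⟩

theorem isWhiteGap_last (π : Perm (Fin n)) : IsWhiteGap π n :=
  ⟨le_rfl, fun _ _ b _ hb => absurd b.2 (by omega)⟩

/-- A Baxter permutation cannot jump down over two values that occur on both sides. -/
theorem IsBaxter.not_jump_down (hπ : IsBaxter π) {i s t k : Fin n} (his : (i : ℕ) < s)
    (hst : (s : ℕ) < t) (htk : (t : ℕ) ≤ k) (h1 : (π t : ℕ) < π i) (h2 : (π i : ℕ) < π k)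
    (h3 : (π k : ℕ) < π s)
    (h4 : ∀ x : Fin n, (s : ℕ) < x → (x : ℕ) < t → (π x : ℕ) < π i ∨ (π k : ℕ) < π x) : False := by
  -- The start `s` moves right as long as the next value stays above `π k`. Since `π t < π i`, the
  -- drop below `π i` eventually occurs at consecutive positions and gives the forbidden pattern.
  suffices H : ∀ m : ℕ, ∀ s : Fin n, (t : ℕ) - s = m → (i : ℕ) < s → (s : ℕ) < t →
      (π k : ℕ) < π s →
      (∀ x : Fin n, (s : ℕ) < x → (x : ℕ) < t → (π x : ℕ) < π i ∨ (π k : ℕ) < π x) → False from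
    H _ s rfl his hst h3 h4
  intro m
  induction m with
  | zero => intro s; omega
  | succ m ih =>
    intro s hm his hst h3 h4
    have ht := t.2
    by_cases hlt : (π ⟨s + 1, by omega⟩ : ℕ) < π i
    · exact hπ ⟨i, s, ⟨s + 1, by omega⟩, k, his, Fin.lt_def.2 (by omega), rfl,
        Or.inl ⟨hlt, h2, h3⟩⟩
    · have hne : (s : ℕ) + 1 ≠ t := fun h => hlt (by
        rwa [show (⟨s + 1, by omega⟩ : Fin n) = t from Fin.ext h])
      exact ih ⟨s + 1, by omega⟩ (by simp; omega) (by simp; omega) (by simp; omega)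
        ((h4 ⟨s + 1, by omega⟩ (by simp) (by simp; omega)).resolve_left hlt)
        (fun x hx hx' => h4 x (by simp at hx; omega) hx')

/-! ### Levels of the white points -/

open Classical in
/-- The number of values below the white point of a gap. -/
noncomputable def gapLevel (π : Perm (Fin n)) (g : ℕ) : ℕ :=
  if g = 0 then 0 else if h : 0 < g ∧ g < n then ascentLevel π ⟨g - 1, by omega⟩ else n

theorem gapLevel_zero (π : Perm (Fin n)) : gapLevel π 0 = 0 := by simp [gapLevel]

theorem gapLevel_last (π : Perm (Fin n)) : gapLevel π n = n := by
  unfold gapLevel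
  split_ifs <;> omega

/-- At an inner gap the level is a supremum of values on the left that lie below the value at `g`,
shifted by one because values start at 0. It therefore tests values on the left without any Baxter
condition. -/
theorem lt_gapLevel_iff (π : Perm (Fin n)) (hi : (i : ℕ) < g) :
    (π i : ℕ) < gapLevel π g ↔ ∀ k : Fin n, (k : ℕ) = g → (π i : ℕ) < π k := by
  unfold gapLevel
  rw [if_neg (by omega)]
  split_ifs with h
  · unfold ascentLevel
    constructor
    · intro hlt k hk
      by_contra hcon
      refine absurd hlt (not_lt.2 (Finset.sup_le fun m hm => ?_))
      simp only [Finset.mem_filter, Finset.mem_univ, true_and] at hm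
      obtain ⟨hm1, b, hb, hmb⟩ := hm
      have : b = k := Fin.ext (by omega)
      subst this
      simp only [Fin.lt_def] at hmb
      omega
    · intro hlt
      refine Nat.lt_of_succ_le (Finset.le_sup (f := fun i => (π i : ℕ) + 1) ?_)
      simp only [Finset.mem_filter, Finset.mem_univ, true_and]
      exact ⟨Fin.le_def.2 (by simp; omega), ⟨g, h.2⟩, by simp; omega, hlt _ rfl⟩
  · exact ⟨fun _ k hk => absurd k.2 (by omega), fun _ => (π i).2⟩

/-- The maximum that defines the level is attained: the value just below a white point occurs to its
left. -/
theorem exists_succ_eq_gapLevel (hg : IsWhiteGap π g) (h0 : 0 < g) :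
    ∃ m : Fin n, (m : ℕ) < g ∧ (π m : ℕ) + 1 = gapLevel π g := by
  have hgn := hg.1
  by_cases h : g < n
  · have hw := hg.2 h0 ⟨g - 1, by omega⟩ ⟨g, h⟩ (by simp; omega) rfl
    have hne : (Finset.univ.filter fun i : Fin n => i ≤ ⟨g - 1, by omega⟩ ∧ ∃ j : Fin n,
        j.val = (⟨g - 1, by omega⟩ : Fin n).val + 1 ∧ π i < π j).Nonempty :=
      ⟨⟨g - 1, by omega⟩, by
        simp only [Finset.mem_filter, Finset.mem_univ, true_and, le_refl]
        exact ⟨⟨g, h⟩, by simp; omega, hw⟩⟩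
    obtain ⟨m, hm, hm'⟩ := Finset.exists_mem_eq_sup _ hne (fun i => (π i : ℕ) + 1)
    simp only [Finset.mem_filter, Finset.mem_univ, true_and, Fin.le_def] at hm
    refine ⟨m, by omega, ?_⟩
    unfold gapLevel
    rw [if_neg (by omega), dif_pos ⟨h0, h⟩, ← hm', ascentLevel]
  · have : g = n := by omega
    subst this
    rw [gapLevel_last]
    refine ⟨π.symm ⟨g - 1, by omega⟩, Fin.is_lt _, ?_⟩
    simp
    omega

/-- A later value strictly between `π (g - 1)` and the level would form the pattern `π j < π k < π i
< π (j + 1)` with the ascent at `g` and the position `m` of the value just below the white point. -/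
theorem gapLevel_le_iff (hπ : IsBaxter π) (hg : IsWhiteGap π g) (hk : g ≤ (k : ℕ)) :
    gapLevel π g ≤ π k ↔ ∀ a : Fin n, (a : ℕ) + 1 = g → (π a : ℕ) < π k := by
  have hkn := k.2
  rcases Nat.eq_zero_or_pos g with rfl | h0
  · rw [gapLevel_zero]
    exact ⟨fun _ a ha => by omega, fun _ => Nat.zero_le _⟩
  obtain ⟨m, hm, hm'⟩ := exists_succ_eq_gapLevel hg h0
  have hmb := (lt_gapLevel_iff π hm).1 (by omega) ⟨g, by omega⟩ rfl
  have hw := hg.2 h0 ⟨g - 1, by omega⟩ ⟨g, by omega⟩ (by simp; omega) rfl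
  constructor
  · intro hle a ha
    have := (lt_gapLevel_iff π (i := a) (by omega)).2 (fun k hk => hg.2 h0 a k ha hk)
    omega
  · intro h
    have hak := h ⟨g - 1, by omega⟩ (by simp; omega)
    by_contra hcon
    have h1 := val_apply_ne π (i := m) (k := k) (by omega)
    have h2 : (m : ℕ) ≠ g - 1 := by
      intro h
      rw [show m = ⟨g - 1, by omega⟩ from Fin.ext h] at hm'
      omega
    refine hπ ⟨m, ⟨g - 1, by omega⟩, ⟨g, by omega⟩, k, Fin.lt_def.2 (by simp; omega),
      Fin.lt_def.2 (by simp; omega), by simp; omega, Or.inr ⟨hak, Fin.lt_def.2 (by omega), hmb⟩⟩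

/-- The value just above a white point occurs to its right: on the left it would be below `π g`,
hence below the level. -/
theorem exists_eq_gapLevel (hg : IsWhiteGap π g) (hn : g < n) :
    ∃ k : Fin n, g ≤ (k : ℕ) ∧ (π k : ℕ) = gapLevel π g := by
  rcases Nat.eq_zero_or_pos g with rfl | h0
  · refine ⟨π.symm ⟨0, hn⟩, Nat.zero_le _, ?_⟩
    simp [gapLevel_zero]
  obtain ⟨m, hm, hm'⟩ := exists_succ_eq_gapLevel hg h0
  have hmb := (lt_gapLevel_iff π hm).1 (by omega) ⟨g, by omega⟩ rfl
  have hlt : gapLevel π g < n := by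
    have := (π ⟨g, by omega⟩).2
    omega
  refine ⟨π.symm ⟨_, hlt⟩, ?_, by simp⟩
  by_contra hcon
  have h1 := lt_gapLevel_iff π (g := g) (i := π.symm ⟨_, hlt⟩) (by omega)
  have h2 : ((π (π.symm ⟨_, hlt⟩) : Fin n) : ℕ) = gapLevel π g := by simp
  have h3 := val_apply_ne π (i := π.symm ⟨_, hlt⟩) (k := ⟨g, by omega⟩) (by simp; omega)
  refine absurd (h1.2 fun k hk => ?_) (by omega)
  rw [show k = ⟨g, by omega⟩ from Fin.ext hk]
  omega

end Gaps


/-! ### The order of the points of the drawing -/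

section Points

variable {n : ℕ} {π : Perm (Fin n)} {i j k : Fin n} {g h : ℕ}

/-- The white point of a gap. -/
noncomputable def whitePoint (π : Perm (Fin n)) (g : ℕ) : ℝ × ℝ :=
  ((g : ℝ) + 1 / 2, (gapLevel π g : ℝ) + 1 / 2)

theorem whitePoint_zero (π : Perm (Fin n)) : whitePoint π 0 = firstPoint := by
  simp [whitePoint, firstPoint, gapLevel_zero]

theorem whitePoint_last (π : Perm (Fin n)) : whitePoint π n = lastPoint n := by
  simp [whitePoint, lastPoint, gapLevel_last]

theorem whitePoint_injective (π : Perm (Fin n)) : Function.Injective (whitePoint π) := by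
  intro g h hgh
  have := congrArg Prod.fst hgh
  simpa [whitePoint] using this

/-- The ascent `a` is the gap `a + 1`, between the positions `a` and `a + 1`. This puts the poles
and the ascents into one family. -/
theorem mem_whitePoints_iff {p : ℝ × ℝ} :
    p ∈ whitePoints π ↔ ∃ g, IsWhiteGap π g ∧ whitePoint π g = p := by
  have key : ∀ a : Fin n, (h : (a : ℕ) + 1 < n) → ascentPoint π a = whitePoint π (a + 1) := by
    intro a h
    have : gapLevel π (a + 1) = ascentLevel π a := by
      unfold gapLevel
      rw [if_neg (by omega), dif_pos ⟨by omega, h⟩]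
      rfl
    simp [ascentPoint, whitePoint, this]
  unfold whitePoints
  constructor
  · rintro ((rfl | rfl) | ⟨a, ha, rfl⟩)
    · exact ⟨0, isWhiteGap_zero π, whitePoint_zero π⟩
    · exact ⟨n, isWhiteGap_last π, whitePoint_last π⟩
    · simp only [ascents, Finset.coe_filter, Finset.mem_univ, true_and, Set.mem_ofPred_eq] at ha
      obtain ⟨b, hb, hab⟩ := ha
      have hbn := b.2
      refine ⟨a + 1, ⟨by omega, fun _ a' b' ha' hb' => ?_⟩, (key a (by omega)).symm⟩
      rw [show a' = a from Fin.ext (by omega), show b' = b from Fin.ext (by omega)]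
      exact hab
  · rintro ⟨g, hg, rfl⟩
    have hgn := hg.1
    rcases Nat.eq_zero_or_pos g with rfl | h0
    · exact Or.inl (Or.inl (whitePoint_zero π))
    rcases Nat.lt_or_ge g n with h | h
    · refine Or.inr ⟨⟨g - 1, by omega⟩, ?_, ?_⟩
      · simp only [ascents, Finset.coe_filter, Finset.mem_univ, true_and, Set.mem_ofPred_eq]
        exact ⟨⟨g, h⟩, by simp; omega, hg.2 h0 _ _ (by simp; omega) rfl⟩
      · rw [key _ (by simp; omega)]
        congr 1
        simp; omega
    · rw [show g = n by omega]
      exact Or.inl (Or.inr (whitePoint_last π))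

/-- Black coordinates are integers and white ones half-integers, so coordinates of different colours
are never equal. -/
theorem cast_add_one_le_cast_add_half {a b : ℕ} : (a : ℝ) + 1 ≤ b + 1 / 2 ↔ a < b := by
  constructor
  · intro h
    by_contra hcon
    have : (b : ℝ) ≤ a := by exact_mod_cast not_lt.1 hcon
    linarith
  · intro h
    have : (a : ℝ) + 1 ≤ b := by exact_mod_cast h
    linarith

theorem cast_add_half_le_cast_add_one {a b : ℕ} : (a : ℝ) + 1 / 2 ≤ b + 1 ↔ a ≤ b := by
  constructor
  · intro h
    by_contra hcon
    have : (b : ℝ) + 1 ≤ a := by exact_mod_cast not_le.1 hcon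
    linarith
  · intro h
    have : (a : ℝ) ≤ b := by exact_mod_cast h
    linarith

theorem lt_iff_of_fst_ne {p q : ℝ × ℝ} (h : p.1 ≠ q.1) : p < q ↔ p.1 ≤ q.1 ∧ p.2 ≤ q.2 := by
  rw [lt_iff_le_and_ne, Prod.le_def]
  exact and_iff_left fun h' => h (congrArg _ h')

theorem cast_add_one_ne_cast_add_half (a b : ℕ) : (a : ℝ) + 1 ≠ b + 1 / 2 := fun h => by
  have h1 := cast_add_one_le_cast_add_half.1 h.le
  have h2 := cast_add_half_le_cast_add_one.1 h.ge
  omega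

theorem blackPoint_lt_whitePoint_iff :
    blackPoint π i < whitePoint π g ↔
      (i : ℕ) < g ∧ ∀ k : Fin n, (k : ℕ) = g → (π i : ℕ) < π k := by
  rw [lt_iff_of_fst_ne (cast_add_one_ne_cast_add_half _ _)]
  simp only [blackPoint, whitePoint, cast_add_one_le_cast_add_half]
  exact and_congr_right fun h => lt_gapLevel_iff π h

theorem whitePoint_lt_blackPoint_iff (hπ : IsBaxter π) (hg : IsWhiteGap π g) :
    whitePoint π g < blackPoint π i ↔
      g ≤ (i : ℕ) ∧ ∀ k : Fin n, (k : ℕ) + 1 = g → (π k : ℕ) < π i := by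
  rw [lt_iff_of_fst_ne (cast_add_one_ne_cast_add_half _ _).symm]
  simp only [blackPoint, whitePoint, cast_add_half_le_cast_add_one]
  exact and_congr_right fun h => gapLevel_le_iff hπ hg h

theorem blackPoint_injective (π : Perm (Fin n)) : Function.Injective (blackPoint π) := by
  intro i j h
  have := congrArg Prod.fst h
  simp only [blackPoint, add_left_inj, Nat.cast_inj] at this
  exact Fin.ext this

theorem blackPoint_lt_blackPoint_iff :
    blackPoint π i < blackPoint π k ↔ (i : ℕ) < k ∧ (π i : ℕ) < π k := by
  constructor
  · intro h
    have hne : (i : ℕ) ≠ k := fun h' => h.ne (by rw [Fin.ext h'])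
    have h' := h.le
    simp only [Prod.le_def, blackPoint, add_le_add_iff_right, Nat.cast_le] at h'
    have := val_apply_ne π hne
    omega
  · rintro ⟨h1, h2⟩
    rw [lt_iff_le_and_ne]
    refine ⟨?_, fun h => h1.ne (congrArg Fin.val (blackPoint_injective π h))⟩
    simp only [Prod.le_def, blackPoint, add_le_add_iff_right, Nat.cast_le]
    omega

theorem whitePoint_le_whitePoint_iff :
    whitePoint π g ≤ whitePoint π h ↔ g ≤ h ∧ gapLevel π g ≤ gapLevel π h := by
  simp [Prod.le_def, whitePoint]

theorem blackPoint_lt_headGap (π : Perm (Fin n)) (i : Fin n) :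
    blackPoint π i < whitePoint π (headGap π i) := by
  obtain ⟨h1, h2, h3, h4⟩ := headGap_eq_iff.1 (rfl : headGap π i = _)
  exact blackPoint_lt_whitePoint_iff.2 ⟨h1, h3⟩

theorem tailGap_lt_blackPoint (hπ : IsBaxter π) (i : Fin n) :
    whitePoint π (tailGap π i) < blackPoint π i := by
  obtain ⟨h1, h2, h3⟩ := tailGap_eq_iff.1 (rfl : tailGap π i = _)
  exact (whitePoint_lt_blackPoint_iff hπ (isWhiteGap_tailGap π i)).2 ⟨h1, h2⟩

/-- The values between `i` and its head gap are below `π i`, so `k` is not among them, and the value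
just before the gap is at most `π i`, hence less than `π k`. -/
theorem headGap_lt_of_blackPoint_lt (hπ : IsBaxter π) (h : blackPoint π i < blackPoint π k) :
    whitePoint π (headGap π i) < blackPoint π k := by
  obtain ⟨h1, h2⟩ := blackPoint_lt_blackPoint_iff.1 h
  obtain ⟨h3, h4, h5, h6⟩ := headGap_eq_iff.1 (rfl : headGap π i = _)
  refine (whitePoint_lt_blackPoint_iff hπ (isWhiteGap_headGap π i)).2 ⟨?_, fun a ha => ?_⟩
  · by_contra hcon
    have := h6 k h1 (by omega)
    omega
  · rcases Nat.lt_or_ge i a with h | h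
    · have := h6 a h (by omega)
      omega
    · rwa [show a = i from Fin.ext (by omega)]

theorem lt_tailGap_of_blackPoint_lt (h : blackPoint π i < blackPoint π k) :
    blackPoint π i < whitePoint π (tailGap π k) := by
  obtain ⟨h1, h2⟩ := blackPoint_lt_blackPoint_iff.1 h
  obtain ⟨h4, h5, h6⟩ := tailGap_eq_iff.1 (rfl : tailGap π k = _)
  refine blackPoint_lt_whitePoint_iff.2 ⟨?_, fun a ha => ?_⟩
  · by_contra hcon
    have := h6 i h1 (by omega)
    omega
  · rcases Nat.lt_or_ge a k with h | h
    · have := h6 a h (by omega)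
      omega
    · rwa [show a = k from Fin.ext (by omega)]

/-- For the levels, let `π m` be the value just below the head of `i`. If there is a position `g`,
its black point is above that of `i`, hence above the head of `i`, so `π m < π g` and `π m` is also
below the white point of `g`. -/
theorem headGap_le_of_blackPoint_lt_whitePoint (hπ : IsBaxter π) (hg : IsWhiteGap π g)
    (h : blackPoint π i < whitePoint π g) : whitePoint π (headGap π i) ≤ whitePoint π g := by
  obtain ⟨h1, h2⟩ := blackPoint_lt_whitePoint_iff.1 h
  have hgn := hg.1
  obtain ⟨h3, h4, h5, h6⟩ := headGap_eq_iff.1 (rfl : headGap π i = _)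
  have hw := isWhiteGap_headGap π i
  have hle : headGap π i ≤ g := by
    by_contra hcon
    have := h2 ⟨g, by omega⟩ rfl
    have := h6 ⟨g, by omega⟩ h1 (by simp; omega)
    omega
  refine whitePoint_le_whitePoint_iff.2 ⟨hle, ?_⟩
  rcases hle.eq_or_lt with heq | hlt
  · rw [heq]
  obtain ⟨m, hm, hm'⟩ := exists_succ_eq_gapLevel hw (by omega)
  have : (π m : ℕ) < gapLevel π g := (lt_gapLevel_iff π (by omega)).2 fun k hk => by
    have h7 := headGap_lt_of_blackPoint_lt hπ
      (blackPoint_lt_blackPoint_iff.2 ⟨by omega, h2 k hk⟩ : blackPoint π i < blackPoint π k)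
    have h8 := ((gapLevel_le_iff hπ hw (by omega)).2
      ((whitePoint_lt_blackPoint_iff hπ hw).1 h7).2)
    omega
  omega

theorem le_tailGap_of_whitePoint_lt_blackPoint (hπ : IsBaxter π) (hg : IsWhiteGap π g)
    (h : whitePoint π g < blackPoint π i) : whitePoint π g ≤ whitePoint π (tailGap π i) := by
  obtain ⟨h1, h2⟩ := (whitePoint_lt_blackPoint_iff hπ hg).1 h
  obtain ⟨h3, h4, h5⟩ := tailGap_eq_iff.1 (rfl : tailGap π i = _)
  have hw := isWhiteGap_tailGap π i
  have hi := i.2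
  have hle : g ≤ tailGap π i := by
    by_contra hcon
    have := h2 ⟨g - 1, by omega⟩ (by simp; omega)
    have := h5 ⟨g - 1, by omega⟩ (by simp; omega) (by simp; omega)
    omega
  refine whitePoint_le_whitePoint_iff.2 ⟨hle, ?_⟩
  rcases hle.eq_or_lt with heq | hlt
  · rw [heq]
  obtain ⟨m, hm, hm'⟩ := exists_eq_gapLevel hw (by omega)
  rw [← hm']
  refine (gapLevel_le_iff hπ hg (by omega)).2 fun k hk => ?_
  have h7 := lt_tailGap_of_blackPoint_lt
      (blackPoint_lt_blackPoint_iff.2 ⟨by omega, h2 k hk⟩ : blackPoint π k < blackPoint π i)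
  have h8 := ((lt_gapLevel_iff π (by omega)).2 (blackPoint_lt_whitePoint_iff.1 h7).2)
  omega

/-- If there were none, the value at `g` would be at least the level of `h`. When the levels differ,
the value just below the level of `h` must then occur left of `g`, which forces it under the level
of `g`. When they agree, the values just below and just above the common level occur left of `g` and
right of `h`, and the values from `g` to `h - 1` jump down over both, against `not_jump_down`. -/
theorem exists_blackPoint_between (hπ : IsBaxter π) (hg : IsWhiteGap π g) (hh : IsWhiteGap π h)
    (hlt : whitePoint π g < whitePoint π h) :
    ∃ i, whitePoint π g < blackPoint π i ∧ blackPoint π i < whitePoint π h := by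
  obtain ⟨h1, h2⟩ := whitePoint_le_whitePoint_iff.1 hlt.le
  have hgh : g < h := lt_of_le_of_ne h1 fun h => hlt.ne (by rw [h])
  have hhn := hh.1
  obtain ⟨m, hm, hm'⟩ := exists_succ_eq_gapLevel hh (by omega)
  have bw : ∀ i : Fin n, blackPoint π i < whitePoint π h ↔
      (i : ℕ) < h ∧ (π i : ℕ) < gapLevel π h := fun i => by
    rw [blackPoint_lt_whitePoint_iff]
    exact and_congr_right fun h => (lt_gapLevel_iff π h).symm
  have wb : ∀ i : Fin n, whitePoint π g < blackPoint π i ↔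
      g ≤ (i : ℕ) ∧ gapLevel π g ≤ π i := fun i => by
    rw [whitePoint_lt_blackPoint_iff hπ hg]
    exact and_congr_right fun h => (gapLevel_le_iff hπ hg h).symm
  simp only [bw, wb]
  by_contra hcon
  push Not at hcon
  have hgw : gapLevel π g ≤ π ⟨g, by omega⟩ :=
    (gapLevel_le_iff hπ hg le_rfl).2 fun a ha => hg.2 (by omega) a _ ha rfl
  have hg1 := hcon ⟨g, by omega⟩ ⟨le_rfl, hgw⟩ hgh
  have hhlt : h < n := by
    by_contra hnot
    have : gapLevel π h = n := by
      rw [show h = n by omega]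
      exact gapLevel_last π
    have := (π ⟨g, by omega⟩).2
    omega
  rcases h2.lt_or_eq with hlt' | heq
  · have hmg : (m : ℕ) < g := by
      by_contra hnot
      have := hcon m ⟨by omega, by omega⟩ hm
      omega
    have := (lt_gapLevel_iff π hmg).2 fun k hk => by
      rw [show k = ⟨g, by omega⟩ from Fin.ext hk]; omega
    omega
  · have hg0 : 0 < g := by
      by_contra hnot
      have := gapLevel_zero π
      rw [show g = 0 by omega] at heq
      omega
    obtain ⟨m', h3, h4⟩ := exists_succ_eq_gapLevel hg hg0
    have hmg : (m : ℕ) < g := by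
      by_contra hnot
      have := val_apply_ne π (i := m) (k := m') (by omega)
      omega
    obtain ⟨k, hk, hk'⟩ := exists_eq_gapLevel hh hhlt
    have hlast := (lt_gapLevel_iff π (g := h) (i := ⟨h - 1, by omega⟩) (by simp; omega)).2
      fun k hk => hh.2 (by omega) _ _ (by simp; omega) hk
    have h3 := val_apply_ne π (i := ⟨g, by omega⟩) (k := k) (by simp; omega)
    have h4 := val_apply_ne π (i := ⟨h - 1, by omega⟩) (k := m) (by simp; omega)
    have h5 : g ≠ h - 1 := by
      intro h5
      rw [show (⟨h - 1, by omega⟩ : Fin n) = ⟨g, by omega⟩ from Fin.ext h5.symm] at hlast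
      omega
    refine hπ.not_jump_down (i := m) (s := ⟨g, by omega⟩) (t := ⟨h - 1, by omega⟩) (k := k)
      (by simp; omega) (by simp; omega) (by simp; omega) (by omega) (by omega) (by omega)
      fun x hx hx' => ?_
    simp only at hx hx'
    have h6 := val_apply_ne π (i := x) (k := k) (by omega)
    have h7 := val_apply_ne π (i := x) (k := m) (by omega)
    omega

/-! ### The edges of the drawing -/

theorem blackPoint_mem (π : Perm (Fin n)) (i : Fin n) :
    blackPoint π i ∈ blackPoints π ∪ whitePoints π := Or.inl ⟨i, rfl⟩

theorem IsWhiteGap.mem_whitePoints (hg : IsWhiteGap π g) : whitePoint π g ∈ whitePoints π :=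
  mem_whitePoints_iff.2 ⟨g, hg, rfl⟩

theorem mem_points_iff {p : ℝ × ℝ} : p ∈ blackPoints π ∪ whitePoints π ↔
    (∃ i, blackPoint π i = p) ∨ ∃ g, IsWhiteGap π g ∧ whitePoint π g = p := by
  rw [Set.mem_union, mem_whitePoints_iff]
  rfl

theorem headGap_le_of_blackPoint_lt (hπ : IsBaxter π) {q : ℝ × ℝ}
    (hq : q ∈ blackPoints π ∪ whitePoints π) (h : blackPoint π i < q) :
    whitePoint π (headGap π i) ≤ q := by
  rcases mem_points_iff.1 hq with ⟨k, rfl⟩ | ⟨g, hg, rfl⟩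
  · exact (headGap_lt_of_blackPoint_lt hπ h).le
  · exact headGap_le_of_blackPoint_lt_whitePoint hπ hg h

theorem le_tailGap_of_lt_blackPoint (hπ : IsBaxter π) {q : ℝ × ℝ}
    (hq : q ∈ blackPoints π ∪ whitePoints π) (h : q < blackPoint π i) :
    q ≤ whitePoint π (tailGap π i) := by
  rcases mem_points_iff.1 hq with ⟨k, rfl⟩ | ⟨g, hg, rfl⟩
  · exact (lt_tailGap_of_blackPoint_lt h).le
  · exact le_tailGap_of_whitePoint_lt_blackPoint hπ hg h

theorem hasseEdge_blackPoint_left_iff (hπ : IsBaxter π) {q : ℝ × ℝ} :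
    HasseEdge π (blackPoint π i) q ↔ q = whitePoint π (headGap π i) := by
  have hmem : whitePoint π (headGap π i) ∈ blackPoints π ∪ whitePoints π :=
    Or.inr (isWhiteGap_headGap π i).mem_whitePoints
  constructor
  · rintro ⟨-, hq, hlt, h⟩
    by_contra hne
    exact h _ hmem ⟨blackPoint_lt_headGap π i,
      lt_of_le_of_ne (headGap_le_of_blackPoint_lt hπ hq hlt) (Ne.symm hne)⟩
  · rintro rfl
    exact ⟨blackPoint_mem π i, hmem, blackPoint_lt_headGap π i, fun r hr h =>
      (headGap_le_of_blackPoint_lt hπ hr h.1).not_gt h.2⟩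

theorem hasseEdge_blackPoint_right_iff (hπ : IsBaxter π) {p : ℝ × ℝ} :
    HasseEdge π p (blackPoint π i) ↔ p = whitePoint π (tailGap π i) := by
  have hmem : whitePoint π (tailGap π i) ∈ blackPoints π ∪ whitePoints π :=
    Or.inr (isWhiteGap_tailGap π i).mem_whitePoints
  constructor
  · rintro ⟨hp, -, hlt, h⟩
    by_contra hne
    exact h _ hmem ⟨lt_of_le_of_ne (le_tailGap_of_lt_blackPoint hπ hp hlt) hne,
      tailGap_lt_blackPoint hπ i⟩
  · rintro rfl
    exact ⟨hmem, blackPoint_mem π i, tailGap_lt_blackPoint hπ i, fun r hr h =>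
      (le_tailGap_of_lt_blackPoint hπ hr h.2).not_gt h.1⟩

theorem isBicolored (hπ : IsBaxter π) : IsBicolored π := by
  intro p q hpq
  rcases mem_points_iff.1 hpq.1 with ⟨i, rfl⟩ | ⟨g, hg, rfl⟩
  · rw [hasseEdge_blackPoint_left_iff hπ] at hpq
    subst hpq
    exact Or.inl ⟨⟨i, rfl⟩, (isWhiteGap_headGap π i).mem_whitePoints⟩
  · rcases mem_points_iff.1 hpq.2.1 with ⟨i, rfl⟩ | ⟨h, hh, rfl⟩
    · exact Or.inr ⟨hg.mem_whitePoints, ⟨i, rfl⟩⟩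
    · obtain ⟨i, hi⟩ := exists_blackPoint_between hπ hg hh hpq.2.2.1
      exact absurd hi (hpq.2.2.2 _ (blackPoint_mem π i))

theorem existsUnique_hasseEdge (hπ : IsBaxter π) {b : ℝ × ℝ} (hb : b ∈ blackPoints π) :
    (∃! p, HasseEdge π p b) ∧ ∃! q, HasseEdge π b q := by
  obtain ⟨i, rfl⟩ := hb
  simp only [hasseEdge_blackPoint_left_iff hπ, hasseEdge_blackPoint_right_iff hπ,
    existsUnique_eq, and_self]

/-- Two points that cover the same point do not lie on the same ray from it. -/
theorem HasseEdge.left_eq_of_mem_segment {p q q' x : ℝ × ℝ} (h : HasseEdge π p q)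
    (h' : HasseEdge π p q') (hne : q ≠ q') (hx : x ∈ segment ℝ p q) (hx' : x ∈ segment ℝ p q') :
    x = p := by
  by_contra hxp
  rw [segment_eq_image_lineMap] at hx hx'
  obtain ⟨s, hs, rfl⟩ := hx
  obtain ⟨t, ht, hst⟩ := hx'
  rw [AffineMap.lineMap_apply, AffineMap.lineMap_apply] at hst
  simp only [vsub_eq_sub, vadd_eq_add, add_left_inj] at hst
  have hs0 : 0 < s := lt_of_le_of_ne hs.1 fun h => hxp (by rw [← h, AffineMap.lineMap_apply_zero])
  have ht0 : 0 < t := by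
    refine lt_of_le_of_ne ht.1 fun h => ?_
    rw [← h, zero_smul] at hst
    rcases smul_eq_zero.1 hst.symm with h | h
    · exact hs0.ne' h
    · exact hxp (by rw [AffineMap.lineMap_apply, vsub_eq_sub, h, smul_zero, vadd_eq_add, zero_add])
  have h1 : t * (q'.1 - p.1) = s * (q.1 - p.1) := by
    have := congrArg Prod.fst hst
    simpa using this
  have h2 : t * (q'.2 - p.2) = s * (q.2 - p.2) := by
    have := congrArg Prod.snd hst
    simpa using this
  have hq := Prod.le_def.1 h.2.2.1.le
  have hq' := Prod.le_def.1 h'.2.2.1.le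
  -- The two edges are positive multiples of one another, so the end of the shorter one lies below
  -- the end of the longer one, which is then not a cover.
  rcases le_total s t with hle | hle
  · refine h.2.2.2 q' h'.2.1 ⟨h'.2.2.1, lt_of_le_of_ne (Prod.le_def.2 ⟨?_, ?_⟩) hne.symm⟩
    · nlinarith [hq.1, hq'.1]
    · nlinarith [hq.2, hq'.2]
  · refine h'.2.2.2 q h.2.1 ⟨h.2.2.1, lt_of_le_of_ne (Prod.le_def.2 ⟨?_, ?_⟩) hne⟩
    · nlinarith [hq.1, hq'.1]
    · nlinarith [hq.2, hq'.2]

/-- Two points covered by the same point do not lie on the same ray from it. -/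
theorem HasseEdge.right_eq_of_mem_segment {p p' q x : ℝ × ℝ} (h : HasseEdge π p q)
    (h' : HasseEdge π p' q) (hne : p ≠ p') (hx : x ∈ segment ℝ p q) (hx' : x ∈ segment ℝ p' q) :
    x = q := by
  by_contra hxp
  rw [segment_symm, segment_eq_image_lineMap] at hx hx'
  obtain ⟨s, hs, rfl⟩ := hx
  obtain ⟨t, ht, hst⟩ := hx'
  rw [AffineMap.lineMap_apply, AffineMap.lineMap_apply] at hst
  simp only [vsub_eq_sub, vadd_eq_add, add_left_inj] at hst
  have hs0 : 0 < s := lt_of_le_of_ne hs.1 fun h => hxp (by rw [← h, AffineMap.lineMap_apply_zero])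
  have ht0 : 0 < t := by
    refine lt_of_le_of_ne ht.1 fun h => ?_
    rw [← h, zero_smul] at hst
    rcases smul_eq_zero.1 hst.symm with h | h
    · exact hs0.ne' h
    · exact hxp (by rw [AffineMap.lineMap_apply, vsub_eq_sub, h, smul_zero, vadd_eq_add, zero_add])
  have h1 : t * (p'.1 - q.1) = s * (p.1 - q.1) := by
    have := congrArg Prod.fst hst
    simpa using this
  have h2 : t * (p'.2 - q.2) = s * (p.2 - q.2) := by
    have := congrArg Prod.snd hst
    simpa using this
  have hq := Prod.le_def.1 h.2.2.1.le
  have hq' := Prod.le_def.1 h'.2.2.1.le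
  rcases le_total s t with hle | hle
  · refine h.2.2.2 p' h'.1 ⟨lt_of_le_of_ne (Prod.le_def.2 ⟨?_, ?_⟩) hne, h'.2.2.1⟩
    · nlinarith [hq.1, hq'.1]
    · nlinarith [hq.2, hq'.2]
  · refine h'.2.2.2 p h.1 ⟨lt_of_le_of_ne (Prod.le_def.2 ⟨?_, ?_⟩) hne.symm, h.2.2.1⟩
    · nlinarith [hq.1, hq'.1]
    · nlinarith [hq.2, hq'.2]

/-- Away from common ends only the bounding boxes matter: a common point `x` gives `p ≤ x ≤ q'` and
`p' ≤ x ≤ q`. If no ends coincide and `p` is black, its unique cover `q` lies below `q'`, so `p' < q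
< q'` contradicts the covering of `p'` by `q'`. The case of a black `q` is dual. -/
theorem hasNoCrossing (hπ : IsBaxter π) : HasNoCrossing π := by
  intro p q p' q' h h' hne x hx
  have hx1 := segment_subset_Icc h.2.2.1.le hx.1
  have hx2 := segment_subset_Icc h'.2.2.1.le hx.2
  have hpq' : p ≤ q' := hx1.1.trans hx2.2
  have hp'q : p' ≤ q := hx2.1.trans hx1.2
  by_cases hp : p = p'
  · subst hp
    have hqq : q ≠ q' := fun h => hne (by rw [h])
    have := h.left_eq_of_mem_segment h' hqq hx.1 hx.2
    simp [this]
  by_cases hq : q = q'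
  · subst hq
    have := h.right_eq_of_mem_segment h' hp hx.1 hx.2
    simp [this]
  rcases hpq'.eq_or_lt with heq | hlt
  · subst heq
    have : x = p := le_antisymm hx2.2 hx1.1
    simp [this]
  rcases hp'q.eq_or_lt with heq | hlt'
  · subst heq
    have : x = p' := le_antisymm hx1.2 hx2.1
    simp [this]
  exfalso
  rcases isBicolored hπ p q h with ⟨⟨i, rfl⟩, -⟩ | ⟨-, ⟨i, rfl⟩⟩
  · have h1 := headGap_le_of_blackPoint_lt hπ h'.2.1 hlt
    rw [← (hasseEdge_blackPoint_left_iff hπ).1 h] at h1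
    exact h'.2.2.2 q h.2.1 ⟨hlt', lt_of_le_of_ne h1 hq⟩
  · have h1 := le_tailGap_of_lt_blackPoint hπ h'.1 hlt'
    rw [← (hasseEdge_blackPoint_right_iff hπ).1 h] at h1
    exact h'.2.2.2 p h.1 ⟨lt_of_le_of_ne h1 (Ne.symm hp), hlt⟩

end Points


/-! ### Cyclic successors in the fibres of a function -/

section CyclicNext

variable {α β : Type*} {f : α → β} {κ : α → ℤ} {d d' z z' : α}

/-- `z` is the cyclic successor of `d` in its fibre of `f`, for the order given by `κ`. -/
def IsCyclicNext (f : α → β) (κ : α → ℤ) (d z : α) : Prop :=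
  f z = f d ∧ ((κ d < κ z ∧ ∀ d', f d' = f d → κ d < κ d' → κ z ≤ κ d') ∨
    ∀ d', f d' = f d → κ d' ≤ κ d ∧ κ z ≤ κ d')

theorem exists_isCyclicNext [Finite α] (f : α → β) (κ : α → ℤ) (d : α) :
    ∃ z, IsCyclicNext f κ d z := by
  classical
  have := Fintype.ofFinite α
  by_cases h : ∃ d', f d' = f d ∧ κ d < κ d'
  · obtain ⟨d', hd'⟩ := h
    obtain ⟨z, hz, hz'⟩ := (Finset.univ.filter fun z => f z = f d ∧ κ d < κ z).exists_min_image κ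
      ⟨d', by simpa using hd'⟩
    simp only [Finset.mem_filter, Finset.mem_univ, true_and] at hz hz'
    exact ⟨z, hz.1, Or.inl ⟨hz.2, fun d' h1 h2 => hz' d' ⟨h1, h2⟩⟩⟩
  · push Not at h
    obtain ⟨z, hz, hz'⟩ := (Finset.univ.filter fun z => f z = f d).exists_min_image κ
      ⟨d, by simp⟩
    simp only [Finset.mem_filter, Finset.mem_univ, true_and] at hz hz'
    exact ⟨z, hz, Or.inr fun d' h1 => ⟨h d' h1, hz' d' h1⟩⟩

theorem IsCyclicNext.right_unique (hκ : Function.Injective κ) (h : IsCyclicNext f κ d z)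
    (h' : IsCyclicNext f κ d z') : z = z' := by
  apply hκ
  obtain ⟨hf, h | h⟩ := h <;> obtain ⟨hf', h' | h'⟩ := h'
  · exact le_antisymm (h.2 _ hf' h'.1) (h'.2 _ hf h.1)
  · have := (h' z hf).1
    have := h.1
    omega
  · have := (h z' hf').1
    have := h'.1
    omega
  · exact le_antisymm (h _ hf').2 (h' _ hf).2

theorem IsCyclicNext.left_unique (hκ : Function.Injective κ) (h : IsCyclicNext f κ d z)
    (h' : IsCyclicNext f κ d' z) : d = d' := by
  by_contra hne
  have hne' : κ d ≠ κ d' := fun h => hne (hκ h)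
  obtain ⟨hf, h⟩ := h
  obtain ⟨hf', h'⟩ := h'
  have hdd : f d' = f d := by rw [← hf, hf']
  rcases h with h | h <;> rcases h' with h' | h'
  · have h1 := h.2 d' hdd
    have h2 := h'.2 d hdd.symm
    have h3 := h.1
    have h4 := h'.1
    omega
  · have h1 := h' d hdd.symm
    have h3 := h.1
    omega
  · have h1 := h d' hdd
    have h3 := h'.1
    omega
  · have h1 := (h d' hdd).1
    have h2 := (h' d hdd.symm).1
    omega

/-- The permutation that sends every element to its cyclic successor. -/
noncomputable def cyclicNext [Finite α] (f : α → β) (κ : α → ℤ) (hκ : Function.Injective κ) :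
    Perm α :=
  Equiv.ofBijective (fun d => (exists_isCyclicNext f κ d).choose)
    (Finite.injective_iff_bijective.1 fun d d' h =>
      (exists_isCyclicNext f κ d).choose_spec.left_unique hκ
        (by rw [show (exists_isCyclicNext f κ d).choose = _ from h]
            exact (exists_isCyclicNext f κ d').choose_spec))

theorem isCyclicNext_cyclicNext [Finite α] (hκ : Function.Injective κ) (d : α) :
    IsCyclicNext f κ d (cyclicNext f κ hκ d) :=
  (exists_isCyclicNext f κ d).choose_spec

theorem Equiv.Perm.SameCycle.induction_on [Finite α] {σ : Perm α} {x y : α}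
    (h : σ.SameCycle x y) {p : α → Prop} (hx : p x) (hp : ∀ z, p z → p (σ z)) : p y := by
  obtain ⟨k, hk⟩ := h.exists_nat_pow_eq
  rw [← hk]
  clear hk
  induction k with
  | zero => exact hx
  | succ k ih =>
    rw [pow_succ', Perm.mul_apply]
    exact hp _ ih

theorem Equiv.Perm.sameCycle_apply_self_right {σ : Perm α} {x : α} : σ.SameCycle x (σ x) :=
  Perm.sameCycle_apply_right.2 (Perm.SameCycle.refl _ _)

/-- The element of a cycle with the largest key has no larger successor, so it wraps around and is
the maximum of its fibre. Cycles in the same fibre share this element. -/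
theorem sameCycle_cyclicNext_iff [Finite α] (hκ : Function.Injective κ) :
    (cyclicNext f κ hκ).SameCycle d d' ↔ f d = f d' := by
  set σ := cyclicNext f κ hκ with hσ
  have hσf : ∀ d, f (σ d) = f d := fun d => (isCyclicNext_cyclicNext hκ d).1
  have hmax : ∀ d, ∃ z, σ.SameCycle d z ∧ ∀ d', f d' = f d → κ d' ≤ κ z := by
    intro d
    have hfin : {z | σ.SameCycle d z}.Finite := Set.toFinite _
    obtain ⟨z, hz, hz'⟩ := hfin.exists_maximalFor κ _ ⟨d, Perm.SameCycle.refl _ _⟩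
    have hfz : f z = f d := (Perm.SameCycle.induction_on (p := fun z => f z = f d) hz rfl
      fun x hx => by rw [hσf, hx])
    refine ⟨z, hz, fun d' hd' => ?_⟩
    obtain ⟨h1, h2 | h2⟩ := isCyclicNext_cyclicNext (f := f) hκ z
    · have h3 := @hz' (σ z) (Perm.sameCycle_apply_right.2 hz) h2.1.le
      have := h2.1
      rw [hσ] at h3
      omega
    · exact (h2 d' (by rw [hd', hfz])).1
  constructor
  · intro h
    exact Perm.SameCycle.induction_on (p := fun z => f d = f z) h rfl fun x hx => by rw [hσf, hx]
  · intro h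
    obtain ⟨z, hz, hz'⟩ := hmax d
    obtain ⟨w, hw, hw'⟩ := hmax d'
    have hfz : f z = f d := (Perm.SameCycle.induction_on (p := fun z => f z = f d) hz rfl
      fun x hx => by rw [hσf, hx])
    have hfw : f w = f d' := (Perm.SameCycle.induction_on (p := fun z => f z = f d') hw rfl
      fun x hx => by rw [hσf, hx])
    have : z = w := hκ (le_antisymm (hw' z (by rw [hfz, h])) (hz' w (by rw [hfw, h])))
    subst this
    exact hz.trans hw.symm

/-- A permutation that goes through each fibre of `f` with a single descent is the permutation of
the cyclic successors. -/
theorem isCyclicNext_of_unique_descent [Finite α] {σ : Perm α}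
    (hσ : ∀ d d', σ.SameCycle d d' ↔ f d = f d')
    (h : ∀ d d', f d = f d' → κ (σ d) ≤ κ d → κ (σ d') ≤ κ d' → d = d') (d : α) :
    IsCyclicNext f κ d (σ d) := by
  have hf : ∀ x, f (σ x) = f x := fun x => ((hσ _ _).1 Perm.sameCycle_apply_self_right).symm
  have hD : ∃ D, σ.SameCycle d D ∧ κ (σ D) ≤ κ D := by
    have hfin : {z | σ.SameCycle d z}.Finite := Set.toFinite _
    obtain ⟨z, hz, hz'⟩ := hfin.exists_maximalFor κ _ ⟨d, Perm.SameCycle.refl _ _⟩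
    refine ⟨z, hz, ?_⟩
    by_contra hcon
    exact hcon (@hz' (σ z) (Perm.sameCycle_apply_right.2 hz) (by omega))
  obtain ⟨D, hdD, hDD⟩ := hD
  -- Cutting the cycle at its descent `D` leaves a chain that increases along `κ` and ends at `D`.
  -- The cyclic successors are read off from this chain.
  set A : α → α → Prop := fun y z => z = σ y ∧ y ≠ D with hA
  have reach : ∀ x, f x = f d → Relation.ReflTransGen A x D := by
    intro x hx
    have hxD : σ.SameCycle x D := ((hσ _ _).2 hx).trans hdD
    obtain ⟨k, hk⟩ := hxD.exists_nat_pow_eq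
    clear hxD hx
    induction k generalizing x with
    | zero => rw [← hk]; exact Relation.ReflTransGen.refl
    | succ k ih =>
      by_cases hx : x = D
      · rw [hx]
      · rw [pow_succ, Perm.mul_apply] at hk
        exact Relation.ReflTransGen.head ⟨rfl, hx⟩ (ih _ hk)
  have mono : ∀ x y, f x = f d → Relation.ReflTransGen A x y → κ x ≤ κ y ∧ f y = f d := by
    intro x y hx hxy
    induction hxy with
    | refl => exact ⟨le_rfl, hx⟩
    | tail _ h2 ih =>
      obtain ⟨rfl, h3⟩ := h2
      refine ⟨ih.1.trans ?_, by rw [hf, ih.2]⟩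
      by_contra hcon
      exact h3 (h _ _ (by rw [ih.2, (hσ _ _).1 hdD]) (by omega) hDD)
  have total : ∀ x y, f x = f d → f y = f d →
      Relation.ReflTransGen A x y ∨ Relation.ReflTransGen A y x := by
    intro x y hx hy
    have hswap : Relator.RightUnique (Function.swap A) := by
      rintro a b c ⟨h1, -⟩ ⟨h2, -⟩
      exact σ.injective (h1.symm.trans h2)
    have := Relation.ReflTransGen.total_of_right_unique hswap
      (Relation.reflTransGen_swap.2 (reach x hx)) (Relation.reflTransGen_swap.2 (reach y hy))
    exact this.symm.imp Relation.reflTransGen_swap.1 Relation.reflTransGen_swap.1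
  refine ⟨hf d, ?_⟩
  by_cases hd : d = D
  · subst hd
    refine Or.inr fun x hx => ⟨(mono x d hx (reach x hx)).1, ?_⟩
    have h1 := reach (σ d) (hf d)
    rcases total (σ d) x (hf d) hx with h2 | h2
    · exact (mono _ _ (hf d) h2).1
    · rcases Relation.ReflTransGen.cases_tail h2 with h3 | ⟨y, -, h3, h4⟩
      · rw [h3]
      · exact absurd (σ.injective h3).symm h4
  · have hlt : κ d < κ (σ d) := by
      by_contra hcon
      exact hd (h _ _ ((hσ _ _).1 hdD) (by omega) hDD)
    refine Or.inl ⟨hlt, fun x hx hdx => ?_⟩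
    rcases total d x rfl hx with h2 | h2
    · rcases Relation.ReflTransGen.cases_head h2 with h3 | ⟨y, ⟨rfl, -⟩, h3⟩
      · rw [h3] at hdx
        omega
      · exact (mono _ _ (hf d) h3).1
    · have := (mono _ _ hx h2).1
      omega

end CyclicNext


/-! ### The combinatorial map of a permutation -/

section PermMap

variable {n : ℕ} {π : Perm (Fin n)} {i i' j j' k : Fin n} {g : ℕ}

/-- The gap of the vertex of a half-edge. -/
noncomputable def vertexGap (π : Perm (Fin n)) (d : HalfEdge n) : ℕ :=
  if d.2 then tailGap π d.1 else headGap π d.1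

/-- The gap of the face to the left of a half-edge; the outer face has gap `0`. -/
noncomputable def faceGap (π : Perm (Fin n)) (d : HalfEdge n) : ℕ :=
  if d.2 then leftGap π d.1 else if rightGap π d.1 = n then 0 else rightGap π d.1

/-- The key that sorts the half-edges around a vertex counterclockwise, starting from the south
east. -/
def dartKey (d : HalfEdge n) : ℤ := if d.2 then -((d.1 : ℤ) + 1) else d.1

@[simp] theorem dartKey_true (i : Fin n) : dartKey (i, true) = -((i : ℤ) + 1) := rfl
@[simp] theorem dartKey_false (i : Fin n) : dartKey (i, false) = i := rfl
@[simp] theorem vertexGap_true (π : Perm (Fin n)) (i : Fin n) :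
    vertexGap π (i, true) = tailGap π i := rfl
@[simp] theorem vertexGap_false (π : Perm (Fin n)) (i : Fin n) :
    vertexGap π (i, false) = headGap π i := rfl
@[simp] theorem faceGap_true (π : Perm (Fin n)) (i : Fin n) :
    faceGap π (i, true) = leftGap π i := rfl
theorem faceGap_false (π : Perm (Fin n)) (i : Fin n) :
    faceGap π (i, false) = if rightGap π i = n then 0 else rightGap π i := rfl
@[simp] theorem oppositeHalf_apply (d : HalfEdge n) : oppositeHalf n d = (d.1, !d.2) := rfl
theorem oppositeHalf_mul_self : oppositeHalf n * oppositeHalf n = 1 := by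
  ext d <;> simp
theorem oppositeHalf_inv : (oppositeHalf n)⁻¹ = oppositeHalf n :=
  inv_eq_of_mul_eq_one_left oppositeHalf_mul_self

theorem dartKey_injective : Function.Injective (dartKey (n := n)) := by
  rintro ⟨i, _ | _⟩ ⟨j, _ | _⟩ h <;> simp at h
  · rw [Fin.ext h]
  · omega
  · omega
  · rw [Fin.ext h]

/-- The map obtained from the drawing of a permutation by erasing the black points. -/
noncomputable def permMap (π : Perm (Fin n)) (hn : 1 ≤ n) : OrientedMap n where
  rot := cyclicNext (vertexGap π) dartKey dartKey_injective
  outer := Quotient.mk _ (⟨0, hn⟩, true)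

/-- The face between two neighbouring incoming edges has its gap just after the left one, where the
value drops. The last intermediate value above `π i'` would belong to another edge with the same
head between the two. -/
theorem gaps_of_consecutive_in (h : headGap π i = headGap π i') (hlt : (i : ℕ) < i')
    (hcon : ∀ m : Fin n, (i : ℕ) < m → headGap π m = headGap π i → (i' : ℕ) ≤ m) :
    rightGap π i = i + 1 ∧ leftGap π i' = i + 1 := by
  obtain ⟨h1, h2, h3, h4⟩ := headGap_eq_iff.1 (rfl : headGap π i = _)
  obtain ⟨h5, h6, h7, h8⟩ := headGap_eq_iff.1 h.symm
  have hlt' := h4 i' hlt h5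
  have hi' := i'.2
  refine ⟨rightGap_eq_iff.2 ⟨by omega, by omega, fun k hk => h4 k (by omega) (by omega),
    fun k _ _ => by omega⟩, leftGap_eq_iff.2 ⟨by omega, fun k hk => ?_, fun k hk hik => ?_⟩⟩
  · rwa [show k = i from Fin.ext (by omega)]
  · by_contra hlk
    have hne := val_apply_ne π (i := k) (k := i') (by omega)
    obtain ⟨m, hm, hmax⟩ := (Finset.univ.filter fun m : Fin n =>
      (m : ℕ) < i' ∧ (i : ℕ) + 1 ≤ m ∧ (π i' : ℕ) < π m).exists_max_image (fun m => (m : ℕ))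
      ⟨k, by simp only [Finset.mem_filter, Finset.mem_univ, true_and]; omega⟩
    simp only [Finset.mem_filter, Finset.mem_univ, true_and] at hm hmax
    have hmi := h4 m (by omega) (by omega)
    have := hcon m (by omega) (headGap_eq_iff.2 ⟨by omega, h2,
      fun x hx => by have := h3 x hx; omega, fun x hx hxg => ?_⟩)
    · omega
    · rcases lt_trichotomy (x : ℕ) i' with h | h | h
      · by_contra hcon'
        have := hmax x ⟨h, by omega, by omega⟩
        omega
      · rw [show x = i' from Fin.ext h]; omega
      · have := h8 x h hxg; omega

/-- Dual to the incoming case: the face has its gap just before the right edge, and the first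
intermediate value below `π j` would belong to another edge with the same tail. -/
theorem gaps_of_consecutive_out (h : tailGap π j = tailGap π j') (hlt : (j : ℕ) < j')
    (hcon : ∀ m : Fin n, (m : ℕ) < j' → tailGap π m = tailGap π j' → (m : ℕ) ≤ j) :
    rightGap π j = j' ∧ leftGap π j' = j' := by
  obtain ⟨h1, h3, h4⟩ := tailGap_eq_iff.1 (rfl : tailGap π j' = _)
  obtain ⟨h5, h7, h8⟩ := tailGap_eq_iff.1 h
  have hlt' := h4 j hlt h5
  have hj' := j'.2
  refine ⟨rightGap_eq_iff.2 ⟨by omega, by omega, fun k hk => ?_, fun k hk hik => ?_⟩,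
    leftGap_eq_iff.2 ⟨by omega, fun k hk => h4 k (by omega) (by omega), fun k _ _ => by omega⟩⟩
  · rwa [show k = j' from Fin.ext (by omega)]
  · by_contra hlk
    have hne := val_apply_ne π (i := k) (k := j) (by omega)
    obtain ⟨m, hm, hmin⟩ := (Finset.univ.filter fun m : Fin n =>
      (m : ℕ) < j' ∧ (j : ℕ) < m ∧ (π m : ℕ) < π j).exists_min_image (fun m => (m : ℕ))
      ⟨k, by simp only [Finset.mem_filter, Finset.mem_univ, true_and]; omega⟩
    simp only [Finset.mem_filter, Finset.mem_univ, true_and] at hm hmin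
    have hmi := h4 m (by omega) (by omega)
    have := hcon m (by omega) (tailGap_eq_iff.2 ⟨by omega,
      fun x hx => by have := h3 x hx; omega, fun x hx hxg => ?_⟩)
    · omega
    · rcases lt_trichotomy (x : ℕ) j with h | h | h
      · have := h8 x h hxg; omega
      · rw [show x = j from Fin.ext h]; omega
      · by_contra hcon'
        have := val_apply_ne π (i := x) (k := m) (by omega)
        have := hmin x ⟨by omega, by omega, by omega⟩
        omega

/-- The two values adjacent to the level of an inner white point belong to an incoming edge `p` and
an outgoing edge `q`. A position obstructing this would produce a jump down over these two
consecutive values, excluded by `not_jump_down`. -/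
theorem gapLevel_facts (hπ : IsBaxter π) (hg : IsWhiteGap π g) (h0 : 0 < g) (hn : g < n) :
    ∃ p q : Fin n, (p : ℕ) < g ∧ g ≤ (q : ℕ) ∧ headGap π p = g ∧ tailGap π q = g ∧
      (π p : ℕ) + 1 = π q ∧
      (∀ i : Fin n, (i : ℕ) < g → ∀ k : Fin n, (k : ℕ) = g → (π i : ℕ) < π k → (π i : ℕ) ≤ π p) ∧
      (∀ k : Fin n, g ≤ (k : ℕ) → ∀ a : Fin n, (a : ℕ) + 1 = g → (π a : ℕ) < π k →
        (π q : ℕ) ≤ π k) := by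
  obtain ⟨p, hp, hp'⟩ := exists_succ_eq_gapLevel hg h0
  obtain ⟨q, hq, hq'⟩ := exists_eq_gapLevel hg hn
  have hpg := (lt_gapLevel_iff π hp).1 (by omega)
  have hqg := (gapLevel_le_iff hπ hg hq).1 (by omega)
  have hA : ∀ i : Fin n, (i : ℕ) < g → ∀ k : Fin n, (k : ℕ) = g → (π i : ℕ) < π k →
      (π i : ℕ) ≤ π p := fun i hi k hk hik => by
    have := (lt_gapLevel_iff π hi).2 fun k' hk' => by
      rwa [show k' = k from Fin.ext (by omega)]
    omega
  have hB : ∀ k : Fin n, g ≤ (k : ℕ) → ∀ a : Fin n, (a : ℕ) + 1 = g → (π a : ℕ) < π k →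
      (π q : ℕ) ≤ π k := fun k hk a ha hak => by
    have := (gapLevel_le_iff hπ hg hk).2 fun a' ha' => by
      rwa [show a' = a from Fin.ext (by omega)]
    omega
  have hw := hg.2 h0 ⟨g - 1, by omega⟩ ⟨g, hn⟩ (by simp; omega) rfl
  have hA' := hA ⟨g - 1, by omega⟩ (by simp; omega) ⟨g, hn⟩ rfl hw
  have hB' := hB ⟨g, hn⟩ le_rfl ⟨g - 1, by omega⟩ (by simp; omega) hw
  refine ⟨p, q, hp, hq, headGap_eq_iff.2 ⟨hp, hg.1, hpg, fun k hpk hkg => ?_⟩,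
    tailGap_eq_iff.2 ⟨hq, hqg, fun k hkq hgk => ?_⟩, by omega, hA, hB⟩
  · by_contra hcon
    have h1 := val_apply_ne π (i := k) (k := p) (by omega)
    have h2 := val_apply_ne π (i := k) (k := q) (by omega)
    have h3 := val_apply_ne π (i := p) (k := ⟨g - 1, by omega⟩) (by simp; omega)
    have hkg' : (k : ℕ) ≠ g - 1 := fun h => by
      rw [show (⟨g - 1, by omega⟩ : Fin n) = k from Fin.ext h.symm] at hA'
      omega
    refine hπ.not_jump_down (i := p) (s := k) (t := ⟨g - 1, by omega⟩) (k := q)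
      (by omega) (by simp; omega) (by simp; omega) (by omega) (by omega) (by omega)
      fun x hx hx' => ?_
    simp only at hx hx'
    have h6 := val_apply_ne π (i := x) (k := p) (by omega)
    have h7 := val_apply_ne π (i := x) (k := q) (by omega)
    omega
  · by_contra hcon
    have h1 := val_apply_ne π (i := k) (k := p) (by omega)
    have h2 := val_apply_ne π (i := k) (k := q) (by omega)
    have h3 := val_apply_ne π (i := q) (k := ⟨g, by omega⟩) (by simp; omega)
    have hkg' : (k : ℕ) ≠ g := fun h => by
      rw [show (⟨g, by omega⟩ : Fin n) = k from Fin.ext h.symm] at hB'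
      omega
    refine hπ.not_jump_down (i := p) (s := ⟨g, by omega⟩) (t := k) (k := q)
      (by simp; omega) (by simp; omega) (by omega) (by omega) (by omega) (by omega)
      fun x hx hx' => ?_
    simp only at hx hx'
    have h6 := val_apply_ne π (i := x) (k := p) (by omega)
    have h7 := val_apply_ne π (i := x) (k := q) (by omega)
    omega

/-- The left side of a vertex. The first outgoing edge is at position `g`, and the first incoming
one carries the largest value on the left that is below `π g`. No earlier value separates these two,
so the searches to the left stop at the same gap. -/
theorem leftGap_eq_of_first (hπ : IsBaxter π) (hj : tailGap π j = g) (hi : headGap π i = g)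
    (hj' : ∀ m, tailGap π m = g → (j : ℕ) ≤ m) (hi' : ∀ m, headGap π m = g → (i : ℕ) ≤ m) :
    leftGap π j = leftGap π i := by
  obtain ⟨h1, h2, h3, h4⟩ := headGap_eq_iff.1 hi
  have hj2 := j.2
  have hgj := (tailGap_eq_iff.1 hj).1
  have hg : IsWhiteGap π g := hi ▸ isWhiteGap_headGap π i
  have hjg : (j : ℕ) = g := by
    have := hj' ⟨g, by omega⟩ (hg.tailGap_eq rfl)
    simp only at this
    omega
  obtain ⟨p, q, hp, hq, hpg, hqg, hpq, hA, hB⟩ := gapLevel_facts hπ hg (by omega) (by omega)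
  have hip : i = p := by
    have h5 := hi' p hpg
    by_contra hne
    have h6 := h4 p (lt_of_le_of_ne h5 fun h => hne (Fin.ext h)) hp
    have := hA i h1 j hjg (h3 j hjg)
    omega
  subst hip
  obtain ⟨h5, h6, h7⟩ := leftGap_eq_iff.1 (rfl : leftGap π i = _)
  refine leftGap_eq_iff.2 ⟨by omega, fun k hk => ?_, fun k hkj hk => ?_⟩
  · have h8 := h6 k hk
    by_contra hcon
    have h9 := val_apply_ne π (i := k) (k := j) (by omega)
    have := hA k (by omega) j hjg (by omega)
    omega
  · have h8 := h3 j hjg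
    rcases lt_trichotomy (k : ℕ) i with h | h | h
    · have := h7 k h hk; omega
    · rwa [show k = i from Fin.ext h]
    · have := h4 k h (by omega); omega

/-- The right side of a vertex. The last incoming edge is at position `g - 1`, and the last outgoing
one carries the smallest value on the right that is above it. -/
theorem rightGap_eq_of_last (hπ : IsBaxter π) (hj : tailGap π j = g) (hi : headGap π i = g)
    (hj' : ∀ m, tailGap π m = g → (m : ℕ) ≤ j) (hi' : ∀ m, headGap π m = g → (m : ℕ) ≤ i) :
    rightGap π j = rightGap π i := by
  have hig := (headGap_eq_iff.1 hi).1
  have hj2 := j.2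
  obtain ⟨h1, h3, h4⟩ := tailGap_eq_iff.1 hj
  have hg : IsWhiteGap π g := hi ▸ isWhiteGap_headGap π i
  have hgi : (i : ℕ) + 1 = g := by
    have := hi' ⟨g - 1, by omega⟩ (hg.headGap_eq (by simp; omega))
    simp only at this
    omega
  obtain ⟨p, q, hp, hq, hpg, hqg, hpq, hA, hB⟩ := gapLevel_facts hπ hg (by omega) (by omega)
  have hjq : j = q := by
    have h5 := hj' q hqg
    by_contra hne
    have h6 := h4 q (lt_of_le_of_ne h5 fun h => hne (Fin.ext h.symm)) hq
    have := hB j h1 i hgi (h3 i hgi)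
    omega
  subst hjq
  obtain ⟨h5, h5', h6, h7⟩ := rightGap_eq_iff.1 (rfl : rightGap π j = _)
  refine Eq.symm (rightGap_eq_iff.2 ⟨by omega, h5', fun k hk => ?_, fun k hik hk => ?_⟩)
  · have h8 := h6 k hk
    by_contra hcon
    have h9 := val_apply_ne π (i := k) (k := i) (by omega)
    have := hB k (by omega) i hgi (by omega)
    omega
  · have h8 := h3 i hgi
    rcases lt_trichotomy (k : ℕ) j with h | h | h
    · have := h4 k h (by omega); omega
    · rwa [show k = j from Fin.ext h]
    · have := h7 k h hk; omega

theorem eq_last_of_forall_tailGap_ne (hg : IsWhiteGap π g) (h : ∀ k, tailGap π k ≠ g) : g = n := by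
  by_contra hne
  have := hg.1
  exact h ⟨g, by omega⟩ (hg.tailGap_eq rfl)

theorem eq_zero_of_forall_headGap_ne (hg : IsWhiteGap π g) (h : ∀ k, headGap π k ≠ g) : g = 0 := by
  by_contra hne
  have := hg.1
  exact h ⟨g - 1, by omega⟩ (hg.headGap_eq (by simp; omega))

/-- A corner lies between neighbouring edges of the same kind, on the left side of a vertex, or on
its right side. A wrap-around between edges of the same kind happens only at a pole, where both
sides have face gap 0. The second claim identifies the gap of a face at its top corner. -/
theorem faceGap_corner (hπ : IsBaxter π) {d z : HalfEdge n}
    (h : IsCyclicNext (vertexGap π) dartKey d z) :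
    faceGap π (oppositeHalf n z) = faceGap π d ∧
      (d.2 = false → z.2 = false → rightGap π d.1 = d.1 + 1) := by
  obtain ⟨i, b⟩ := d
  obtain ⟨j, c⟩ := z
  obtain ⟨hf, h⟩ := h
  have hi := i.2
  have hj := j.2
  cases b <;> cases c <;> simp only [oppositeHalf_apply, Bool.not_true, Bool.not_false,
    vertexGap_true, vertexGap_false, faceGap_true, faceGap_false, dartKey_true, dartKey_false,
    Prod.forall, Bool.forall_bool] at *
  · rcases h with ⟨hlt, h⟩ | h
    · obtain ⟨h1, h2⟩ := gaps_of_consecutive_in hf.symm (by omega) fun m hm hm' => by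
        have := (h m).1 hm' (by omega); omega
      rw [h1, h2]
      simp
      omega
    -- Wrap-around at the sink: `d` is the last position and `z` carries the largest value, so both
    -- border the outer face.
    · have hw := isWhiteGap_headGap π i
      have hn : headGap π i = n := eq_last_of_forall_tailGap_ne hw fun k hk => by
        have := (h k).2 hk; omega
      have hlast := (h ⟨n - 1, by omega⟩).1 ((isWhiteGap_last π).headGap_eq
        (by simp; omega) |>.trans hn.symm)
      simp only at hlast
      have hr : rightGap π i = n := rightGap_eq_iff.2 ⟨by omega, le_rfl,
        fun k hk => absurd k.2 (by omega), fun k hk => absurd k.2 (by omega)⟩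
      rw [hr, if_pos rfl]
      refine ⟨leftGap_eq_iff.2 ⟨Nat.zero_le _, fun k hk => by omega, fun k hk _ => ?_⟩,
        fun _ _ => by omega⟩
      obtain ⟨m, hm⟩ : ∃ m, (π m : ℕ) = n - 1 := ⟨π.symm ⟨n - 1, by omega⟩, by simp⟩
      have hmax : ∀ x : Fin n, (x : ℕ) ≠ m → (π x : ℕ) < π m := fun x hx => by
        have := val_apply_ne π hx
        have := (π x).2
        omega
      have hmg : headGap π m = n := headGap_eq_iff.2 ⟨m.2, le_rfl,
        fun k hk => absurd k.2 (by omega), fun k hk _ => hmax k (by omega)⟩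
      have h1 := (h m).1 (by rw [hmg, hn])
      have hjm : j = m := by
        by_contra hne
        have hne' : (j : ℕ) ≠ m := fun h => hne (Fin.ext h)
        have h3 := (headGap_eq_iff.1 (hf.trans hn)).2.2.2 m (by omega) m.2
        have h4 := hmax j hne'
        omega
      rw [hjm]
      exact hmax k (by rw [← hjm]; omega)
  · rcases h with ⟨hlt, h⟩ | h
    · omega
    · rw [rightGap_eq_of_last hπ hf rfl (fun m hm => by have := (h m).2 hm; omega)
        (fun m hm => by have := (h m).1 hm; omega)]
      simp
  · rcases h with ⟨hlt, h⟩ | h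
    · rw [leftGap_eq_of_first hπ (g := tailGap π i) rfl hf
        (fun m hm => by
          by_contra hcon
          have := (h m).2 hm (by omega)
          omega)
        (fun m hm => by have := (h m).1 hm (by omega); omega)]
      simp
    · have := (h i).2 rfl
      omega
  · rcases h with ⟨hlt, h⟩ | h
    · obtain ⟨h1, h2⟩ := gaps_of_consecutive_out hf (by omega) fun m hm hm' => by
        have := (h m).2 hm' (by omega); omega
      rw [h1, h2, if_neg (by omega)]
      simp
    -- Wrap-around at the source: `d` is the first position and `z` carries the smallest value.
    · have hw := isWhiteGap_tailGap π i
      have hn : tailGap π i = 0 := eq_zero_of_forall_headGap_ne hw fun k hk => by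
        have := (h k).1 hk; omega
      have hfirst := (h ⟨0, by omega⟩).2 ((isWhiteGap_zero π).tailGap_eq rfl |>.trans hn.symm)
      simp only at hfirst
      have hl : leftGap π i = 0 := leftGap_eq_iff.2 ⟨by omega, fun k hk => by omega,
        fun k hk => by omega⟩
      rw [hl]
      refine ⟨if_pos (rightGap_eq_iff.2 ⟨hj, le_rfl, fun k hk => absurd k.2 (by omega),
        fun k hk _ => ?_⟩), fun h => by simp at h⟩
      obtain ⟨m, hm⟩ : ∃ m, (π m : ℕ) = 0 := ⟨π.symm ⟨0, by omega⟩, by simp⟩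
      have hmin : ∀ x : Fin n, (x : ℕ) ≠ m → (π m : ℕ) < π x := fun x hx => by
        have := val_apply_ne π hx
        omega
      have hmg : tailGap π m = 0 := tailGap_eq_iff.2 ⟨Nat.zero_le _, fun k hk => by omega,
        fun k hk _ => hmin k (by omega)⟩
      have h1 := (h m).2 (by rw [hmg, hn])
      have hjm : j = m := by
        by_contra hne
        have hne' : (j : ℕ) ≠ m := fun h => hne (Fin.ext h)
        have h3 := (tailGap_eq_iff.1 (hf.trans hn)).2.2 m (by omega) (Nat.zero_le _)
        have h4 := hmin j hne'
        omega
      rw [hjm]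
      exact hmin k (by rw [← hjm]; omega)

/-! ### Vertices and faces of the map as gaps. -/

theorem vertexOf_permMap_eq_iff (hn : 1 ≤ n) {d d' : HalfEdge n} :
    (permMap π hn).vertexOf d = (permMap π hn).vertexOf d' ↔ vertexGap π d = vertexGap π d' :=
  Quotient.eq.trans (sameCycle_cyclicNext_iff dartKey_injective)

/-- `oppositeHalf` is an involution, so the two permutations are inverse to each other. The form
that turns first is more convenient for following corners. -/
theorem sameCycle_face_iff (σ : Perm (HalfEdge n)) (d d' : HalfEdge n) :
    (σ⁻¹ * oppositeHalf n).SameCycle d d' ↔ (oppositeHalf n * σ).SameCycle d d' := by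
  rw [← Perm.sameCycle_inv, mul_inv_rev, inv_inv, oppositeHalf_inv]

theorem OrientedMap.faceOf_eq_iff (M : OrientedMap n) (d d' : HalfEdge n) :
    M.faceOf d = M.faceOf d' ↔ (oppositeHalf n * M.rot).SameCycle d d' :=
  Quotient.eq.trans (sameCycle_face_iff _ _ _)

theorem OrientedMap.vertexOf_eq_iff (M : OrientedMap n) (d d' : HalfEdge n) :
    M.vertexOf d = M.vertexOf d' ↔ M.rot.SameCycle d d' :=
  Quotient.eq

/-- The face gap is constant along a face by `faceGap_corner`. Conversely, the half-edge with the
largest key in a face is `(i, false)` at a top corner, where the gap is `i + 1`, read as 0 if this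
is `n`. So the gap determines `i` and hence the face. -/
theorem faceOf_permMap_eq_iff (hπ : IsBaxter π) (hn : 1 ≤ n) {d d' : HalfEdge n} :
    (permMap π hn).faceOf d = (permMap π hn).faceOf d' ↔ faceGap π d = faceGap π d' := by
  rw [OrientedMap.faceOf_eq_iff]
  set σ := (permMap π hn).rot
  have hσ : ∀ d, IsCyclicNext (vertexGap π) dartKey d (σ d) := isCyclicNext_cyclicNext dartKey_injective
  have hf : ∀ d, faceGap π ((oppositeHalf n * σ) d) = faceGap π d := fun d =>
    (faceGap_corner hπ (hσ d)).1
  have hinv : ∀ {d z}, (oppositeHalf n * σ).SameCycle d z → faceGap π z = faceGap π d :=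
    fun {d z} hz => hz.induction_on (p := fun z => faceGap π z = faceGap π d) rfl
      fun x hx => by rw [hf, hx]
  have hmax : ∀ d, ∃ i : Fin n, (oppositeHalf n * σ).SameCycle d (i, false) ∧
      rightGap π i = i + 1 := by
    intro d
    have hfin : {z | (oppositeHalf n * σ).SameCycle d z}.Finite := Set.toFinite _
    obtain ⟨⟨i, b⟩, hz, hz'⟩ := hfin.exists_maximalFor dartKey _ ⟨d, Perm.SameCycle.refl _ _⟩
    have h1 := @hz' _ (Perm.sameCycle_apply_right.2 hz)
    have h2 := hσ (i, b)
    have h3 := (faceGap_corner hπ h2).2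
    rw [Perm.mul_apply] at h1
    obtain ⟨⟨j, c⟩, hj⟩ : ∃ z, σ (i, b) = z := ⟨_, rfl⟩
    rw [hj] at h1 h2 h3
    obtain ⟨h4, h5⟩ := h2
    cases b <;> cases c <;> simp only [oppositeHalf_apply, Bool.not_true, Bool.not_false,
      vertexGap_true, vertexGap_false, dartKey_true, dartKey_false, Prod.forall,
      Bool.forall_bool] at *
    · exact ⟨i, hz, h3 (by simp) (by simp)⟩
    · have h6 := (tailGap_eq_iff.1 h4).1
      have h7 := (headGap_eq_iff.1 (rfl : headGap π i = _)).1
      have := h1 (by omega)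
      omega
    · have h6 := (headGap_eq_iff.1 h4).1
      have h7 := (tailGap_eq_iff.1 (rfl : tailGap π i = _)).1
      have := h1 (by omega)
      omega
    · have := h1 (by omega)
      omega
  refine ⟨fun h => (hinv h).symm, fun h => ?_⟩
  obtain ⟨i, hi, hi'⟩ := hmax d
  obtain ⟨j, hj, hj'⟩ := hmax d'
  have h1 : faceGap π (i, false) = faceGap π (j, false) := by rw [hinv hi, hinv hj, h]
  rw [faceGap_false, faceGap_false, hi', hj'] at h1
  have : i = j := Fin.ext (by split_ifs at h1 <;> omega)
  subst this
  exact hi.trans hj.symm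

theorem leftGap_zero (hn : 1 ≤ n) (π : Perm (Fin n)) : leftGap π ⟨0, hn⟩ = 0 :=
  leftGap_eq_iff.2 ⟨le_rfl, fun k hk => by omega, fun k hk => by simp at hk⟩

theorem faceOf_permMap_eq_outerFace_iff (hπ : IsBaxter π) (hn : 1 ≤ n) {d : HalfEdge n} :
    (permMap π hn).faceOf d = (permMap π hn).outerFace ↔ faceGap π d = 0 := by
  have : (permMap π hn).outerFace = (permMap π hn).faceOf (⟨0, hn⟩, true) := rfl
  rw [this, faceOf_permMap_eq_iff hπ, faceGap_true, leftGap_zero]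

end PermMap


/-! ### Maps labelled by the positions of a permutation -/

section Model

variable {n : ℕ} {π : Perm (Fin n)} {M N : OrientedMap n} {τ : Perm (Fin n)} {g : ℕ}

theorem Nat.card_eq_card_of_injective {α γ : Type*} (f : α → γ) (hf : Function.Injective f)
    (s : Finset γ) (hs : ∀ x, x ∈ s ↔ ∃ a, f a = x) : Nat.card α = s.card := by
  rw [Nat.card_congr (Equiv.ofInjective f hf), Nat.card_coe_set_eq, ← Set.ncard_coe_finset]
  congr 1
  ext x
  simp [hs]

/-- The vertices, the faces and the outer face of `M`, whose edge `e` has the label `τ e`, are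
those of the drawing of `π`. -/
structure IsModel (π : Perm (Fin n)) (M : OrientedMap n) (τ : Perm (Fin n)) : Prop where
  vertex : ∀ d d', M.vertexOf d = M.vertexOf d' ↔
    vertexGap π (Prod.map τ id d) = vertexGap π (Prod.map τ id d')
  face : ∀ d d', M.faceOf d = M.faceOf d' ↔
    faceGap π (Prod.map τ id d) = faceGap π (Prod.map τ id d')
  outer : ∀ d, M.faceOf d = M.outerFace ↔ faceGap π (Prod.map τ id d) = 0

theorem OrientedMap.rot_conj (h : ∀ d, N.rot (Prod.map τ id d) = Prod.map τ id (M.rot d)) :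
    N.rot = (τ.prodCongr (Equiv.refl Bool)) * M.rot * (τ.prodCongr (Equiv.refl Bool))⁻¹ := by
  rw [eq_mul_inv_iff_mul_eq]
  exact Equiv.ext h

theorem OrientedMap.vertexOf_map_eq_iff
    (h : ∀ d, N.rot (Prod.map τ id d) = Prod.map τ id (M.rot d)) (d d' : HalfEdge n) :
    N.vertexOf (Prod.map τ id d) = N.vertexOf (Prod.map τ id d') ↔
      M.vertexOf d = M.vertexOf d' := by
  rw [vertexOf_eq_iff, vertexOf_eq_iff, rot_conj h, Perm.sameCycle_conj]
  rw [show Prod.map τ id = (τ.prodCongr (Equiv.refl Bool)) from rfl]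
  simp only [Perm.inv_def, Equiv.symm_apply_apply]

theorem OrientedMap.faceOf_map_eq_iff
    (h : ∀ d, N.rot (Prod.map τ id d) = Prod.map τ id (M.rot d)) (d d' : HalfEdge n) :
    N.faceOf (Prod.map τ id d) = N.faceOf (Prod.map τ id d') ↔ M.faceOf d = M.faceOf d' := by
  have h1 : oppositeHalf n * N.rot = (τ.prodCongr (Equiv.refl Bool)) * (oppositeHalf n * M.rot) *
      (τ.prodCongr (Equiv.refl Bool))⁻¹ := by
    rw [rot_conj h, ← mul_assoc, ← mul_assoc, ← mul_assoc]
    rfl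
  rw [faceOf_eq_iff, faceOf_eq_iff, h1, Perm.sameCycle_conj]
  rw [show Prod.map τ id = (τ.prodCongr (Equiv.refl Bool)) from rfl]
  simp only [Perm.inv_def, Equiv.symm_apply_apply]

theorem isModel_of_rot (hπ : IsBaxter π) (hn : 1 ≤ n)
    (h : ∀ d, (permMap π hn).rot (Prod.map τ id d) = Prod.map τ id (M.rot d))
    (h' : ∀ d, M.faceOf d = M.outerFace ↔
      (permMap π hn).faceOf (Prod.map τ id d) = (permMap π hn).outerFace) : IsModel π M τ where
  vertex d d' := by rw [← OrientedMap.vertexOf_map_eq_iff h, vertexOf_permMap_eq_iff]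
  face d d' := by rw [← OrientedMap.faceOf_map_eq_iff h, faceOf_permMap_eq_iff hπ]
  outer d := by rw [h', faceOf_permMap_eq_outerFace_iff hπ]

namespace IsModel

/-- The gap of a vertex. -/
noncomputable def gap (h : IsModel π M τ) : M.Vertex → ℕ :=
  Quotient.lift (fun d => vertexGap π (Prod.map τ id d)) fun d d' hd =>
    (h.vertex d d').1 (Quotient.sound hd)

theorem gap_vertexOf (h : IsModel π M τ) (d : HalfEdge n) :
    h.gap (M.vertexOf d) = vertexGap π (Prod.map τ id d) := rfl

theorem gap_tail (h : IsModel π M τ) (e : Fin n) : h.gap (M.tail e) = tailGap π (τ e) := rfl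

theorem gap_head (h : IsModel π M τ) (e : Fin n) : h.gap (M.head e) = headGap π (τ e) := rfl

theorem gap_injective (h : IsModel π M τ) : Function.Injective h.gap := by
  rintro ⟨d⟩ ⟨d'⟩ hd
  exact (h.vertex d d').2 hd

theorem isWhiteGap_gap (h : IsModel π M τ) (v : M.Vertex) : IsWhiteGap π (h.gap v) := by
  obtain ⟨⟨e, _ | _⟩⟩ := v
  · exact isWhiteGap_headGap π (τ e)
  · exact isWhiteGap_tailGap π (τ e)

theorem exists_tail_eq (h : IsModel π M τ) {v : M.Vertex} (hv : h.gap v ≠ n) :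
    ∃ e, M.tail e = v := by
  by_contra hcon
  push Not at hcon
  refine hv (eq_last_of_forall_tailGap_ne (h.isWhiteGap_gap v) fun k hk => hcon (τ.symm k) ?_)
  exact h.gap_injective (by rw [h.gap_tail, Equiv.apply_symm_apply, hk])

theorem exists_head_eq (h : IsModel π M τ) {v : M.Vertex} (hv : h.gap v ≠ 0) :
    ∃ e, M.head e = v := by
  by_contra hcon
  push Not at hcon
  refine hv (eq_zero_of_forall_headGap_ne (h.isWhiteGap_gap v) fun k hk => hcon (τ.symm k) ?_)
  exact h.gap_injective (by rw [h.gap_head, Equiv.apply_symm_apply, hk])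

theorem isSource_iff (h : IsModel π M τ) {v : M.Vertex} : M.IsSource v ↔ h.gap v = 0 := by
  constructor
  · intro hv
    by_contra hcon
    obtain ⟨e, he⟩ := h.exists_head_eq hcon
    exact hv e he
  · rintro hv e rfl
    have := (headGap_eq_iff.1 hv).1
    omega

theorem isSink_iff (h : IsModel π M τ) {v : M.Vertex} : M.IsSink v ↔ h.gap v = n := by
  constructor
  · intro hv
    by_contra hcon
    obtain ⟨e, he⟩ := h.exists_tail_eq hcon
    exact hv e he
  · rintro hv e rfl
    have := (tailGap_eq_iff.1 hv).1
    have := (τ e).2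
    omega

theorem exists_gap_eq (hn : 1 ≤ n) (h : IsModel π M τ) (hg : IsWhiteGap π g) :
    ∃ v, h.gap v = g := by
  rcases Nat.eq_zero_or_pos g with rfl | h0
  · exact ⟨M.tail (τ.symm ⟨0, hn⟩), by
      rw [h.gap_tail, Equiv.apply_symm_apply]; exact hg.tailGap_eq rfl⟩
  · have := hg.1
    exact ⟨M.head (τ.symm ⟨g - 1, by omega⟩), by
      rw [h.gap_head, Equiv.apply_symm_apply]; exact hg.headGap_eq (by simp; omega)⟩

theorem gap_lt_of_step (h : IsModel π M τ) {u v : M.Vertex} (huv : M.Step u v) :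
    h.gap u < h.gap v := by
  obtain ⟨e, rfl, rfl⟩ := huv
  rw [h.gap_tail, h.gap_head]
  have h1 := (tailGap_eq_iff.1 (rfl : tailGap π (τ e) = _)).1
  have h2 := (headGap_eq_iff.1 (rfl : headGap π (τ e) = _)).1
  omega

theorem gap_lt_of_transGen (h : IsModel π M τ) {u v : M.Vertex}
    (huv : Relation.TransGen M.Step u v) : h.gap u < h.gap v := by
  induction huv with
  | single h' => exact h.gap_lt_of_step h'
  | tail _ h' ih => exact ih.trans (h.gap_lt_of_step h')

/-- An outgoing edge leads to a larger gap, so every vertex is joined to the sink. -/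
theorem connected (h : IsModel π M τ) (u v : M.Vertex) : Relation.EqvGen M.Step u v := by
  suffices H : ∀ m : ℕ, ∀ u, n - h.gap u = m →
      ∃ t, h.gap t = n ∧ Relation.EqvGen M.Step u t by
    obtain ⟨t, ht, hut⟩ := H _ u rfl
    obtain ⟨t', ht', hvt⟩ := H _ v rfl
    rw [h.gap_injective (ht'.trans ht.symm)] at hvt
    exact hut.trans _ _ _ (hvt.symm _ _)
  intro m
  induction m using Nat.strong_induction_on with
  | _ m ih =>
    intro u hu
    by_cases hun : h.gap u = n
    · exact ⟨u, hun, .refl _⟩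
    obtain ⟨e, rfl⟩ := h.exists_tail_eq hun
    have hstep : M.Step (M.tail e) (M.head e) := ⟨e, rfl, rfl⟩
    have h1 := h.gap_lt_of_step hstep
    have h2 := (h.isWhiteGap_gap (M.head e)).1
    obtain ⟨t, ht, ht'⟩ := ih (n - h.gap (M.head e)) (by omega) _ rfl
    exact ⟨t, ht, (Relation.EqvGen.rel _ _ hstep).trans _ _ _ ht'⟩

/-- The gap of a face. -/
noncomputable def gapFace (h : IsModel π M τ) : M.Face → ℕ :=
  Quotient.lift (fun d => faceGap π (Prod.map τ id d)) fun d d' hd =>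
    (h.face d d').1 (Quotient.sound hd)

theorem gapFace_injective (h : IsModel π M τ) : Function.Injective h.gapFace := by
  rintro ⟨d⟩ ⟨d'⟩ hd
  exact (h.face d d').2 hd

/-- Vertices are the white gaps; faces are the remaining gaps, the descents, together with 0 for the
outer face. This makes `n + 1` gaps and one extra 0. -/
theorem euler (hn : 1 ≤ n) (h : IsModel π M τ) :
    Nat.card M.Vertex + Nat.card M.Face = n + 2 := by
  classical
  rw [Nat.card_eq_card_of_injective h.gap h.gap_injective
      ((Finset.range (n + 1)).filter (IsWhiteGap π)) fun g => ?_,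
    Nat.card_eq_card_of_injective h.gapFace h.gapFace_injective
      (insert 0 ((Finset.range (n + 1)).filter fun g => ¬ IsWhiteGap π g)) fun g => ?_,
    Finset.card_insert_of_notMem (by simp [isWhiteGap_zero]), ← add_assoc,
    Finset.card_filter_add_card_filter_not, Finset.card_range]
  · simp only [Finset.mem_insert, Finset.mem_filter, Finset.mem_range]
    constructor
    · rintro (rfl | ⟨h1, h2⟩)
      · refine ⟨M.faceOf (τ.symm ⟨0, hn⟩, true), ?_⟩
        change leftGap π (τ (τ.symm _)) = 0
        rw [Equiv.apply_symm_apply, leftGap_zero]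
      · have h3 : g ≠ n := fun h => h2 (h ▸ isWhiteGap_last π)
        have h4 : ¬ ∀ a b : Fin n, (a : ℕ) + 1 = g → (b : ℕ) = g → (π a : ℕ) < π b :=
          fun h => h2 ⟨by omega, fun _ => h⟩
        push Not at h4
        obtain ⟨a, b, ha, hb, hab⟩ := h4
        have := val_apply_ne π (i := a) (k := b) (by omega)
        refine ⟨M.faceOf (τ.symm b, true), ?_⟩
        change leftGap π (τ (τ.symm _)) = g
        rw [Equiv.apply_symm_apply]
        refine leftGap_eq_iff.2 ⟨by omega, fun k hk => ?_, fun k hk => by omega⟩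
        rw [show k = a from Fin.ext (by omega)]
        omega
    · rintro ⟨⟨e, b⟩, rfl⟩
      cases b
      · change faceGap π (τ e, false) = 0 ∨ faceGap π (τ e, false) < n + 1 ∧
          ¬ IsWhiteGap π (faceGap π (τ e, false))
        rw [faceGap_false]
        obtain ⟨h1, h2, h3, h4⟩ := rightGap_eq_iff.1 (rfl : rightGap π (τ e) = _)
        split_ifs with hr
        · exact Or.inl rfl
        · refine Or.inr ⟨by omega, fun hw => ?_⟩
          have h5 := hw.2 (by omega) ⟨rightGap π (τ e) - 1, by omega⟩
            ⟨rightGap π (τ e), by omega⟩ (by simp; omega) rfl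
          have h6 := h3 ⟨rightGap π (τ e), by omega⟩ rfl
          by_cases h7 : rightGap π (τ e) - 1 = τ e
          · rw [show (⟨rightGap π (τ e) - 1, by omega⟩ : Fin n) = τ e from Fin.ext h7] at h5
            omega
          · have := h4 ⟨rightGap π (τ e) - 1, by omega⟩ (by simp; omega) (by simp; omega)
            omega
      · change leftGap π (τ e) = 0 ∨ leftGap π (τ e) < n + 1 ∧ ¬ IsWhiteGap π (leftGap π (τ e))
        obtain ⟨h1, h2, h3⟩ := leftGap_eq_iff.1 (rfl : leftGap π (τ e) = _)
        have h4 := (τ e).2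
        by_cases h0 : leftGap π (τ e) = 0
        · exact Or.inl h0
        · refine Or.inr ⟨by omega, fun hw => ?_⟩
          have h5 := hw.2 (by omega) ⟨leftGap π (τ e) - 1, by omega⟩
            ⟨leftGap π (τ e), by omega⟩ (by simp; omega) rfl
          have h6 := h2 ⟨leftGap π (τ e) - 1, by omega⟩ (by simp; omega)
          by_cases h7 : leftGap π (τ e) = τ e
          · rw [show (⟨leftGap π (τ e), by omega⟩ : Fin n) = τ e from Fin.ext h7] at h5
            omega
          · have := h3 ⟨leftGap π (τ e), by omega⟩ (by simp; omega) (by simp)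
            omega
  · simp only [Finset.mem_filter, Finset.mem_range]
    constructor
    · rintro ⟨-, hg⟩
      exact h.exists_gap_eq hn hg
    · rintro ⟨v, rfl⟩
      have := h.isWhiteGap_gap v
      exact ⟨by have := this.1; omega, this⟩

theorem isPlaneBipolar (hn : 1 ≤ n) (h : IsModel π M τ) : M.IsPlaneBipolar where
  connected := h.connected
  euler := h.euler hn
  acyclic v hv := (h.gap_lt_of_transGen hv).false
  unique_source := by
    obtain ⟨v, hv⟩ := h.exists_gap_eq hn (isWhiteGap_zero π)
    exact ⟨v, h.isSource_iff.2 hv, fun w hw => h.gap_injective ((h.isSource_iff.1 hw).trans hv.symm)⟩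
  unique_sink := by
    obtain ⟨v, hv⟩ := h.exists_gap_eq hn (isWhiteGap_last π)
    exact ⟨v, h.isSink_iff.2 hv, fun w hw => h.gap_injective ((h.isSink_iff.1 hw).trans hv.symm)⟩
  source_outer v hv := by
    refine ⟨(τ.symm ⟨0, hn⟩, true), h.gap_injective ?_, (h.outer _).2 ?_⟩
    · rw [h.isSource_iff.1 hv, h.gap_vertexOf]
      simp only [Prod.map_apply, Equiv.apply_symm_apply, id, vertexGap_true]
      exact (isWhiteGap_zero π).tailGap_eq rfl
    · simp only [Prod.map_apply, Equiv.apply_symm_apply, id, faceGap_true, leftGap_zero]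
  sink_outer v hv := by
    refine ⟨(τ.symm ⟨n - 1, by omega⟩, false), h.gap_injective ?_, (h.outer _).2 ?_⟩
    · rw [h.isSink_iff.1 hv, h.gap_vertexOf]
      simp only [Prod.map_apply, Equiv.apply_symm_apply, id, vertexGap_false]
      exact (isWhiteGap_last π).headGap_eq (by simp; omega)
    · simp only [Prod.map_apply, Equiv.apply_symm_apply, id, faceGap_false]
      exact if_pos (rightGap_eq_iff.2 ⟨by simp; omega, le_rfl, fun k hk => absurd k.2 (by omega),
        fun k hk => absurd k.2 (by simp at hk; omega)⟩)

/-! ### The parameters -/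

theorem nonPolarCount_eq (h : IsModel π M τ) (hn : 1 ≤ n) :
    M.nonPolarCount = (ascents π).card := by
  classical
  rw [OrientedMap.nonPolarCount, ← Finset.card_map ⟨fun a : Fin n => (a : ℕ) + 1, fun a b h =>
    Fin.ext (by simpa using h)⟩]
  refine Nat.card_eq_card_of_injective (fun v => h.gap v.1)
    (fun v w hvw => Subtype.ext (h.gap_injective hvw)) _ fun g => ?_
  simp only [Finset.mem_map, ascents, Finset.mem_filter, Finset.mem_univ, true_and,
    Subtype.exists, h.isSource_iff, h.isSink_iff]
  constructor
  · rintro ⟨a, ⟨b, hb, hab⟩, rfl⟩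
    have := b.2
    obtain ⟨v, hv⟩ := h.exists_gap_eq hn (g := a + 1) ⟨by omega, fun _ a' b' ha' hb' => by
      rw [show a' = a from Fin.ext (by omega), show b' = b from Fin.ext (by omega)]
      exact hab⟩
    exact ⟨v, ⟨by omega, by omega⟩, hv⟩
  · rintro ⟨v, ⟨h0, hn'⟩, rfl⟩
    have hw := h.isWhiteGap_gap v
    have := hw.1
    exact ⟨⟨h.gap v - 1, by omega⟩, ⟨⟨h.gap v, by omega⟩, by simp; omega,
      hw.2 (by omega) _ _ (by simp; omega) rfl⟩, by
        change h.gap v - 1 + 1 = h.gap v; omega⟩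

theorem degree_sink (h : IsModel π M τ) {t : M.Vertex} (ht : M.IsSink t) :
    M.degree t = (rlMaxima π).card := by
  have hdart : ∀ d : HalfEdge n, M.vertexOf d = t → d.2 = false := by
    rintro ⟨e, _ | _⟩ hd
    · rfl
    · exact absurd hd (ht e)
  refine Nat.card_eq_card_of_injective (fun d => τ d.1.1) (fun d d' hdd' => ?_) _ fun i => ?_
  · exact Subtype.ext (Prod.ext (τ.injective hdd') ((hdart _ d.2).trans (hdart _ d'.2).symm))
  · have : i ∈ rlMaxima π ↔ headGap π i = n := by
      simp only [rlMaxima, Finset.mem_filter, Finset.mem_univ, true_and, headGap_eq_iff,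
        Fin.lt_def]
      exact ⟨fun h => ⟨i.2, le_rfl, fun k hk => absurd k.2 (by omega), fun k hk _ => h k hk⟩,
        fun h k hk => h.2.2.2 k hk k.2⟩
    rw [this]
    constructor
    · intro hi
      refine ⟨⟨(τ.symm i, false), h.gap_injective ?_⟩, by simp⟩
      rw [h.isSink_iff.1 ht, h.gap_vertexOf]
      simpa using hi
    · rintro ⟨⟨⟨e, b⟩, hd⟩, rfl⟩
      have hb := hdart _ hd
      simp only at hb
      subst hb
      exact (congrArg h.gap hd).trans (h.isSink_iff.1 ht)

theorem degree_source (h : IsModel π M τ) {s : M.Vertex} (hs : M.IsSource s) :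
    M.degree s = (lrMinima π).card := by
  have hdart : ∀ d : HalfEdge n, M.vertexOf d = s → d.2 = true := by
    rintro ⟨e, _ | _⟩ hd
    · exact absurd hd (hs e)
    · rfl
  refine Nat.card_eq_card_of_injective (fun d => τ d.1.1) (fun d d' hdd' => ?_) _ fun i => ?_
  · exact Subtype.ext (Prod.ext (τ.injective hdd') ((hdart _ d.2).trans (hdart _ d'.2).symm))
  · have : i ∈ lrMinima π ↔ tailGap π i = 0 := by
      simp only [lrMinima, Finset.mem_filter, Finset.mem_univ, true_and, tailGap_eq_iff,
        Fin.lt_def]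
      exact ⟨fun h => ⟨Nat.zero_le _, fun k hk => by omega, fun k hk _ => h k hk⟩,
        fun h k hk => h.2.2 k hk (Nat.zero_le _)⟩
    rw [this]
    constructor
    · intro hi
      refine ⟨⟨(τ.symm i, true), h.gap_injective ?_⟩, by simp⟩
      rw [h.isSource_iff.1 hs, h.gap_vertexOf]
      simpa using hi
    · rintro ⟨⟨⟨e, b⟩, hd⟩, rfl⟩
      have hb := hdart _ hd
      simp only at hb
      subst hb
      exact (congrArg h.gap hd).trans (h.isSource_iff.1 hs)

/-- A set of edges that follow each other from the source to the sink forms a unique path. -/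
theorem existsUnique_path (h : IsModel π M τ) (hn : 1 ≤ n) (S : Finset (Fin n))
    (h0 : ∃ i ∈ S, tailGap π i = 0)
    (h1 : ∀ i ∈ S, headGap π i ≠ n → ∃ j ∈ S, tailGap π j = headGap π i)
    (h2 : ∀ i ∈ S, ∀ j ∈ S, tailGap π i ≤ tailGap π j → i = j ∨ headGap π i ≤ tailGap π j) :
    (∃! p, ∃ s t, M.IsSource s ∧ M.IsSink t ∧ M.IsPath s p t ∧ ∀ e ∈ p, τ e ∈ S) ∧
    ∀ p, (∃ s t, M.IsSource s ∧ M.IsSink t ∧ M.IsPath s p t ∧ ∀ e ∈ p, τ e ∈ S) →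
      p.length = S.card := by
  obtain ⟨s, hs⟩ := h.exists_gap_eq hn (isWhiteGap_zero π)
  obtain ⟨t, ht⟩ := h.exists_gap_eq hn (isWhiteGap_last π)
  have tail_lt : ∀ i, tailGap π i < n := fun i => by
    have := (tailGap_eq_iff.1 (rfl : tailGap π i = _)).1
    have := i.2
    omega
  have tail_lt_head : ∀ i, tailGap π i < headGap π i := fun i => by
    have := (tailGap_eq_iff.1 (rfl : tailGap π i = _)).1
    have := (headGap_eq_iff.1 (rfl : headGap π i = _)).1
    omega
  have hinj : ∀ i ∈ S, ∀ j ∈ S, tailGap π i = tailGap π j → i = j := fun i hi j hj hij =>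
    (h2 i hi j hj hij.le).resolve_right (by have := tail_lt_head i; omega)
  have hex : ∀ m, ∀ e, τ e ∈ S → n - headGap π (τ e) = m →
      ∃ p, M.IsPath (M.tail e) p t ∧ ∀ e ∈ p, τ e ∈ S := by
    intro m
    induction m using Nat.strong_induction_on with
    | _ m ih =>
      intro e he hm
      by_cases hhead : headGap π (τ e) = n
      · exact ⟨[e], ⟨rfl, h.gap_injective (by rw [h.gap_head, hhead, ht])⟩, by simpa using he⟩
      · obtain ⟨j, hj, hj'⟩ := h1 _ he hhead
        have h3 := tail_lt_head j
        have h4 := (headGap_eq_iff.1 (rfl : headGap π j = _)).2.1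
        obtain ⟨p, hp, hp'⟩ := ih (n - headGap π j) (by omega) (τ.symm j)
          (by rwa [Equiv.apply_symm_apply]) (by rw [Equiv.apply_symm_apply])
        refine ⟨e :: p, ⟨rfl, ?_⟩, ?_⟩
        · rw [show M.head e = M.tail (τ.symm j) from h.gap_injective (by
            rw [h.gap_head, h.gap_tail, Equiv.apply_symm_apply, hj'])]
          exact hp
        · simpa using ⟨he, hp'⟩
  have huniq : ∀ p q u, M.IsPath u p t → M.IsPath u q t → (∀ e ∈ p, τ e ∈ S) →
      (∀ e ∈ q, τ e ∈ S) → p = q := by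
    intro p
    induction p with
    | nil =>
      intro q u hp hq _ _
      cases q with
      | nil => rfl
      | cons e q =>
        have := congrArg h.gap (hq.1.trans hp)
        rw [h.gap_tail, ht] at this
        exact absurd this (tail_lt _).ne
    | cons e p ih =>
      intro q u hp hq hpS hqS
      cases q with
      | nil =>
        have := congrArg h.gap (hp.1.trans hq)
        rw [h.gap_tail, ht] at this
        exact absurd this (tail_lt _).ne
      | cons e' q =>
        have hee : e = e' := τ.injective (hinj _ (hpS e (by simp)) _ (hqS e' (by simp)) (by
          rw [← h.gap_tail, ← h.gap_tail, hp.1, hq.1]))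
        subst hee
        rw [ih q _ hp.2 hq.2 (fun x hx => hpS x (by simp [hx])) fun x hx => hqS x (by simp [hx])]
  -- A path in `S` to the sink misses no edge of `S` that starts at or after its beginning, because
  -- by `h2` no other edge of `S` has its tail gap before the head of a given edge and at or after
  -- its tail. Starting from the source this gives all of `S`.
  have hmem : ∀ p u, M.IsPath u p t → (∀ e ∈ p, τ e ∈ S) → p.Nodup ∧
      ∀ e, τ e ∈ S → (e ∈ p ↔ h.gap u ≤ tailGap π (τ e)) := by
    intro p
    induction p with
    | nil =>
      intro u hp _
      refine ⟨List.nodup_nil, fun e _ => ?_⟩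
      rw [(congrArg h.gap hp).trans ht]
      simpa using tail_lt _
    | cons e p ih =>
      intro u hp hpS
      obtain ⟨hnd, hmem⟩ := ih _ hp.2 fun x hx => hpS x (by simp [hx])
      have heS := hpS e (by simp)
      have hu : h.gap u = tailGap π (τ e) := by rw [← h.gap_tail, hp.1]
      rw [h.gap_head] at hmem
      have h3 := tail_lt_head (τ e)
      refine ⟨List.nodup_cons.2 ⟨fun hep => ?_, hnd⟩, fun x hx => ?_⟩
      · have := (hmem e heS).1 hep
        omega
      · rw [List.mem_cons, hmem x hx, hu]
        constructor
        · rintro (rfl | h)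
          · exact le_rfl
          · omega
        · intro h
          exact (h2 _ heS _ hx h).imp (fun h => (τ.injective h).symm) id
  have hst : ∀ {s' t'}, M.IsSource s' → M.IsSink t' → s' = s ∧ t' = t := fun hs' ht' =>
    ⟨h.gap_injective ((h.isSource_iff.1 hs').trans hs.symm),
      h.gap_injective ((h.isSink_iff.1 ht').trans ht.symm)⟩
  constructor
  · obtain ⟨i, hi, hi'⟩ := h0
    obtain ⟨p, hp, hpS⟩ := hex _ (τ.symm i) (by rwa [Equiv.apply_symm_apply]) rfl
    rw [show M.tail (τ.symm i) = s from h.gap_injective (by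
      rw [h.gap_tail, Equiv.apply_symm_apply, hi', hs])] at hp
    refine ⟨p, ⟨s, t, h.isSource_iff.2 hs, h.isSink_iff.2 ht, hp, hpS⟩, ?_⟩
    rintro q ⟨s', t', hs', ht', hq, hqS⟩
    obtain ⟨rfl, rfl⟩ := hst hs' ht'
    exact huniq _ _ _ hq hp hqS hpS
  · rintro p ⟨s', t', hs', ht', hp, hpS⟩
    obtain ⟨rfl, rfl⟩ := hst hs' ht'
    obtain ⟨hnd, hmem'⟩ := hmem _ _ hp hpS
    rw [← List.toFinset_card_of_nodup hnd, ← Finset.card_map τ.toEmbedding]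
    congr 1
    ext i
    simp only [Finset.mem_map, List.mem_toFinset, Equiv.coe_toEmbedding]
    constructor
    · rintro ⟨e, he, rfl⟩
      exact hpS e he
    · intro hi
      refine ⟨τ.symm i, (hmem' _ (by rwa [Equiv.apply_symm_apply])).2 ?_, by simp⟩
      rw [hs]
      exact Nat.zero_le _

/-- The search for the left face runs to the gap 0 exactly at the lr-maxima. The tail gap of an
lr-maximum is its own position and its head gap is the position of the next one, so these edges form
a path. -/
theorem leftBorder (h : IsModel π M τ) (hn : 1 ≤ n) : (∃! p, M.IsLeftBorder p) ∧
    ∀ p, M.IsLeftBorder p → p.length = (lrMaxima π).card := by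
  have hmem : ∀ i, i ∈ lrMaxima π ↔ ∀ k : Fin n, (k : ℕ) < i → (π k : ℕ) < π i := fun i => by
    simp only [lrMaxima, Finset.mem_filter, Finset.mem_univ, true_and, Fin.lt_def]
  have htail : ∀ i ∈ lrMaxima π, tailGap π i = i := fun i hi => tailGap_eq_iff.2
    ⟨le_rfl, fun k hk => (hmem i).1 hi k (by omega), fun k hk => by omega⟩
  have hface : ∀ e, M.leftFace e = M.outerFace ↔ τ e ∈ lrMaxima π := fun e => by
    rw [OrientedMap.leftFace, h.outer, hmem]
    simp only [Prod.map_apply, id, faceGap_true, leftGap_eq_iff]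
    exact ⟨fun h k hk => h.2.2 k hk (Nat.zero_le _),
      fun h => ⟨Nat.zero_le _, fun k hk => by omega, fun k hk _ => h k hk⟩⟩
  have := h.existsUnique_path hn (lrMaxima π)
    ⟨⟨0, hn⟩, (hmem _).2 fun k hk => by simp at hk, (isWhiteGap_zero π).tailGap_eq rfl⟩
    (fun i hi hin => by
      obtain ⟨h1, h2, h3, h4⟩ := headGap_eq_iff.1 (rfl : headGap π i = _)
      have hm : (⟨headGap π i, by omega⟩ : Fin n) ∈ lrMaxima π := (hmem _).2 fun k hk => by
        have h5 := h3 ⟨headGap π i, by omega⟩ rfl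
        rcases lt_trichotomy (k : ℕ) i with h | h | h
        · have := (hmem i).1 hi k h
          omega
        · rwa [show k = i from Fin.ext h]
        · have := h4 k h hk
          omega
      exact ⟨_, hm, htail _ hm⟩)
    (fun i hi j hj hij => by
      rw [htail i hi, htail j hj] at hij
      rw [htail j hj]
      rcases hij.eq_or_lt with h | h
      · exact Or.inl (Fin.ext h)
      · refine Or.inr ?_
        by_contra hcon
        have h1 := (hmem j).1 hj i h
        have h2 := (headGap_eq_iff.1 (rfl : headGap π i = _)).2.2.2 j h (by omega)
        omega)
  simpa only [OrientedMap.IsLeftBorder, hface] using this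

/-- The search for the right face runs to the gap `n` exactly at the rl-minima. Such an edge `i`
ends at the gap `i + 1`, and the path continues with the smallest value to the right of `i`. -/
theorem rightBorder (h : IsModel π M τ) (hn : 1 ≤ n) : (∃! p, M.IsRightBorder p) ∧
    ∀ p, M.IsRightBorder p → p.length = (rlMinima π).card := by
  have hmem : ∀ i, i ∈ rlMinima π ↔ ∀ k : Fin n, (i : ℕ) < k → (π i : ℕ) < π k := fun i => by
    simp only [rlMinima, Finset.mem_filter, Finset.mem_univ, true_and, Fin.lt_def]
  have hhead : ∀ i ∈ rlMinima π, headGap π i = i + 1 := fun i hi => headGap_eq_iff.2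
    ⟨by omega, i.2, fun k hk => (hmem i).1 hi k (by omega), fun k hk => by omega⟩
  have hface : ∀ e, M.rightFace e = M.outerFace ↔ τ e ∈ rlMinima π := fun e => by
    rw [OrientedMap.rightFace, h.outer, hmem]
    simp only [Prod.map_apply, id, faceGap_false]
    have h1 := (rightGap_eq_iff.1 (rfl : rightGap π (τ e) = _)).1
    have h2 : rightGap π (τ e) = n ↔ ∀ k : Fin n, (τ e : ℕ) < k → (π (τ e) : ℕ) < π k := by
      rw [rightGap_eq_iff]
      exact ⟨fun h k hk => h.2.2.2 k hk k.2, fun h => ⟨(τ e).2, le_rfl,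
        fun k hk => absurd k.2 (by omega), fun k hk _ => h k hk⟩⟩
    rw [← h2]
    split_ifs with h3
    · simp [h3]
    · simp only [h3, iff_false]
      omega
  have htail : ∀ i ∈ rlMinima π, ∀ j : Fin n, (i : ℕ) < j → (i : ℕ) + 1 ≤ tailGap π j := by
    intro i hi j hij
    by_contra hcon
    have h1 := (tailGap_eq_iff.1 (rfl : tailGap π j = _)).2.2 i hij (by omega)
    have h2 := (hmem i).1 hi j hij
    omega
  have := h.existsUnique_path hn (rlMinima π)
    (by
      have hz : ∀ k : Fin n, (k : ℕ) ≠ π.symm ⟨0, hn⟩ → (π (π.symm ⟨0, hn⟩) : ℕ) < π k :=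
        fun k hk => by
          have := val_apply_ne π hk
          simp only [Equiv.apply_symm_apply] at this ⊢
          omega
      exact ⟨π.symm ⟨0, hn⟩, (hmem _).2 fun k hk => hz k (by omega),
        tailGap_eq_iff.2 ⟨Nat.zero_le _, fun k hk => by omega, fun k hk _ => hz k (by omega)⟩⟩)
    (fun i hi hin => by
      rw [hhead i hi] at hin ⊢
      have hi' := i.2
      obtain ⟨j, hj, hmin⟩ := (Finset.univ.filter fun j : Fin n =>
        (i : ℕ) < j).exists_min_image (fun j => (π j : ℕ)) ⟨⟨i + 1, by omega⟩,
          Finset.mem_filter.2 ⟨Finset.mem_univ _, Nat.lt_succ_self _⟩⟩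
      simp only [Finset.mem_filter, Finset.mem_univ, true_and] at hj hmin
      refine ⟨j, (hmem j).2 fun k hk => lt_of_le_of_ne (hmin k (by omega))
        (val_apply_ne π (by omega)), tailGap_eq_iff.2 ⟨hj, fun k hk => ?_, fun k hk hik =>
        lt_of_le_of_ne (hmin k (by omega)) (val_apply_ne π (by omega))⟩⟩
      rw [show k = i from Fin.ext (by omega)]
      exact (hmem i).1 hi j hj)
    (fun i hi j hj hij => by
      rw [hhead i hi]
      rcases lt_trichotomy (i : ℕ) j with h | h | h
      · exact Or.inr (htail i hi j h)
      · exact Or.inl (Fin.ext h)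
      · have h1 := htail j hj i h
        have h2 := (tailGap_eq_iff.1 (rfl : tailGap π j = _)).1
        omega)
  simpa only [OrientedMap.IsRightBorder, hface] using this

end IsModel

end Model


/-! ### Directions around the white points -/

section Directions

variable {n : ℕ} {π π' : Perm (Fin n)} {M : OrientedMap n} {τ τ' : Perm (Fin n)} {g : ℕ}

theorem Complex.arg_mem_Ioo_of_pos {x y : ℝ} (hx : 0 < x) (hy : 0 < y) :
    Complex.arg ⟨x, y⟩ ∈ Set.Ioo 0 (Real.pi / 2) := by
  refine ⟨lt_of_le_of_ne (Complex.arg_nonneg_iff.2 hy.le) fun h => ?_,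
    Complex.arg_lt_pi_div_two_iff.2 (Or.inl hx)⟩
  have := (Complex.arg_eq_zero_iff.1 h.symm).2
  simp only at this
  exact hy.ne' this

theorem Complex.arg_lt_arg_of_pos {x y x' y' : ℝ} (hx : 0 < x') (hxx : x' < x) (hy : 0 < y)
    (hyy : y < y') : Complex.arg ⟨x, y⟩ < Complex.arg ⟨x', y'⟩ := by
  have h1 := Complex.arg_mem_Ioo_of_pos (hx.trans hxx) hy
  have h2 := Complex.arg_mem_Ioo_of_pos hx (hy.trans hyy)
  have hpi := Real.pi_pos
  rw [← Real.strictMonoOn_tan.lt_iff_lt ⟨by linarith [h1.1], h1.2⟩ ⟨by linarith [h2.1], h2.2⟩,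
    Complex.tan_arg, Complex.tan_arg]
  simp only
  rw [div_lt_div_iff₀ (hx.trans hxx) hx]
  nlinarith

theorem Complex.arg_eq_of_neg {x y : ℝ} (hy : y < 0) :
    Complex.arg ⟨x, y⟩ = Complex.arg ⟨-x, -y⟩ - Real.pi := by
  rw [← Complex.arg_neg_eq_arg_sub_pi_of_im_pos (x := ⟨-x, -y⟩) (by simpa using hy)]
  congr 1
  apply Complex.ext <;> simp

theorem ccwAngle_eq {α β θ : ℝ} (h0 : 0 < θ) (h1 : θ ≤ 2 * Real.pi)
    (h : ∃ z : ℤ, β - α = θ + z * (2 * Real.pi)) : ccwAngle α β = θ := by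
  rw [ccwAngle, toIocMod_eq_iff]
  simpa using ⟨⟨h0, h1⟩, h⟩

/-- The argument of the first half of an edge, seen from its white point. -/
noncomputable def dartArg (π : Perm (Fin n)) (d : HalfEdge n) : ℝ :=
  directionArg (whitePoint π (vertexGap π d)) (blackPoint π d.1)

/-- The argument of a half-edge, in the interval from `0` to `2π`. -/
noncomputable def dartTheta (π : Perm (Fin n)) (d : HalfEdge n) : ℝ :=
  if d.2 then dartArg π d else dartArg π d + 2 * Real.pi

theorem dart_pos (hπ : IsBaxter π) (i : Fin n) :
    0 < (i : ℝ) + 1 - ((tailGap π i : ℝ) + 1 / 2) ∧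
      0 < (π i : ℝ) + 1 - ((gapLevel π (tailGap π i) : ℝ) + 1 / 2) := by
  have h := (Prod.le_def.1 (tailGap_lt_blackPoint hπ i).le)
  simp only [whitePoint, blackPoint] at h
  have h1 := cast_add_one_ne_cast_add_half i (tailGap π i)
  have h2 := cast_add_one_ne_cast_add_half (π i) (gapLevel π (tailGap π i))
  exact ⟨sub_pos.2 (lt_of_le_of_ne h.1 h1.symm), sub_pos.2 (lt_of_le_of_ne h.2 h2.symm)⟩

theorem dart_neg (π : Perm (Fin n)) (i : Fin n) :
    (i : ℝ) + 1 - ((headGap π i : ℝ) + 1 / 2) < 0 ∧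
      (π i : ℝ) + 1 - ((gapLevel π (headGap π i) : ℝ) + 1 / 2) < 0 := by
  have h := (Prod.le_def.1 (blackPoint_lt_headGap π i).le)
  simp only [whitePoint, blackPoint] at h
  have h1 := cast_add_one_ne_cast_add_half i (headGap π i)
  have h2 := cast_add_one_ne_cast_add_half (π i) (gapLevel π (headGap π i))
  exact ⟨sub_neg.2 (lt_of_le_of_ne h.1 h1), sub_neg.2 (lt_of_le_of_ne h.2 h2)⟩

theorem dartTheta_true (π : Perm (Fin n)) (i : Fin n) : dartTheta π (i, true) =
    Complex.arg ⟨(i : ℝ) + 1 - ((tailGap π i : ℝ) + 1 / 2),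
      (π i : ℝ) + 1 - ((gapLevel π (tailGap π i) : ℝ) + 1 / 2)⟩ := rfl

theorem dartTheta_false (π : Perm (Fin n)) (i : Fin n) : dartTheta π (i, false) =
    Complex.arg ⟨-((i : ℝ) + 1 - ((headGap π i : ℝ) + 1 / 2)),
      -((π i : ℝ) + 1 - ((gapLevel π (headGap π i) : ℝ) + 1 / 2))⟩ + Real.pi := by
  rw [show dartTheta π (i, false) = Complex.arg ⟨(i : ℝ) + 1 - ((headGap π i : ℝ) + 1 / 2),
      (π i : ℝ) + 1 - ((gapLevel π (headGap π i) : ℝ) + 1 / 2)⟩ + 2 * Real.pi from rfl,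
    Complex.arg_eq_of_neg (dart_neg π i).2]
  ring

theorem dartTheta_true_mem (hπ : IsBaxter π) (i : Fin n) :
    dartTheta π (i, true) ∈ Set.Ioo 0 (Real.pi / 2) := by
  rw [dartTheta_true]
  exact Complex.arg_mem_Ioo_of_pos (dart_pos hπ i).1 (dart_pos hπ i).2

theorem dartTheta_false_mem (π : Perm (Fin n)) (i : Fin n) :
    dartTheta π (i, false) ∈ Set.Ioo Real.pi (3 * Real.pi / 2) := by
  rw [dartTheta_false]
  have := Complex.arg_mem_Ioo_of_pos (neg_pos.2 (dart_neg π i).1) (neg_pos.2 (dart_neg π i).2)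
  exact ⟨by linarith [this.1], by linarith [this.2]⟩

theorem dartTheta_mem (hπ : IsBaxter π) (d : HalfEdge n) :
    dartTheta π d ∈ Set.Ioo 0 (3 * Real.pi / 2) := by
  have hpi := Real.pi_pos
  obtain ⟨i, _ | _⟩ := d
  · have := dartTheta_false_mem π i
    exact ⟨by linarith [this.1], this.2⟩
  · have := dartTheta_true_mem hπ i
    exact ⟨this.1, by linarith [this.2]⟩

/-- Outgoing half-edges point north-east and incoming ones south-west, so only edges of the same
kind need work. At a common vertex a larger position goes with a smaller value, and this orders the
slopes. -/
theorem dartTheta_lt_dartTheta (hπ : IsBaxter π) {d d' : HalfEdge n}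
    (h : vertexGap π d = vertexGap π d') (hlt : dartKey d < dartKey d') :
    dartTheta π d < dartTheta π d' := by
  have hpi := Real.pi_pos
  obtain ⟨i, _ | _⟩ := d <;> obtain ⟨j, _ | _⟩ := d' <;>
    simp only [vertexGap_true, vertexGap_false, dartKey_true, dartKey_false] at h hlt
  · rw [dartTheta_false, dartTheta_false]
    have h1 := dart_neg π i
    have h2 := dart_neg π j
    have h3 := (headGap_eq_iff.1 (rfl : headGap π j = _)).1
    have h4 := (headGap_eq_iff.1 h).2.2.2 j (by omega) h3
    have h5 : ((i : ℕ) : ℝ) < (j : ℕ) := by exact_mod_cast hlt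
    have h6 : ((π j : ℕ) : ℝ) < (π i : ℕ) := by exact_mod_cast h4
    rw [h] at h1 ⊢
    refine add_lt_add_left (Complex.arg_lt_arg_of_pos ?_ ?_ ?_ ?_) _ <;> linarith [h1.1, h1.2, h2.1, h2.2]
  · omega
  · have h1 := dartTheta_true_mem hπ i
    have h2 := dartTheta_false_mem π j
    linarith [h1.2, h2.1]
  · rw [dartTheta_true, dartTheta_true]
    have h1 := dart_pos hπ i
    have h2 := dart_pos hπ j
    have h3 := (tailGap_eq_iff.1 (rfl : tailGap π j = _)).1
    have h4 := (tailGap_eq_iff.1 h).2.2 j (by omega) h3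
    have h5 : ((j : ℕ) : ℝ) < (i : ℕ) := by exact_mod_cast (show (j : ℕ) < i by omega)
    have h6 : ((π i : ℕ) : ℝ) < (π j : ℕ) := by exact_mod_cast h4
    rw [h] at h1 ⊢
    refine Complex.arg_lt_arg_of_pos ?_ ?_ ?_ ?_ <;> linarith [h1.1, h1.2, h2.1, h2.2]

theorem exists_dartTheta_eq (π : Perm (Fin n)) (d : HalfEdge n) :
    ∃ z : ℤ, dartTheta π d = dartArg π d + z * (2 * Real.pi) := by
  obtain ⟨i, _ | _⟩ := d
  · exact ⟨1, by simp [dartTheta]⟩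
  · exact ⟨0, by simp [dartTheta]⟩

theorem ccwAngle_dartArg (hπ : IsBaxter π) (d : HalfEdge n) {β θ : ℝ}
    (hθ : θ ∈ Set.Ioo 0 (2 * Real.pi)) (hβ : ∃ z : ℤ, θ = β + z * (2 * Real.pi)) :
    ccwAngle (dartArg π d) β =
      if dartTheta π d < θ then θ - dartTheta π d else θ - dartTheta π d + 2 * Real.pi := by
  have hpi := Real.pi_pos
  have h1 := dartTheta_mem hπ d
  obtain ⟨z, hz⟩ := exists_dartTheta_eq π d
  obtain ⟨w, hw⟩ := hβ
  split_ifs with h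
  · refine ccwAngle_eq (by linarith) (by linarith [hθ.2, h1.1]) ⟨z - w, ?_⟩
    rw [hz, hw]
    push_cast
    ring
  · refine ccwAngle_eq (by linarith [hθ.1, h1.2]) (by linarith) ⟨z - w - 1, ?_⟩
    rw [hz, hw]
    push_cast
    ring

theorem ccwAngle_dartArg_dartArg (hπ : IsBaxter π) (d d' : HalfEdge n) :
    ccwAngle (dartArg π d) (dartArg π d') = if dartTheta π d < dartTheta π d' then
      dartTheta π d' - dartTheta π d else dartTheta π d' - dartTheta π d + 2 * Real.pi := by
  have hpi := Real.pi_pos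
  have := dartTheta_mem hπ d'
  exact ccwAngle_dartArg hπ d ⟨this.1, by linarith [this.2]⟩ (exists_dartTheta_eq π d')

theorem dartTheta_lt_iff (hπ : IsBaxter π) {d d' : HalfEdge n}
    (h : vertexGap π d = vertexGap π d') :
    dartTheta π d < dartTheta π d' ↔ dartKey d < dartKey d' := by
  refine ⟨fun hlt => ?_, dartTheta_lt_dartTheta hπ h⟩
  by_contra hcon
  rcases (not_lt.1 hcon).eq_or_lt with heq | hlt'
  · rw [dartKey_injective heq] at hlt
    exact lt_irrefl _ hlt
  · exact lt_asymm hlt (dartTheta_lt_dartTheta hπ h.symm hlt')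

theorem dartTheta_le_iff (hπ : IsBaxter π) {d d' : HalfEdge n}
    (h : vertexGap π d = vertexGap π d') :
    dartTheta π d ≤ dartTheta π d' ↔ dartKey d ≤ dartKey d' := by
  rw [← not_lt, dartTheta_lt_iff hπ h.symm, not_lt]

/-- Seen from `d`, angles increase with the keys beyond that of `d`, and the keys up to that of `d`
follow after passing a full turn. -/
theorem ccwAngle_le_of_isCyclicNext (hπ : IsBaxter π) {d z d' : HalfEdge n}
    (hz : IsCyclicNext (vertexGap π) dartKey d z) (hd' : vertexGap π d' = vertexGap π d) :
    ccwAngle (dartArg π d) (dartArg π z) ≤ ccwAngle (dartArg π d) (dartArg π d') := by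
  have hpi := Real.pi_pos
  have hz1 := dartTheta_mem hπ z
  have hd1 := dartTheta_mem hπ d'
  obtain ⟨hf, h⟩ := hz
  rw [ccwAngle_dartArg_dartArg hπ, ccwAngle_dartArg_dartArg hπ]
  simp only [dartTheta_lt_iff hπ hf.symm, dartTheta_lt_iff hπ hd'.symm]
  rcases h with ⟨h1, h2⟩ | h
  · rw [if_pos h1]
    split_ifs with h3
    · linarith [(dartTheta_le_iff hπ (hf.trans hd'.symm)).2 (h2 d' hd' h3)]
    · linarith [hz1.2, hd1.1]
  · rw [if_neg (not_lt.2 (h z hf).1), if_neg (not_lt.2 (h d' hd').1)]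
    linarith [(dartTheta_le_iff hπ (hf.trans hd'.symm)).2 (h d' hd').2]

theorem eq_of_ccwAngle_eq (hπ : IsBaxter π) {d z z' : HalfEdge n}
    (hz : vertexGap π z = vertexGap π z')
    (h : ccwAngle (dartArg π d) (dartArg π z) = ccwAngle (dartArg π d) (dartArg π z')) :
    z = z' := by
  have hpi := Real.pi_pos
  have hz1 := dartTheta_mem hπ z
  have hd1 := dartTheta_mem hπ z'
  have : dartTheta π z = dartTheta π z' := by
    rw [ccwAngle_dartArg_dartArg hπ, ccwAngle_dartArg_dartArg hπ] at h
    split_ifs at h <;> linarith [hz1.1, hz1.2, hd1.1, hd1.2]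
  exact dartKey_injective (le_antisymm ((dartTheta_le_iff hπ hz).1 this.le)
    ((dartTheta_le_iff hπ hz.symm).1 this.ge))

theorem exists_theta_southWest : ∃ θ ∈ Set.Ioo Real.pi (3 * Real.pi / 2),
    ∃ z : ℤ, θ = directionArg (0, 0) (-1, -1) + z * (2 * Real.pi) := by
  have h1 := Complex.arg_mem_Ioo_of_pos one_pos one_pos
  refine ⟨Complex.arg ⟨1, 1⟩ + Real.pi, ⟨by linarith [h1.1], by linarith [h1.2]⟩, 1, ?_⟩
  rw [show directionArg (0, 0) (-1, -1) = Complex.arg ⟨-1, -1⟩ by simp [directionArg],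
    Complex.arg_eq_of_neg (x := -1) (y := -1) (by norm_num), neg_neg]
  push_cast
  ring

/-! ### Realizations -/

/-- A black point has a single cover and covers a single point, so the incidences leave no freedom
for the positions. -/
theorem Realization.position_vertexOf (hπ : IsBaxter π) (R : Realization π M) (d : HalfEdge n) :
    (R.position (M.vertexOf d) : ℝ × ℝ) =
      whitePoint π (vertexGap π (Prod.map R.point id d)) := by
  obtain ⟨e, _ | _⟩ := d
  · exact (hasseEdge_blackPoint_left_iff hπ).1 ((R.covering_iff (M.head e) e).2 rfl)
  · exact (hasseEdge_blackPoint_right_iff hπ).1 ((R.covered_iff (M.tail e) e).2 rfl)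

theorem Realization.vertexOf_eq_iff (hπ : IsBaxter π) (R : Realization π M) (d d' : HalfEdge n) :
    M.vertexOf d = M.vertexOf d' ↔
      vertexGap π (Prod.map R.point id d) = vertexGap π (Prod.map R.point id d') := by
  rw [← R.position.injective.eq_iff, Subtype.ext_iff, R.position_vertexOf hπ,
    R.position_vertexOf hπ, (whitePoint_injective π).eq_iff]

/-- Both half-edges minimize the angle from `d` at the same vertex, one by `next_ccw`, the other as
cyclic successor, and distinct half-edges have distinct angles. -/
theorem Realization.rot_eq (hπ : IsBaxter π) (hn : 1 ≤ n) (R : Realization π M) (d : HalfEdge n) :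
    (permMap π hn).rot (Prod.map R.point id d) = Prod.map R.point id (M.rot d) := by
  have hz : IsCyclicNext (vertexGap π) dartKey (Prod.map R.point id d)
    ((permMap π hn).rot (Prod.map R.point id d)) := isCyclicNext_cyclicNext dartKey_injective _
  have hrot : M.vertexOf (M.rot d) = M.vertexOf d :=
    (M.vertexOf_eq_iff _ _).2 (Perm.sameCycle_apply_left.2 (Perm.SameCycle.refl _ _))
  have hrot' := (R.vertexOf_eq_iff hπ _ _).1 hrot
  set z := (permMap π hn).rot (Prod.map R.point id d)
  have hw : Prod.map R.point id (Prod.map R.point.symm id z) = z := by simp [Prod.map]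
  have hz' : M.vertexOf (Prod.map R.point.symm id z) = M.vertexOf d := by
    rw [R.vertexOf_eq_iff hπ, hw]
    exact hz.1
  refine eq_of_ccwAngle_eq hπ (d := Prod.map R.point id d) (hz.1.trans hrot'.symm)
    (le_antisymm (ccwAngle_le_of_isCyclicNext hπ hz hrot') ?_)
  have := R.next_ccw d _ hz'
  rw [R.position_vertexOf hπ, R.position_vertexOf hπ, R.position_vertexOf hπ, hw] at this
  simpa [dartArg] using this

/-- All edges at `w_0` point north-east, so the south-west ray lies in the corner where the rotation
wraps around. This corner follows the edge at position 0, which `permMap` uses to name the outer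
face. -/
theorem Realization.faceOf_eq_outerFace_iff (hπ : IsBaxter π) (hn : 1 ≤ n) (R : Realization π M) :
    ∀ d, M.faceOf d = M.outerFace ↔
      (permMap π hn).faceOf (Prod.map R.point id d) = (permMap π hn).outerFace := by
  have hpi := Real.pi_pos
  have hrot := R.rot_eq hπ hn
  obtain ⟨d, hd, hout, hangle⟩ := R.outer_corner
  rw [R.position_vertexOf hπ, ← whitePoint_zero π] at hd
  have hd0 := whitePoint_injective π hd
  rw [R.position_vertexOf hπ, R.position_vertexOf hπ, ← hrot] at hangle
  have hz : IsCyclicNext (vertexGap π) dartKey (Prod.map R.point id d)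
    ((permMap π hn).rot (Prod.map R.point id d)) := isCyclicNext_cyclicNext dartKey_injective _
  have key : Prod.map R.point id d = (⟨0, hn⟩, true) := by
    have htrue : ∀ d, vertexGap π d = 0 → d.2 = true := by
      rintro ⟨i, _ | _⟩ hi
      · have := (headGap_eq_iff.1 hi).1
        omega
      · rfl
    set w := Prod.map R.point id d
    set z := (permMap π hn).rot w
    have hR1 : R.point d.1 = w.1 := rfl
    have hR2 : R.point (M.rot d).1 = z.1 := by
      rw [show z = Prod.map R.point id (M.rot d) from hrot d]
      rfl
    rw [hR1, hR2] at hangle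
    change ccwAngle (dartArg π w) _ < ccwAngle (dartArg π w) (dartArg π z) at hangle
    obtain ⟨θ, hθ, hθ'⟩ := exists_theta_southWest
    have hzt := htrue z (hz.1.trans hd0)
    have hwt := htrue w hd0
    have hz1 : dartTheta π z < Real.pi / 2 := by
      have := (dartTheta_true_mem hπ z.1).2
      rwa [← hzt] at this
    have hw1 : dartTheta π w < Real.pi / 2 := by
      have := (dartTheta_true_mem hπ w.1).2
      rwa [← hwt] at this
    rw [ccwAngle_dartArg hπ w ⟨by linarith [hθ.1], by linarith [hθ.2]⟩ hθ',
      if_pos (by linarith [hθ.1]), ccwAngle_dartArg_dartArg hπ] at hangle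
    obtain ⟨hf, h | h⟩ := hz
    · rw [if_pos ((dartTheta_lt_iff hπ hf.symm).2 h.1)] at hangle
      linarith [hθ.1]
    · have h1 := (h (⟨0, hn⟩, true) (((isWhiteGap_zero π).tailGap_eq rfl).trans hd0.symm)).1
      obtain ⟨i, b⟩ := w
      simp only at hwt
      subst hwt
      simp only [dartKey_true] at h1
      exact Prod.ext (Fin.ext (by simp; omega)) rfl
  intro d'
  rw [← hout, ← OrientedMap.faceOf_map_eq_iff hrot, key]
  rfl

theorem Realization.iso (hπ : IsBaxter π) (hn : 1 ≤ n) (R : Realization π M) :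
    OrientedMap.Iso M (permMap π hn) :=
  ⟨R.point, R.rot_eq hπ hn, R.faceOf_eq_outerFace_iff hπ hn⟩

theorem Realization.isModel (hπ : IsBaxter π) (hn : 1 ≤ n) (R : Realization π M) :
    IsModel π M R.point :=
  isModel_of_rot hπ hn (R.rot_eq hπ hn) (R.faceOf_eq_outerFace_iff hπ hn)

theorem Realization.exists_of_iso (hπ : IsBaxter π) (hn : 1 ≤ n)
    (h : OrientedMap.Iso M (permMap π hn)) : Nonempty (Realization π M) := by
  have hpi := Real.pi_pos
  obtain ⟨τ, hrot, hout⟩ := h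
  have h := isModel_of_rot hπ hn hrot hout
  let pos : M.Vertex ≃ whitePoints π := Equiv.ofBijective
    (fun v => ⟨whitePoint π (h.gap v), (h.isWhiteGap_gap v).mem_whitePoints⟩)
    ⟨fun v w hvw => h.gap_injective (whitePoint_injective π (congrArg Subtype.val hvw)),
      fun ⟨p, hp⟩ => by
        obtain ⟨g, hg, rfl⟩ := mem_whitePoints_iff.1 hp
        obtain ⟨v, rfl⟩ := h.exists_gap_eq hn hg
        exact ⟨v, rfl⟩⟩
  have hpos : ∀ v, (pos v : ℝ × ℝ) = whitePoint π (h.gap v) := fun v => rfl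
  have hz : ∀ d, IsCyclicNext (vertexGap π) dartKey (Prod.map τ id d)
      (Prod.map τ id (M.rot d)) := fun d => by
    rw [← hrot d]
    exact isCyclicNext_cyclicNext dartKey_injective _
  refine ⟨⟨τ, pos, fun v e => ?_, fun v e => ?_, fun d d' hd' => ?_,
    ⟨(τ.symm ⟨0, hn⟩, true), ?_, ?_, ?_⟩⟩⟩
  · rw [hasseEdge_blackPoint_right_iff hπ, hpos, (whitePoint_injective π).eq_iff, ← h.gap_tail,
      h.gap_injective.eq_iff]
  · rw [hasseEdge_blackPoint_left_iff hπ, hpos, (whitePoint_injective π).eq_iff, ← h.gap_head,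
      h.gap_injective.eq_iff]
  · exact ccwAngle_le_of_isCyclicNext hπ (hz d) ((h.vertex _ _).1 hd')
  · rw [hpos, h.gap_vertexOf, ← whitePoint_zero π]
    simp only [Prod.map_apply, Equiv.apply_symm_apply, id, vertexGap_true]
    rw [(isWhiteGap_zero π).tailGap_eq rfl]
  · rw [h.outer]
    simp only [Prod.map_apply, Equiv.apply_symm_apply, id, faceGap_true, leftGap_zero]
  · have h1 := hz (τ.symm ⟨0, hn⟩, true)
    set d : HalfEdge n := (τ.symm ⟨0, hn⟩, true)
    have hd : Prod.map τ id d = (⟨0, hn⟩, true) := by simp [d]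
    change ccwAngle (dartArg π (Prod.map τ id d)) _ <
      ccwAngle (dartArg π (Prod.map τ id d)) (dartArg π (Prod.map τ id (M.rot d)))
    set z := Prod.map τ id (M.rot d)
    rw [hd] at h1 ⊢
    have hg0 : vertexGap π (⟨0, hn⟩, true) = 0 := (isWhiteGap_zero π).tailGap_eq rfl
    obtain ⟨θ, hθ, hθ'⟩ := exists_theta_southWest
    have h2 := dartTheta_true_mem hπ ⟨0, hn⟩
    have h3 := dartTheta_mem hπ z
    -- Position 0 has the largest key at the source, so the turn to the next half-edge wraps around
    -- and goes past the south-west direction.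
    have hzt : dartKey z ≤ dartKey ((⟨0, hn⟩, true) : HalfEdge n) := by
      obtain ⟨i, b⟩ := z
      cases b
      · have := (headGap_eq_iff.1 (h1.1.trans hg0)).1
        omega
      · simp only [dartKey_true]
        omega
    rw [ccwAngle_dartArg hπ _ ⟨by linarith [hθ.1], by linarith [hθ.2]⟩ hθ',
      if_pos (by linarith [hθ.1, h2.2]), ccwAngle_dartArg_dartArg hπ,
      if_neg (not_lt.2 ((dartTheta_le_iff hπ h1.1).2 hzt))]
    linarith [hθ.2, h3.1]

/-! ### A map determines its permutation -/

theorem Equiv.Perm.eq_one_of_strictMono {σ : Perm (Fin n)} (h : StrictMono σ) : σ = 1 := by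
  have h' : StrictMono σ.symm := fun i j hij => by
    by_contra hcon
    have := h.monotone (not_lt.1 hcon)
    simp only [Equiv.apply_symm_apply] at this
    exact absurd hij (not_lt.2 this)
  ext i
  have h1 : i ≤ σ i := h.le_apply
  have h2 : σ i ≤ σ.symm (σ i) := h'.le_apply
  rw [Equiv.symm_apply_apply] at h2
  exact congrArg Fin.val (le_antisymm h2 h1)

namespace IsModel

/-- The condition on `e` and `e'` speaks of the map only. Gaps of heads and inner right faces lie
after the position of an edge, gaps of tails and left faces do not, so it increases every admissible
labelling. -/
theorem lt_of_adjacent (h : IsModel π M τ) {e e' : Fin n} (hee : M.head e = M.tail e' ∨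
    (M.rightFace e = M.leftFace e' ∧ M.leftFace e' ≠ M.outerFace)) : (τ e : ℕ) < τ e' := by
  rcases hee with hee | ⟨hee, hout⟩
  · have h0 := (h.vertex _ _).1 hee
    simp only [Prod.map_apply, id, vertexGap_true, vertexGap_false] at h0
    have h1 := (headGap_eq_iff.1 (rfl : headGap π (τ e) = _)).1
    have h2 := (tailGap_eq_iff.1 (rfl : tailGap π (τ e') = _)).1
    omega
  · have h0 := (h.face _ _).1 hee
    have h1 := mt (h.outer _).2 hout
    simp only [Prod.map_apply, id, faceGap_true, faceGap_false] at h0 h1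
    have h2 := (rightGap_eq_iff.1 (rfl : rightGap π (τ e) = _)).1
    have h3 := (leftGap_eq_iff.1 (rfl : leftGap π (τ e') = _)).1
    split_ifs at h0 <;> omega

/-- An ascent between consecutive positions is a common vertex, a descent is a common inner face. -/
theorem adjacent_of_succ (h : IsModel π M τ) {e e' : Fin n} (hee : (τ e : ℕ) + 1 = τ e') :
    M.head e = M.tail e' ∨
      (M.rightFace e = M.leftFace e' ∧ M.leftFace e' ≠ M.outerFace) := by
  have hlt := (τ e').2
  rcases Nat.lt_or_gt_of_ne (val_apply_ne π (i := τ e) (k := τ e') (by omega)) with h1 | h1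
  · left
    refine (h.vertex _ _).2 ?_
    simp only [Prod.map_apply, id, vertexGap_true, vertexGap_false]
    have hw : IsWhiteGap π (τ e' : ℕ) := ⟨by omega, fun _ a b ha hb => by
      rwa [show a = τ e from Fin.ext (by omega), show b = τ e' from Fin.ext (by omega)]⟩
    rw [hw.headGap_eq hee, hw.tailGap_eq rfl]
  · right
    have hr : rightGap π (τ e) = τ e' := rightGap_eq_iff.2 ⟨by omega, by omega, fun k hk => by
      rwa [show k = τ e' from Fin.ext hk], fun k hk hk' => by omega⟩
    have hl : leftGap π (τ e') = τ e' := leftGap_eq_iff.2 ⟨le_rfl, fun k hk => by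
      rwa [show k = τ e from Fin.ext (by omega)], fun k hk hk' => by omega⟩
    refine ⟨(h.face _ _).2 ?_, mt (h.outer _).1 ?_⟩
    · simp only [Prod.map_apply, id, faceGap_true, faceGap_false]
      rw [hr, hl, if_neg (by omega)]
    · simp only [Prod.map_apply, id, faceGap_true]
      omega

/-- Edges consecutive for `τ` are adjacent in the map, and adjacency increases `τ'`. So `τ' * τ⁻¹`
is increasing, hence the identity. -/
theorem labels_unique (h : IsModel π M τ) (h' : IsModel π' M τ') : τ = τ' := by
  have hmono : StrictMono (τ' * τ⁻¹) := by
    have H : ∀ m : ℕ, ∀ i j : Fin n, (j : ℕ) = i + m + 1 → (τ' * τ⁻¹) i < (τ' * τ⁻¹) j := by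
      intro m
      induction m with
      | zero =>
        intro i j hij
        refine Fin.lt_def.2 (h'.lt_of_adjacent (h.adjacent_of_succ ?_))
        simp only [Perm.inv_def, Equiv.apply_symm_apply]
        omega
      | succ m ih =>
        intro i j hij
        have hj := j.2
        refine (ih i ⟨i + m + 1, by omega⟩ rfl).trans
          (Fin.lt_def.2 (h'.lt_of_adjacent (h.adjacent_of_succ ?_)))
        simp only [Perm.inv_def, Equiv.apply_symm_apply]
        omega
    intro i j hij
    exact H (j - i - 1) i j (by rw [Fin.lt_def] at hij; omega)
  exact (mul_inv_eq_one.1 (Perm.eq_one_of_strictMono hmono)).symm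

theorem whitePoint_le_of_reflTransGen (hπ : IsBaxter π) (h : IsModel π M τ) {u v : M.Vertex}
    (huv : Relation.ReflTransGen M.Step u v) :
    whitePoint π (h.gap u) ≤ whitePoint π (h.gap v) := by
  induction huv with
  | refl => exact le_rfl
  | tail _ hstep ih =>
    obtain ⟨e, rfl, rfl⟩ := hstep
    exact ih.trans ((tailGap_lt_blackPoint hπ (τ e)).trans (blackPoint_lt_headGap π (τ e))).le

/-- A black point between two white points has its tail and head between them too, which allows
induction on the difference of the gaps. -/
theorem reflTransGen_of_whitePoint_le (hπ : IsBaxter π) (h : IsModel π M τ) {u v : M.Vertex}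
    (huv : whitePoint π (h.gap u) ≤ whitePoint π (h.gap v)) :
    Relation.ReflTransGen M.Step u v := by
  suffices H : ∀ m : ℕ, ∀ u v, h.gap v - h.gap u = m →
      whitePoint π (h.gap u) ≤ whitePoint π (h.gap v) → Relation.ReflTransGen M.Step u v from
    H _ u v rfl huv
  intro m
  induction m using Nat.strong_induction_on with
  | _ m ih =>
    intro u v hm huv
    rcases huv.eq_or_lt with heq | hlt
    · rw [h.gap_injective (whitePoint_injective π heq)]
    obtain ⟨i, hi1, hi2⟩ := exists_blackPoint_between hπ (h.isWhiteGap_gap u)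
      (h.isWhiteGap_gap v) hlt
    have h1 := le_tailGap_of_whitePoint_lt_blackPoint hπ (h.isWhiteGap_gap u) hi1
    have h2 := headGap_le_of_blackPoint_lt_whitePoint hπ (h.isWhiteGap_gap v) hi2
    obtain ⟨e, rfl⟩ := τ.surjective i
    rw [← h.gap_tail] at h1
    rw [← h.gap_head] at h2
    have hstep : M.Step (M.tail e) (M.head e) := ⟨e, rfl, rfl⟩
    have h3 := h.gap_lt_of_step hstep
    have h4 := (whitePoint_le_whitePoint_iff.1 h1).1
    have h5 := (whitePoint_le_whitePoint_iff.1 h2).1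
    exact (ih _ (by omega) _ _ rfl h1).trans
      (Relation.ReflTransGen.head hstep (ih _ (by omega) _ _ rfl h2))

theorem blackPoint_lt_iff (hπ : IsBaxter π) (h : IsModel π M τ) {e e' : Fin n} :
    blackPoint π (τ e) < blackPoint π (τ e') ↔
      Relation.ReflTransGen M.Step (M.head e) (M.tail e') := by
  constructor
  · intro hlt
    refine h.reflTransGen_of_whitePoint_le hπ ?_
    rw [h.gap_head, h.gap_tail]
    exact headGap_le_of_blackPoint_lt_whitePoint hπ (isWhiteGap_tailGap π _)
      (lt_tailGap_of_blackPoint_lt hlt)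
  · intro hr
    have := h.whitePoint_le_of_reflTransGen hπ hr
    exact ((blackPoint_lt_headGap π _).trans_le this).trans (tailGap_lt_blackPoint hπ _)

/-- Once the labels agree, whether `π i < π j` for `i < j` is a question of reachability in the map.
The two permutations then order every pair of positions alike. -/
theorem perm_unique (hπ : IsBaxter π) (hπ' : IsBaxter π') (h : IsModel π M τ)
    (h' : IsModel π' M τ') : π = π' := by
  obtain rfl := h.labels_unique h'
  have H : ∀ i j : Fin n, i < j → (π i < π j ↔ π' i < π' j) := by
    intro i j hij
    have h1 := h.blackPoint_lt_iff hπ (e := τ.symm i) (e' := τ.symm j)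
    have h2 := h'.blackPoint_lt_iff hπ' (e := τ.symm i) (e' := τ.symm j)
    rw [← h2, blackPoint_lt_blackPoint_iff, blackPoint_lt_blackPoint_iff] at h1
    simp only [Equiv.apply_symm_apply, ← Fin.lt_def, hij, true_and] at h1
    exact h1
  have hmono : StrictMono (π' * π⁻¹) := by
    intro a b hab
    obtain ⟨i, rfl⟩ := π.surjective a
    obtain ⟨j, rfl⟩ := π.surjective b
    simp only [Perm.mul_apply, Perm.inv_def, Equiv.symm_apply_apply]
    rcases lt_trichotomy i j with hij | rfl | hij
    · exact (H i j hij).1 hab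
    · exact absurd hab (lt_irrefl _)
    · by_contra hcon
      have hne : π' i ≠ π' j := fun h => hij.ne (π'.injective h).symm
      exact lt_asymm hab ((H j i hij).2 (lt_of_le_of_ne (not_lt.1 hcon) hne.symm))
  exact (mul_inv_eq_one.1 (Perm.eq_one_of_strictMono hmono)).symm

end IsModel

end Directions


/-! ### The local structure of plane bipolar orientations -/

/-- Rotation systems whose vertices and faces have the local structure of the vertices and faces
of a plane bipolar orientation: each vertex that is not a pole has its incoming edges in a row, and
each face is bounded by two directed paths. -/
structure LocalMap (n : ℕ) where
  rot : Perm (HalfEdge n)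
  out : HalfEdge n → Prop
  height : HalfEdge n → ℤ
  height_rot : ∀ d, height (rot d) = height d
  height_lt : ∀ e, height (e, true) < height (e, false)
  out_face : ∀ d, out (oppositeHalf n (rot d)) ↔ out d
  unique_vertex : ∀ b d d', rot.SameCycle d d' → d.2 = b → (rot d).2 = !b → d'.2 = b →
    (rot d').2 = !b → d = d'
  unique_face : ∀ b d d', (oppositeHalf n * rot).SameCycle d d' → d.2 = b → (rot d).2 = b →
    d'.2 = b → (rot d').2 = b → d = d'
  pole_of_out : ∀ d d', (rot d).2 = d.2 → out d → rot.SameCycle d d' → d'.2 = d.2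

open Relation (TransGen ReflTransGen)

theorem Equiv.Perm.apply_inv_apply {α : Type*} (σ : Perm α) (x : α) : σ (σ⁻¹ x) = x :=
  σ.apply_symm_apply x

theorem Equiv.Perm.inv_apply_apply {α : Type*} (σ : Perm α) (x : α) : σ⁻¹ (σ x) = x :=
  σ.symm_apply_apply x

theorem oppositeHalf_oppositeHalf {n : ℕ} (d : HalfEdge n) :
    oppositeHalf n (oppositeHalf n d) = d := by simp

theorem Equiv.Perm.SameCycle.exists_change {α : Type*} [Finite α] {σ : Perm α} {x y : α}
    (h : σ.SameCycle x y) (p : α → Bool) (hx : p x = true) (hy : p y = false) :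
    ∃ z, σ.SameCycle x z ∧ p z = true ∧ p (σ z) = false := by
  by_contra hcon
  push Not at hcon
  have := h.induction_on (p := fun z => σ.SameCycle x z ∧ p z = true)
    ⟨Perm.SameCycle.refl _ _, hx⟩ fun z hz =>
      ⟨Perm.sameCycle_apply_right.2 hz.1, by simpa using hcon z hz.1 hz.2⟩
  simp [hy] at this

/-! ### The relations above and beside, and their symmetries. -/

namespace LocalMap

variable {n : ℕ} (L : LocalMap n)

/-- The permutation whose cycles are the faces. -/
def face : Perm (HalfEdge n) := oppositeHalf n * L.rot

/-- The edge `g'` starts at the head of `g`. -/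
def Above (g g' : Fin n) : Prop := L.rot.SameCycle (g, false) (g', true)

/-- An inner face lies to the right of `g` and to the left of `g'`. -/
def Beside (g g' : Fin n) : Prop := L.face.SameCycle (g, false) (g', true) ∧ ¬ L.out (g, false)

variable {L} {d d' : HalfEdge n} {e g g' i j l x y : Fin n} {b : Bool}

theorem face_apply (h : L.rot d = (g, b)) : L.face d = (g, !b) := by
  simp [face, h]

theorem sameCycle_face (h : L.rot d = (g, b)) : L.face.SameCycle d (g, !b) :=
  face_apply h ▸ Perm.sameCycle_apply_self_right

theorem sameCycle_rot (h : L.rot d = d') : L.rot.SameCycle d d' :=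
  h ▸ Perm.sameCycle_apply_self_right

theorem out_iff (h : L.face.SameCycle d d') : L.out d ↔ L.out d' :=
  h.induction_on (p := fun z => L.out d ↔ L.out z) Iff.rfl fun z hz => by
    rw [hz, ← L.out_face z]
    rfl

theorem height_eq (h : L.rot.SameCycle d d') : L.height d' = L.height d :=
  h.induction_on (p := fun z => L.height z = L.height d) rfl fun z hz => by rw [L.height_rot, hz]

theorem Above.height_eq (h : L.Above g g') : L.height (g', true) = L.height (g, false) :=
  LocalMap.height_eq h

theorem Above.height_lt (h : L.Above g g') : L.height (g, true) < L.height (g', true) :=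
  h.height_eq ▸ L.height_lt g

theorem height_lt_of_transGen (h : TransGen L.Above g g') :
    L.height (g, true) < L.height (g', true) := by
  induction h with
  | single h => exact h.height_lt
  | tail _ h ih => exact ih.trans h.height_lt

/-- The mirror image. -/
def mirror (L : LocalMap n) : LocalMap n where
  rot := L.rot⁻¹
  -- A corner is named by the half-edge that it follows; the corner following `d` in the mirror
  -- image precedes it in `L`, where it is named by `L.rot⁻¹ d`.
  out d := L.out (L.rot⁻¹ d)
  height := L.height
  height_rot d := by rw [← L.height_rot (L.rot⁻¹ d), Perm.apply_inv_apply]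
  height_lt := L.height_lt
  out_face d := by
    rw [← L.out_face, Perm.apply_inv_apply]
    simp
  unique_vertex b d d' h h1 h2 h3 h4 := by
    refine (L.rot⁻¹).injective (L.unique_vertex (!b) _ _ ?_ h2 ?_ h4 ?_)
    · exact Perm.sameCycle_inv.1 (Perm.sameCycle_apply_left.2 (Perm.sameCycle_apply_right.2 h))
    · rw [Perm.apply_inv_apply, h1, Bool.not_not]
    · rw [Perm.apply_inv_apply, h3, Bool.not_not]
  unique_face b d d' h h1 h2 h3 h4 := by
    refine (L.rot⁻¹).injective (L.unique_face b _ _ ?_ h2 ?_ h4 ?_)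
    · rw [show oppositeHalf n * L.rot⁻¹ = L.rot * (oppositeHalf n * L.rot)⁻¹ * L.rot⁻¹ by
        rw [mul_inv_rev, oppositeHalf_inv, mul_inv_cancel_left], Perm.sameCycle_conj,
        Perm.sameCycle_inv] at h
      exact h
    · rw [Perm.apply_inv_apply, h1]
    · rw [Perm.apply_inv_apply, h3]
  pole_of_out d d' h1 h2 h3 := by
    rw [← h1]
    refine L.pole_of_out _ _ (by rw [Perm.apply_inv_apply, h1]) h2 ?_
    exact Perm.sameCycle_inv.1 (Perm.sameCycle_apply_left.2 h3)

/-- The map with all edges reversed. -/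
def reverse (L : LocalMap n) : LocalMap n where
  rot := oppositeHalf n * L.rot * (oppositeHalf n)⁻¹
  out d := L.out (oppositeHalf n d)
  height d := - L.height (oppositeHalf n d)
  height_rot d := by
    rw [oppositeHalf_inv, Perm.mul_apply, Perm.mul_apply, oppositeHalf_oppositeHalf, L.height_rot]
  height_lt e := neg_lt_neg (L.height_lt e)
  out_face d := by
    rw [oppositeHalf_inv, Perm.mul_apply, Perm.mul_apply, oppositeHalf_oppositeHalf,
      ← L.out_face (oppositeHalf n d)]
  unique_vertex b d d' h h1 h2 h3 h4 := by
    rw [Perm.sameCycle_conj] at h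
    rw [oppositeHalf_inv] at *
    refine (oppositeHalf n).injective (L.unique_vertex (!b) _ _ h ?_ ?_ ?_ ?_)
    · simp [h1]
    · simpa using h2
    · simp [h3]
    · simpa using h4
  unique_face b d d' h h1 h2 h3 h4 := by
    rw [← mul_assoc, ← mul_assoc, mul_assoc (oppositeHalf n), Perm.sameCycle_conj] at h
    rw [oppositeHalf_inv] at *
    refine (oppositeHalf n).injective (L.unique_face (!b) _ _ h ?_ ?_ ?_ ?_)
    · simp [h1]
    · simpa using h2
    · simp [h3]
    · simpa using h4
  pole_of_out d d' h1 h2 h3 := by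
    rw [Perm.sameCycle_conj] at h3
    rw [oppositeHalf_inv] at *
    have := L.pole_of_out _ _ (by simpa using h1) h2 h3
    simpa using this

/-- Mirroring keeps `Above` and turns `Beside` around, while reversal turns both around. Facts
proved for one side or one end of a face thus carry over to the others. -/
theorem above_mirror : L.mirror.Above = L.Above := by
  ext g g'
  exact Perm.sameCycle_inv

theorem above_reverse : L.reverse.Above = Function.swap L.Above := by
  ext g g'
  unfold Above reverse
  rw [Perm.sameCycle_conj, Perm.sameCycle_comm, oppositeHalf_inv]
  rfl

theorem sameCycle_face_mirror :
    L.mirror.face.SameCycle d d' ↔ L.face.SameCycle (L.rot⁻¹ d) (L.rot⁻¹ d') := by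
  unfold face mirror
  rw [show oppositeHalf n * L.rot⁻¹ = L.rot * (oppositeHalf n * L.rot)⁻¹ * L.rot⁻¹ by
    rw [mul_inv_rev, oppositeHalf_inv, mul_inv_cancel_left], Perm.sameCycle_conj,
    Perm.sameCycle_inv]

theorem sameCycle_face_inv_rot (d : HalfEdge n) :
    L.face.SameCycle (L.rot⁻¹ d) (oppositeHalf n d) := by
  have := Perm.sameCycle_apply_self_right (σ := L.face) (x := L.rot⁻¹ d)
  rwa [face, Perm.mul_apply, Perm.apply_inv_apply] at this

theorem beside_mirror : L.mirror.Beside = Function.swap L.Beside := by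
  ext g g'
  unfold Beside Function.swap
  have h1 : L.face.SameCycle (L.rot⁻¹ (g, false)) (g, true) := sameCycle_face_inv_rot _
  have h2 : L.face.SameCycle (L.rot⁻¹ (g', true)) (g', false) := sameCycle_face_inv_rot _
  have h3 : L.mirror.out (g, false) ↔ L.out (g, true) := out_iff h1
  rw [h3, sameCycle_face_mirror]
  constructor
  · rintro ⟨h, ho⟩
    have := h2.symm.trans (h.symm.trans h1)
    exact ⟨this, by rwa [out_iff this]⟩
  · rintro ⟨h, ho⟩
    exact ⟨h1.trans (h.symm.trans h2.symm), by
      have := out_iff h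
      rwa [← this]⟩

theorem beside_reverse : L.reverse.Beside = Function.swap L.Beside := by
  ext g g'
  have h : L.reverse.face = oppositeHalf n * L.face * (oppositeHalf n)⁻¹ := by
    simp only [face, reverse, mul_assoc]
  unfold Beside Function.swap
  rw [h, Perm.sameCycle_conj, Perm.sameCycle_comm, oppositeHalf_inv]
  refine and_congr_right fun h => not_congr (out_iff (L := L) ?_)
  exact h.symm

/-- The edges that leave a vertex are beside each other, from left to right. -/
theorem eq_or_beside_of_last_out (h : L.rot.SameCycle (g, true) (j, true))
    (hj : (L.rot (j, true)).2 = false) : g = j ∨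
      TransGen (fun a b => L.Beside a b ∧ L.rot.SameCycle (a, true) (b, true)) j g := by
  obtain ⟨k, hk⟩ := h.exists_nat_pow_eq
  clear h
  induction k generalizing g with
  | zero => exact Or.inl (congrArg Prod.fst hk)
  | succ k ih =>
    rw [pow_succ, Perm.mul_apply] at hk
    obtain ⟨⟨g', b⟩, hg'⟩ : ∃ z, L.rot (g, true) = z := ⟨_, rfl⟩
    rw [hg'] at hk
    have hc := sameCycle_rot hg'
    have hcj : L.rot.SameCycle (g', b) (j, true) := ⟨k, by exact_mod_cast hk⟩
    cases b
    · left
      have := L.unique_vertex true _ _ (hc.trans hcj) rfl (by rw [hg']; rfl) rfl hj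
      exact congrArg Prod.fst this
    -- The face between the two outgoing edges is inner: an outer corner of this kind would make the
    -- vertex a pole, but an incoming half-edge follows `j`.
    · have hbeside : L.Beside g' g := by
        have h1 := sameCycle_face hg'
        refine ⟨h1.symm, fun hout => ?_⟩
        have := L.pole_of_out _ (L.rot (j, true)) (by rw [hg']) ((out_iff h1).2 hout)
          (Perm.sameCycle_apply_right.2 (hc.trans hcj))
        simp [hj] at this
      rcases ih hk with rfl | h
      · exact Or.inr (.single ⟨hbeside, hc.symm⟩)
      · exact Or.inr (h.tail ⟨hbeside, hc.symm⟩)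

theorem eq_or_beside_of_last_in (h : L.rot.SameCycle (g, false) (j, false))
    (hj : (L.rot (j, false)).2 = true) : g = j ∨
      TransGen (fun a b => L.Beside a b ∧ L.rot.SameCycle (a, false) (b, false)) g j := by
  have key : ∀ {a b : Fin n}, L.reverse.rot.SameCycle (a, true) (b, true) ↔
      L.rot.SameCycle (a, false) (b, false) := fun {a b} => by
    unfold reverse
    rw [Perm.sameCycle_conj, oppositeHalf_inv]
    rfl
  have := eq_or_beside_of_last_out (L := L.reverse) (key.2 h) (by
    simpa [reverse, oppositeHalf_inv] using hj)
  refine this.imp_right fun h => ?_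
  rw [← Relation.transGen_swap]
  refine Relation.TransGen.mono (fun a b hab => ?_) _ _ h
  rw [beside_reverse, key] at hab
  exact ⟨hab.1, hab.2.symm⟩

/-- The edges to the left of a face form a path that ends at the top of the face. -/
theorem eq_or_above_of_top (hi : (L.rot (i, false)).2 = false)
    (h : L.face.SameCycle (l, false) (i, false)) : l = i ∨ TransGen L.Above l i := by
  obtain ⟨k, hk⟩ := h.exists_nat_pow_eq
  clear h
  induction k generalizing l with
  | zero => exact Or.inl (congrArg Prod.fst hk)
  | succ k ih =>
    rw [pow_succ, Perm.mul_apply] at hk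
    obtain ⟨⟨x, b⟩, hx⟩ : ∃ z, L.rot (l, false) = z := ⟨_, rfl⟩
    rw [face_apply hx] at hk
    cases b
    · left
      have hc : L.face.SameCycle (l, false) (i, false) :=
        (sameCycle_face hx).trans ⟨k, by exact_mod_cast hk⟩
      exact congrArg Prod.fst (L.unique_face false _ _ hc rfl (by rw [hx]) rfl hi)
    · have hlx : L.Above l x := sameCycle_rot hx
      rcases ih hk with rfl | h
      · exact Or.inr (.single hlx)
      · exact Or.inr (.head hlx h)

/-- Reversal of `eq_or_above_of_top`: the path on the right side of a face starts at the bottom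
corner. -/
theorem eq_or_above_of_bottom_right (hi : (L.rot (i, true)).2 = true)
    (h : L.face.SameCycle (i, true) (l, true)) : l = i ∨ TransGen L.Above i l := by
  have := eq_or_above_of_top (L := L.reverse) (i := i) (l := l)
    (by simpa [reverse, oppositeHalf_inv] using hi)
    (by
      rw [show L.reverse.face = oppositeHalf n * L.face * (oppositeHalf n)⁻¹ by
        simp only [face, reverse, mul_assoc], Perm.sameCycle_conj, oppositeHalf_inv]
      exact h.symm)
  rw [above_reverse, Relation.transGen_swap] at this
  exact this

/-- The bottom corner lies between the first edges `y` and `j` of the right and left sides of the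
face; mirroring and reversal turn it into a top corner. -/
theorem eq_or_above_of_bottom_left (hi : L.rot (y, true) = (j, true))
    (h : L.face.SameCycle (x, false) (y, true)) : x = j ∨ TransGen L.Above j x := by
  have := eq_or_above_of_top (L := L.mirror.reverse) (i := j) (l := x)
    (by
      have : L.rot.symm (j, true) = (y, true) := by rw [← hi, symm_apply_apply]
      simp [reverse, mirror, oppositeHalf_inv, this])
    (by
      rw [show L.mirror.reverse.face = L.face⁻¹ by
        simp only [face, reverse, mirror, oppositeHalf_inv, mul_inv_rev]
        rw [← mul_assoc, ← mul_assoc, oppositeHalf_mul_self, one_mul], Perm.sameCycle_inv]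
      exact h.trans (sameCycle_face hi))
  rw [above_reverse, above_mirror, Relation.transGen_swap] at this
  exact this

theorem wellFounded_height (L : LocalMap n) :
    WellFounded fun g h : Fin n => L.height (g, false) < L.height (h, false) := by
  have : IsTrans (Fin n) fun g h : Fin n => L.height (g, false) < L.height (h, false) :=
    ⟨fun _ _ _ => lt_trans⟩
  have : Std.Irrefl fun g h : Fin n => L.height (g, false) < L.height (h, false) :=
    ⟨fun _ => lt_irrefl _⟩
  exact Finite.wellFounded_of_trans_of_irrefl _

/-- The right side of an edge is closed under going up. -/
theorem beside_above (hQ : TransGen L.Beside e g) (hP : L.Above g g') :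
    TransGen L.Beside e g' ∨ TransGen L.Above e g' := by
  -- Induction on the height of the head of `g`. Inside it, `k` counts the turns from `g'` to an
  -- incoming edge `g₁`, so that the incoming edges are treated from left to right.
  induction g using L.wellFounded_height.induction generalizing e g' with
  | _ g ih =>
  obtain ⟨k, hk⟩ := hP.symm.exists_nat_pow_eq
  have hgg := hP.height_eq
  clear hP
  suffices H : ∀ k : ℕ, ∀ g₁, (L.rot ^ k) (g', true) = (g₁, false) → ∀ e, TransGen L.Beside e g₁ →
      TransGen L.Beside e g' ∨ TransGen L.Above e g' from H k g hk e hQ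
  clear hQ hk e
  intro k
  induction k with
  | zero => intro g₁ h; simp at h
  | succ k ihk =>
    intro g₁ hk e hQ
    rw [pow_succ', Perm.mul_apply] at hk
    obtain ⟨⟨i, b⟩, hi⟩ : ∃ z, (L.rot ^ k) (g', true) = z := ⟨_, rfl⟩
    have hc : L.rot.SameCycle (g', true) (i, b) := ⟨k, by exact_mod_cast hi⟩
    rw [hi] at hk
    have hf := sameCycle_face hk
    obtain ⟨l, hel, hlg⟩ := Relation.TransGen.tail'_iff.1 hQ
    -- If `i` is incoming, its corner with `g₁` is the top of the face to the left of `g₁`, and the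
    -- left side of that face climbs from `l` to `i`. If `i` is outgoing, it is the leftmost
    -- outgoing edge and has the same face on its left as `g₁`.
    cases b
    · have hPi : L.Above i g' := hc.symm
      have hih : L.height (i, false) = L.height (g, false) := by rw [← hPi.height_eq, hgg]
      rcases eq_or_above_of_top (by rw [hk]) (hlg.1.trans hf.symm) with rfl | hli
      · rcases Relation.reflTransGen_iff_eq_or_transGen.1 hel with rfl | hel
        · exact Or.inr (.single hPi)
        · exact ihk _ hi _ hel
      -- Along this climb every head before the last is lower than the head of `g`, so the outer
      -- induction hypothesis passes the alternative from edge to edge.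
      · have hprop : ∀ y, TransGen L.Above l y → L.height (y, false) ≤ L.height (g, false) →
            TransGen L.Beside e y ∨ TransGen L.Above e y := by
          intro y hy
          induction hy with
          | single hly =>
            intro hle
            rcases Relation.reflTransGen_iff_eq_or_transGen.1 hel with rfl | hel
            · exact Or.inr (.single hly)
            · refine ih _ (lt_of_lt_of_le ?_ hle) hel hly
              rw [← hly.height_eq]
              exact L.height_lt _
          | @tail y z _ hyz ihy =>
            intro hle
            have hlt : L.height (y, false) < L.height (z, false) := by
              rw [← hyz.height_eq]
              exact L.height_lt _
            rcases ihy (hlt.le.trans hle) with h | h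
            · exact ih _ (hlt.trans_le hle) h hyz
            · exact Or.inr (h.tail hyz)
        rcases hprop i hli hih.le with h | h
        · exact ihk _ hi _ h
        · exact Or.inr (h.tail hPi)
    · have hej : TransGen L.Beside e i :=
        Relation.TransGen.tail' hel ⟨hlg.1.trans hf.symm, hlg.2⟩
      rcases eq_or_beside_of_last_out hc (by rw [hk]) with rfl | h
      · exact Or.inl hej
      · exact Or.inl (hej.trans (Relation.TransGen.mono (fun a b h => h.1) _ _ h))

theorem beside_trans_above (hQ : TransGen L.Beside e g) (hP : TransGen L.Above g g') :
    TransGen L.Beside e g' ∨ TransGen L.Above e g' := by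
  induction hP with
  | single h => exact beside_above hQ h
  | tail _ h ih =>
    rcases ih with ih | ih
    · exact beside_above ih h
    · exact Or.inr (ih.tail h)

theorem above_trans_beside (hP : TransGen L.Above e g) (hQ : TransGen L.Beside g g') :
    TransGen L.Beside e g' ∨ TransGen L.Above e g' := by
  have := beside_trans_above (L := L.reverse) (e := g') (g := g) (g' := e)
  rw [above_reverse, beside_reverse] at this
  simp only [Relation.transGen_swap] at this
  exact this hQ hP

end LocalMap


open Relation (TransGen ReflTransGen)

/-- The index counts the steps needed to reach an element satisfying `p`. -/
theorem Equiv.Perm.exists_index {α : Type*} (σ : Perm α) [Finite α] (p : α → Prop)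
    (hp : ∀ d, ∃ d', σ.SameCycle d d' ∧ p d') :
    ∃ idx : α → ℕ, ∀ d, ¬ p d → idx d = idx (σ d) + 1 := by
  classical
  have H : ∀ d, ∃ k : ℕ, p ((σ ^ k) d) := fun d => by
    obtain ⟨d', h, hd'⟩ := hp d
    obtain ⟨k, rfl⟩ := h.exists_nat_pow_eq
    exact ⟨k, hd'⟩
  refine ⟨fun d => Nat.find (H d), fun d hd => ?_⟩
  have h2 : ∃ k, p ((σ ^ (k + 1)) d) := by
    simpa only [pow_succ, Perm.mul_apply] using H (σ d)
  refine (Nat.find_comp_succ (H d) h2 (by simpa using hd)).trans ?_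
  simp only [pow_succ, Perm.mul_apply]

/-! ### Acyclicity of the relation beside, and the total order of the edges. -/

namespace LocalMap

variable {n : ℕ} {L : LocalMap n} {e g g' i j x y : Fin n} {m : ℤ}

/-- An upward sweep: a numbering of the edges with tails below height `m` extends to those with
tails at height `m`. The edges leaving a vertex are inserted just after its last incoming edge,
whose number is `F y` (0 if there is none), and from left to right according to `idx`. The factor
`B` makes room for them. -/
theorem exists_strictMono_beside_step
    (hsource : ∀ d, (∀ d', L.rot.SameCycle d d' → d'.2 = true) →
      ∃ d', L.rot.SameCycle d d' ∧ L.out d') {f : Fin n → ℤ}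
    (hf : ∀ x y, L.height (x, true) < m → L.height (y, true) < m → L.Beside x y → f x < f y) :
    ∃ f : Fin n → ℤ, ∀ x y, L.height (x, true) < m + 1 → L.height (y, true) < m + 1 →
      L.Beside x y → f x < f y := by
  classical
  -- `idx` counts the turns to the leftmost outgoing edge of the vertex or to an outer corner. A
  -- vertex without incoming edges has an outer corner by `hsource`, so the count stops.
  obtain ⟨idx, hidx⟩ := L.rot.exists_index
    (fun d => ¬ (d.2 = true ∧ (L.rot d).2 = true ∧ ¬ L.out d)) (by
      intro d
      by_contra! hcon
      obtain ⟨d', h, h'⟩ := hsource d fun d' h => (hcon d' h).1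
      exact (hcon d' h).2.2 h')
  obtain ⟨B, hB⟩ : ∃ B : ℕ, ∀ y, idx (y, true) + 1 < B :=
    ⟨∑ y, (idx (y, true) + 2), fun y => by
      have := Finset.single_le_sum (f := fun y => idx (y, true) + 2) (fun _ _ => Nat.zero_le _)
        (Finset.mem_univ y)
      exact this⟩
  obtain ⟨F, hF, hF'⟩ : ∃ F : Fin n → ℤ,
      (∀ i y, L.Above i y → (L.rot (i, false)).2 = true → F y = f i) ∧
      ∀ x y, L.rot.SameCycle (x, true) (y, true) → F x = F y := by
    let p : Fin n → Fin n → Prop := fun y i => L.Above i y ∧ (L.rot (i, false)).2 = true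
    have key : ∀ i y, p y i → (if h : ∃ i, p y i then f h.choose else 0) = f i := by
      intro i y hi
      have h : ∃ i, p y i := ⟨i, hi⟩
      rw [dif_pos h]
      have := L.unique_vertex false _ _ (h.choose_spec.1.trans hi.1.symm) rfl h.choose_spec.2 rfl
        hi.2
      exact congrArg f (congrArg Prod.fst this)
    refine ⟨fun y => if h : ∃ i, p y i then f h.choose else 0, fun i y h h' => key i y ⟨h, h'⟩,
      fun x y h => ?_⟩
    by_cases hx : ∃ i, p x i
    · obtain ⟨i, hi⟩ := hx
      exact (key i x hi).trans (key i y ⟨hi.1.trans h, hi.2⟩).symm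
    · have hy : ¬ ∃ i, p y i := fun ⟨i, hi⟩ => hx ⟨i, hi.1.trans h.symm, hi.2⟩
      simp only [dif_neg hx, dif_neg hy]
  -- The incoming edges of a vertex are beside each other from left to right, and `F y` is the
  -- number of the last one.
  have hparent : ∀ i y, L.Above i y → L.height (y, true) < m + 1 → f i ≤ F y := by
    intro i y hi hy
    obtain ⟨⟨k, b⟩, hk, hb, hk'⟩ := hi.exists_change (fun d => !d.2) rfl rfl
    obtain rfl : b = false := by simpa using hb
    replace hk' : (L.rot (k, false)).2 = true := by simpa using hk'
    rw [hF k y (hk.symm.trans hi) hk']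
    have hlow : ∀ a, L.rot.SameCycle (i, false) (a, false) → L.height (a, true) < m := fun a ha => by
      have h1 := L.height_lt a
      have h2 := height_eq ha
      have h3 := hi.height_eq
      omega
    rcases eq_or_beside_of_last_in hk hk' with rfl | h
    · exact le_rfl
    · refine le_of_lt (And.right (a := L.rot.SameCycle (i, false) (k, false)) ?_)
      clear hk hk' hb
      induction h with
      | single h => exact ⟨h.2, hf _ _ (hlow _ (.refl _ _)) (hlow _ h.2) h.1⟩
      | tail _ h ih =>
        exact ⟨ih.1.trans h.2, ih.2.trans (hf _ _ (hlow _ ih.1) (hlow _ (ih.1.trans h.2)) h.1)⟩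
  refine ⟨fun y => if L.height (y, true) < m then B * f y else B * F y + (idx (y, true) + 1),
    fun x y hx hy hxy => ?_⟩
  -- Either the right side of the face continues below `y` along an edge `i`, or `y` starts at the
  -- bottom of the face. The next alternative says the same of `x` on the left side.
  have hbottom : (∃ i, L.rot (y, true) = (i, false) ∧ L.face.SameCycle (y, true) (i, true) ∧
      L.Above i y) ∨ ∃ j, L.rot (y, true) = (j, true) ∧ (x = j ∨ TransGen L.Above j x) := by
    obtain ⟨⟨i, b⟩, h⟩ : ∃ z, L.rot (y, true) = z := ⟨_, rfl⟩
    cases b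
    · exact Or.inl ⟨i, h, sameCycle_face h, (sameCycle_rot h).symm⟩
    · exact Or.inr ⟨i, h, eq_or_above_of_bottom_left h hxy.1⟩
  have htop : (∃ k, L.rot (k, false) = (x, true) ∧ L.Beside k y ∧ L.Above k x) ∨
      ∃ j, L.rot (j, true) = (x, true) ∧ (y = j ∨ TransGen L.Above j y) := by
    obtain ⟨⟨k, b⟩, h⟩ : ∃ z, L.rot z = (x, true) := L.rot.surjective _
    have h' := sameCycle_face h
    cases b
    · exact Or.inl ⟨k, h, ⟨h'.trans hxy.1, by rw [out_iff h']; exact hxy.2⟩, sameCycle_rot h⟩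
    · exact Or.inr ⟨k, h, eq_or_above_of_bottom_right (by rw [h]) (h'.trans hxy.1)⟩
  have hlow : ∀ {a b}, L.Above a b → L.height (b, true) < m + 1 → L.height (a, true) < m :=
    fun h h' => by have := h.height_lt; omega
  have hBx := hB x
  have hBy := hB y
  have hmul : ∀ {a b : ℤ}, a < b → B * a + B ≤ B * b := fun {a b} h => by nlinarith
  dsimp only
  -- A new edge is compared through the edge just below it on the face, which is already numbered. A
  -- bottom corner either contradicts the heights or has `x` and `y` as neighbouring outgoing edges,
  -- ordered by `idx`.
  split_ifs with h1 h2 h2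
  · have := hmul (hf x y h1 h2 hxy)
    omega
  · rcases hbottom with ⟨i, -, hyi, hi⟩ | ⟨j, hj, hjx⟩
    · have := hmul ((hf x i h1 (hlow hi hy) ⟨hxy.1.trans hyi, hxy.2⟩).trans_le (hparent i y hi hy))
      omega
    · have hh := height_eq (sameCycle_rot hj)
      rcases hjx with rfl | hjx
      · omega
      · have := height_lt_of_transGen hjx
        omega
  · rcases htop with ⟨k, hk, hky, hkx⟩ | ⟨j, hj, hjy⟩
    · rw [hF k x hkx (by rw [hk])]
      have := hmul (hf k y (hlow hkx hx) h2 hky)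
      omega
    · have hh := height_eq (sameCycle_rot hj)
      rcases hjy with rfl | hjy
      · omega
      · have := height_lt_of_transGen hjy
        omega
  · rcases hbottom with ⟨i, hyi', hyi, hi⟩ | ⟨j, hj, hjx⟩
    · rcases htop with ⟨k, hk, hky, hkx⟩ | ⟨j, hj, hjy⟩
      · rw [hF k x hkx (by rw [hk])]
        have := hmul ((hf k i (hlow hkx hx) (hlow hi hy) ⟨hky.1.trans hyi, hky.2⟩).trans_le
          (hparent i y hi hy))
        omega
      · have hh := height_eq (sameCycle_rot hj)
        rcases hjy with rfl | hjy
        · rw [hyi'] at hj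
          simp at hj
        · have := height_lt_of_transGen hjy
          omega
    · have hh := height_eq (sameCycle_rot hj)
      rcases hjx with rfl | hjx
      · rw [hF' y x (sameCycle_rot hj), hidx (y, true) (by
          rw [not_not, hj]
          exact ⟨rfl, rfl, by rw [← out_iff hxy.1]; exact hxy.2⟩), hj]
        push_cast
        omega
      · have := height_lt_of_transGen hjx
        omega

/-- The numbering witnesses that `Beside` has no cycles. Heights are bounded, so finitely many steps
of the sweep suffice. -/
theorem exists_strictMono_beside
    (hsource : ∀ d, (∀ d', L.rot.SameCycle d d' → d'.2 = true) →
      ∃ d', L.rot.SameCycle d d' ∧ L.out d') :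
    ∃ f : Fin n → ℤ, ∀ x y, L.Beside x y → f x < f y := by
  obtain ⟨m, hm⟩ : ∃ m, ∀ x : Fin n, m ≤ L.height (x, true) := by
    obtain ⟨m, hm⟩ := (Set.finite_range fun x : Fin n => L.height (x, true)).bddBelow
    exact ⟨m, fun x => hm ⟨x, rfl⟩⟩
  obtain ⟨M, hM⟩ : ∃ M, ∀ x : Fin n, L.height (x, true) ≤ M := by
    obtain ⟨m, hm⟩ := (Set.finite_range fun x : Fin n => L.height (x, true)).bddAbove
    exact ⟨m, fun x => hm ⟨x, rfl⟩⟩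
  have key : ∀ c : ℕ, ∃ f : Fin n → ℤ, ∀ x y, L.height (x, true) < m + c →
      L.height (y, true) < m + c → L.Beside x y → f x < f y := by
    intro c
    induction c with
    | zero => exact ⟨0, fun x y hx => by have := hm x; omega⟩
    | succ c ih =>
      obtain ⟨f, hf⟩ := ih
      obtain ⟨f, hf⟩ := exists_strictMono_beside_step hsource hf
      exact ⟨f, fun x y hx hy => hf x y (by omega) (by omega)⟩
  obtain ⟨f, hf⟩ := key (M + 1 - m).toNat
  exact ⟨f, fun x y => hf x y (by have := hM x; omega) (by have := hM y; omega)⟩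

/-- The order of the edges in which an edge precedes those above it and those beside it. -/
def Precedes (L : LocalMap n) (e g : Fin n) : Prop :=
  TransGen L.Above e g ∨ TransGen L.Beside e g

theorem Precedes.trans (h : L.Precedes e g) (h' : L.Precedes g g') : L.Precedes e g' := by
  rcases h with h | h <;> rcases h' with h' | h'
  · exact Or.inl (h.trans h')
  · exact (above_trans_beside h h').symm
  · exact (beside_trans_above h h').symm
  · exact Or.inr (h.trans h')

theorem precedes_irrefl {f : Fin n → ℤ} (hf : ∀ x y, L.Beside x y → f x < f y) (e : Fin n) :
    ¬ L.Precedes e e := by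
  rintro (h | h)
  · exact lt_irrefl _ (height_lt_of_transGen h)
  · have : ∀ {g}, TransGen L.Beside e g → f e < f g := fun h => by
      induction h with
      | single h => exact hf _ _ h
      | tail _ h ih => exact ih.trans (hf _ _ h)
    exact lt_irrefl _ (this h)

/-- The edge that comes next in the order of the edges. -/
def Next (L : LocalMap n) (e g : Fin n) : Prop :=
  ((L.rot (e, false)).2 = true ∧ L.Above e g ∧ (L.rot (g, true)).2 = false) ∨
  ((L.rot (e, false)).2 = false ∧ L.Beside e g ∧ (L.rot (g, true)).2 = true)

theorem Next.precedes (h : L.Next e g) : L.Precedes e g :=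
  h.imp (fun h => .single h.2.1) fun h => .single h.2.1

/-- The edge `e` is recovered from `g` as the last incoming edge at its tail or as the top edge on
the left side of the face to its left; corners of these types are unique. -/
theorem Next.left_unique (h : L.Next e g) (h' : L.Next i g) : e = i := by
  rcases h with ⟨h1, h2, h3⟩ | ⟨h1, h2, h3⟩ <;> rcases h' with ⟨k1, k2, k3⟩ | ⟨k1, k2, k3⟩
  · exact congrArg Prod.fst (L.unique_vertex false _ _ (h2.trans k2.symm) rfl h1 rfl k1)
  · simp [h3] at k3
  · simp [h3] at k3
  · exact congrArg Prod.fst (L.unique_face false _ _ (h2.1.trans k2.1.symm) rfl h1 rfl k1)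

/-- If `e` is the last incoming edge at its head, one takes the leftmost outgoing edge there.
Otherwise the corner after `e` is the top of the face to its right, and one takes the bottom edge on
the other side. Only the top corner of the outer face stops this. -/
theorem exists_next (h : ¬ ((L.rot (e, false)).2 = false ∧ L.out (e, false))) :
    ∃ g, L.Next e g := by
  obtain ⟨⟨g, b⟩, hg⟩ : ∃ z, L.rot (e, false) = z := ⟨_, rfl⟩
  cases b
  · rw [hg] at h
    obtain ⟨⟨x, b⟩, hx, rfl, hx'⟩ := (sameCycle_face hg).symm.exists_change Prod.snd rfl rfl
    refine ⟨x, Or.inr ⟨by rw [hg], ⟨(sameCycle_face hg).trans hx, fun ho => h ⟨rfl, ho⟩⟩, ?_⟩⟩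
    simpa [face] using hx'
  · obtain ⟨⟨x, b⟩, hx, rfl, hx'⟩ := (sameCycle_rot hg).symm.exists_change Prod.snd rfl rfl
    exact ⟨x, Or.inl ⟨by rw [hg], (sameCycle_rot hg).trans hx, hx'⟩⟩

/-- Every chain of `Next` ends at the edge before the top corner of the outer face, which is unique.
As `Next` is injective, of two chains with this common end one contains the other. -/
theorem precedes_total (hout : ∀ d d', L.out d → L.out d' → L.face.SameCycle d d')
    {f : Fin n → ℤ} (hf : ∀ x y, L.Beside x y → f x < f y) (e g : Fin n) :
    e = g ∨ L.Precedes e g ∨ L.Precedes g e := by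
  have hwf : WellFounded fun a b => L.Precedes b a := by
    have : IsTrans (Fin n) fun a b => L.Precedes b a := ⟨fun _ _ _ h h' => h'.trans h⟩
    have : Std.Irrefl fun a b => L.Precedes b a := ⟨precedes_irrefl hf⟩
    exact Finite.wellFounded_of_trans_of_irrefl _
  have hlast : ∀ e, ∃ l, ReflTransGen L.Next e l ∧ (L.rot (l, false)).2 = false ∧
      L.out (l, false) := by
    intro e
    induction e using hwf.induction with
    | _ e ih =>
    by_cases h : (L.rot (e, false)).2 = false ∧ L.out (e, false)
    · exact ⟨e, .refl, h⟩
    · obtain ⟨g, hg⟩ := exists_next h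
      obtain ⟨l, hl, h'⟩ := ih g hg.precedes
      exact ⟨l, .head hg hl, h'⟩
  obtain ⟨l, h1, h2, h3⟩ := hlast e
  obtain ⟨l', k1, k2, k3⟩ := hlast g
  obtain rfl : l = l' :=
    congrArg Prod.fst (L.unique_face false _ _ (hout _ _ h3 k3) rfl h2 rfl k2)
  have hle : ∀ {a b}, ReflTransGen L.Next a b → a = b ∨ L.Precedes a b := fun h => by
    induction h with
    | refl => exact Or.inl rfl
    | tail _ h ih =>
      rcases ih with rfl | ih
      · exact Or.inr h.precedes
      · exact Or.inr (ih.trans h.precedes)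
  rw [← Relation.reflTransGen_swap] at h1 k1
  rcases Relation.ReflTransGen.total_of_right_unique
    (r := Function.swap L.Next) (fun _ _ _ h h' => Next.left_unique h h') h1 k1 with h | h
  · rw [Relation.reflTransGen_swap] at h
    rcases hle h with rfl | h
    · exact Or.inl rfl
    · exact Or.inr (Or.inr h)
  · rw [Relation.reflTransGen_swap] at h
    rcases hle h with rfl | h
    · exact Or.inl rfl
    · exact Or.inr (Or.inl h)

end LocalMap


/-! ### Plane bipolar orientations have the local structure -/

namespace OrientedMap

open Relation (TransGen)

variable {n : ℕ} {M : OrientedMap n}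

instance (M : OrientedMap n) : Finite M.Vertex := inferInstanceAs (Finite (Quotient _))

theorem vertexOf_rot (M : OrientedMap n) (d : HalfEdge n) : M.vertexOf (M.rot d) = M.vertexOf d :=
  (M.vertexOf_eq_iff _ _).2 Perm.sameCycle_apply_self_right.symm

theorem vertexOf_surjective (M : OrientedMap n) : Function.Surjective M.vertexOf :=
  Quotient.mk_surjective

theorem faceOf_surjective (M : OrientedMap n) : Function.Surjective M.faceOf :=
  Quotient.mk_surjective

theorem IsSource.snd_eq {v : M.Vertex} (h : M.IsSource v) {d : HalfEdge n} (hd : M.vertexOf d = v) :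
    d.2 = true := by
  obtain ⟨e, _ | _⟩ := d
  · exact absurd hd (h e)
  · rfl

theorem IsSink.snd_eq {v : M.Vertex} (h : M.IsSink v) {d : HalfEdge n} (hd : M.vertexOf d = v) :
    d.2 = false := by
  obtain ⟨e, _ | _⟩ := d
  · rfl
  · exact absurd hd (h e)

theorem isSource_of_forall {d : HalfEdge n} (h : ∀ d', M.rot.SameCycle d d' → d'.2 = true) :
    M.IsSource (M.vertexOf d) := fun e he => by
  have := h (e, false) ((M.vertexOf_eq_iff _ _).1 he.symm)
  simp at this

namespace IsPlaneBipolar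

variable (h : M.IsPlaneBipolar)
include h

/-- A face whose half-edges all point the same way would be a directed cycle. -/
theorem exists_snd_eq_of_face (b : Bool) (d : HalfEdge n) :
    ∃ d', (oppositeHalf n * M.rot).SameCycle d d' ∧ d'.2 = b := by
  by_contra! hcon
  set φ := oppositeHalf n * M.rot with hφ
  have hφ' : ∀ x, φ x = oppositeHalf n (M.rot x) := fun x => rfl
  have hstep : ∀ k : ℕ, if b then TransGen M.Step (M.vertexOf d) (M.vertexOf ((φ ^ (k + 1)) d))
      else TransGen M.Step (M.vertexOf ((φ ^ (k + 1)) d)) (M.vertexOf d) := by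
    have key : ∀ x, φ.SameCycle d x → if b then M.Step (M.vertexOf x) (M.vertexOf (φ x)) else
        M.Step (M.vertexOf (φ x)) (M.vertexOf x) := by
      intro x hx
      have h2 := hcon (φ x) (Perm.sameCycle_apply_right.2 hx)
      obtain ⟨⟨g, c⟩, hg⟩ : ∃ z, M.rot x = z := ⟨_, rfl⟩
      have h3 := M.vertexOf_rot x
      rw [hφ', hg] at h2
      rw [hφ', ← h3, hg]
      cases b <;> cases c <;> simp at h2 ⊢
      · exact ⟨g, rfl, rfl⟩
      · exact ⟨g, rfl, rfl⟩
    intro k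
    induction k with
    | zero =>
      have := key d (.refl _ _)
      cases b
      · exact .single this
      · exact .single this
    | succ k ih =>
      have := key ((φ ^ (k + 1)) d) ⟨(k + 1 : ℕ), by rw [zpow_natCast]⟩
      rw [pow_succ', Perm.mul_apply]
      cases b
      · exact .head this ih
      · exact .tail ih this
  obtain ⟨k, hk⟩ : ∃ k : ℕ, φ ^ (k + 1) = 1 := by
    refine ⟨orderOf φ - 1, ?_⟩
    rw [Nat.sub_add_cancel (orderOf_pos φ), pow_orderOf_eq_one]
  have := hstep k
  rw [hk] at this
  cases b
  · exact h.acyclic _ this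
  · exact h.acyclic _ this

theorem source_ne_sink (hn : 1 ≤ n) {s t : M.Vertex} (hs : M.IsSource s) (ht : M.IsSink t) :
    s ≠ t := by
  rintro rfl
  have key : ∀ u v : M.Vertex, Relation.EqvGen M.Step u v → (u = s ↔ v = s) := by
    intro u v huv
    induction huv with
    | rel u v h =>
      obtain ⟨e, rfl, rfl⟩ := h
      exact iff_of_false (ht e) (hs e)
    | refl => rfl
    | symm _ _ _ ih => exact ih.symm
    | trans _ _ _ _ _ ih ih' => exact ih.trans ih'
  exact ht ⟨0, hn⟩ ((key _ _ (h.connected s _)).1 rfl)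

theorem card_nonPolar (hn : 1 ≤ n) :
    Nat.card {v : M.Vertex // ¬ M.IsSource v ∧ ¬ M.IsSink v} + 2 = Nat.card M.Vertex := by
  classical
  obtain ⟨s, hs, hs'⟩ := h.unique_source
  obtain ⟨t, ht, ht'⟩ := h.unique_sink
  have hst := h.source_ne_sink hn hs ht
  have : Fintype M.Vertex := Fintype.ofFinite _
  have h1 : ∀ v, (¬ M.IsSource v ∧ ¬ M.IsSink v) ↔ v ∈ ({s, t} : Finset M.Vertex)ᶜ := fun v => by
    rw [Finset.mem_compl, Finset.mem_insert, Finset.mem_singleton, not_or]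
    exact and_congr (not_congr ⟨hs' v, fun h => h ▸ hs⟩) (not_congr ⟨ht' v, fun h => h ▸ ht⟩)
  rw [Nat.card_congr (Equiv.subtypeEquivRight h1), Nat.card_eq_fintype_card, Fintype.card_coe,
    Finset.card_compl, Finset.card_pair hst, Nat.card_eq_fintype_card]
  have := Finset.card_le_univ ({s, t} : Finset M.Vertex)
  rw [Finset.card_pair hst] at this
  omega

/-- Each non-polar vertex has a corner from incoming to outgoing edges and one back, and each face
has a corner between two outgoing and one between two incoming edges. By Euler's relation `2 (V - 2)
+ 2 F = 2 n`, which is the number of all corners, so none of these corners is repeated. -/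
theorem corner_bijective (hn : 1 ≤ n) (b : Bool) :
    (∃ f : {d : HalfEdge n // (d.2, (M.rot d).2) = (b, !b)} →
        {v : M.Vertex // ¬ M.IsSource v ∧ ¬ M.IsSink v},
      Function.Injective f ∧ ∀ d, (f d : M.Vertex) = M.vertexOf d) ∧
    Function.Injective fun d : {d : HalfEdge n // (d.2, (M.rot d).2) = (b, b)} => M.faceOf d := by
  have hpole : ∀ c (d : {d : HalfEdge n // (d.2, (M.rot d).2) = (c, !c)}),
      ¬ M.IsSource (M.vertexOf d) ∧ ¬ M.IsSink (M.vertexOf d) := by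
    rintro c ⟨d, hd⟩
    refine ⟨fun hs => ?_, fun hs => ?_⟩ <;>
    · have h1 := hs.snd_eq (d := d) rfl
      have h2 := hs.snd_eq (d := M.rot d) (M.vertexOf_rot d)
      simp [h1, h2] at hd
  let f (c : Bool) : {d : HalfEdge n // (d.2, (M.rot d).2) = (c, !c)} →
      {v : M.Vertex // ¬ M.IsSource v ∧ ¬ M.IsSink v} := fun d => ⟨M.vertexOf d, hpole c d⟩
  have hf : ∀ c, Function.Surjective (f c) := by
    rintro c ⟨v, hv⟩
    simp only [IsSource, IsSink, not_forall, not_not] at hv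
    obtain ⟨⟨e, he⟩, ⟨e', he'⟩⟩ := hv
    have key : ∀ x y : HalfEdge n, M.vertexOf x = v → M.vertexOf y = v → x.2 = c → y.2 = !c →
        ∃ d, f c d = ⟨v, hv⟩ := by
      intro x y hx hy hxc hyc
      obtain ⟨z, h1, h2, h3⟩ := Perm.SameCycle.exists_change
        ((M.vertexOf_eq_iff x y).1 (hx.trans hy.symm)) (fun d => d.2 == c) (by simp [hxc])
        (by simp [hyc])
      refine ⟨⟨z, ?_⟩, Subtype.ext (((M.vertexOf_eq_iff x z).2 h1).symm.trans hx)⟩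
      simp at h2 h3
      simp [h2, Bool.eq_not.2 h3]
    cases c
    · exact key (e, false) (e', true) he he' rfl rfl
    · exact key (e', true) (e, false) he' he rfl rfl
  let g (c : Bool) : {d : HalfEdge n // (d.2, (M.rot d).2) = (c, c)} → M.Face :=
    fun d => M.faceOf d
  have hg : ∀ c, Function.Surjective (g c) := by
    intro c v
    obtain ⟨d, rfl⟩ := M.faceOf_surjective v
    obtain ⟨x, hx, hxc⟩ := h.exists_snd_eq_of_face c d
    obtain ⟨y, hy, hyc⟩ := h.exists_snd_eq_of_face (!c) d
    obtain ⟨z, h1, h2, h3⟩ := Perm.SameCycle.exists_change (hx.symm.trans hy) (fun d => d.2 == c)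
      (by simp [hxc]) (by simp [hyc])
    refine ⟨⟨z, ?_⟩, ((M.faceOf_eq_iff _ _).2 (hx.trans h1)).symm⟩
    simp at h2 h3
    simp [h2, h3]
  have hcard : ∑ c : Bool × Bool, Nat.card {d : HalfEdge n // (d.2, (M.rot d).2) = c} = 2 * n := by
    have := Finset.card_eq_sum_card_fiberwise (s := Finset.univ) (t := Finset.univ)
      (f := fun d : HalfEdge n => (d.2, (M.rot d).2)) (fun _ _ => Finset.mem_coe.2 (Finset.mem_univ _))
    simp only [Finset.card_univ, Fintype.card_prod, Fintype.card_fin, Fintype.card_bool] at this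
    rw [mul_comm, this]
    refine Finset.sum_congr rfl fun c _ => ?_
    rw [Nat.card_eq_fintype_card, Fintype.card_subtype]
  simp only [Fintype.sum_prod_type, Fintype.sum_bool] at hcard
  have hV := h.card_nonPolar hn
  have hE := h.euler
  have f1 := Nat.card_le_card_of_surjective _ (hf true)
  have f2 := Nat.card_le_card_of_surjective _ (hf false)
  have g1 := Nat.card_le_card_of_surjective _ (hg true)
  have g2 := Nat.card_le_card_of_surjective _ (hg false)
  simp only [Bool.not_true, Bool.not_false] at f1 f2
  refine ⟨⟨f b, ((Nat.bijective_iff_surjective_and_card _).2 ⟨hf b, ?_⟩).1, fun d => rfl⟩,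
    ((Nat.bijective_iff_surjective_and_card _).2 ⟨hg b, ?_⟩).1⟩
  · cases b <;> simp only [Bool.not_true, Bool.not_false] <;> omega
  · cases b <;> omega

theorem eq_of_face {b : Bool} (hn : 1 ≤ n) {d d' : HalfEdge n} (hf : M.faceOf d = M.faceOf d')
    (h1 : d.2 = b) (h2 : (M.rot d).2 = b) (h3 : d'.2 = b) (h4 : (M.rot d').2 = b) : d = d' := by
  have := (h.corner_bijective hn b).2 (a₁ := ⟨d, by rw [h1, h2]⟩) (a₂ := ⟨d', by rw [h3, h4]⟩) hf
  exact congrArg Subtype.val this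

theorem eq_of_vertex {b : Bool} (hn : 1 ≤ n) {d d' : HalfEdge n}
    (hf : M.vertexOf d = M.vertexOf d') (h1 : d.2 = b) (h2 : (M.rot d).2 = !b) (h3 : d'.2 = b)
    (h4 : (M.rot d').2 = !b) : d = d' := by
  obtain ⟨f, hi, hv⟩ := (h.corner_bijective hn b).1
  have := hi (a₁ := ⟨d, by rw [h1, h2]⟩) (a₂ := ⟨d', by rw [h3, h4]⟩)
    (Subtype.ext (by rw [hv, hv]; exact hf))
  exact congrArg Subtype.val this

/-- The pole of the matching kind has an outer corner of this type, and by `eq_of_face` the outer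
face has only one. -/
theorem isPole_of_outer (hn : 1 ≤ n) {d : HalfEdge n} (h1 : (M.rot d).2 = d.2)
    (h2 : M.faceOf d = M.outerFace) :
    if d.2 then M.IsSource (M.vertexOf d) else M.IsSink (M.vertexOf d) := by
  obtain ⟨e, _ | _⟩ := d
  · obtain ⟨t, ht, -⟩ := h.unique_sink
    obtain ⟨d', rfl, ho⟩ := h.sink_outer t ht
    have := h.eq_of_face hn (h2.trans ho.symm) rfl h1 (ht.snd_eq rfl)
      (ht.snd_eq (M.vertexOf_rot d'))
    rw [this, ht.snd_eq (d := d') rfl]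
    exact ht
  · obtain ⟨s, hs, -⟩ := h.unique_source
    obtain ⟨d', rfl, ho⟩ := h.source_outer s hs
    have := h.eq_of_face hn (h2.trans ho.symm) rfl h1 (hs.snd_eq rfl)
      (hs.snd_eq (M.vertexOf_rot d'))
    rw [this, hs.snd_eq (d := d') rfl]
    exact hs

/-- The number of strict ancestors of a vertex serves as its height; by acyclicity the tail of `e`
is an ancestor of the head but not of itself. -/
theorem ncard_ancestors_lt (e : Fin n) : {u | TransGen M.Step u (M.vertexOf (e, true))}.ncard <
    {u | TransGen M.Step u (M.vertexOf (e, false))}.ncard := by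
  have hstep : M.Step (M.vertexOf (e, true)) (M.vertexOf (e, false)) := ⟨e, rfl, rfl⟩
  refine Set.ncard_lt_ncard ⟨fun u hu => TransGen.tail hu hstep, fun hcon => ?_⟩
  exact h.acyclic _ (hcon (show M.vertexOf (e, true) ∈ _ from TransGen.single hstep))

/-- The local structure of a plane bipolar orientation. -/
noncomputable def localMap (hn : 1 ≤ n) : LocalMap n where
  rot := M.rot
  out d := M.faceOf d = M.outerFace
  height d := ({u | TransGen M.Step u (M.vertexOf d)}.ncard : ℤ)
  height_rot d := by rw [M.vertexOf_rot]
  height_lt e := by exact_mod_cast h.ncard_ancestors_lt e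
  out_face d := by
    rw [show M.faceOf (oppositeHalf n (M.rot d)) = M.faceOf d from
      (M.faceOf_eq_iff _ _).2 (Perm.sameCycle_apply_self_right (σ := oppositeHalf n * M.rot)).symm]
  unique_vertex b d d' hd h1 h2 h3 h4 := h.eq_of_vertex hn ((M.vertexOf_eq_iff _ _).2 hd) h1 h2 h3 h4
  unique_face b d d' hd h1 h2 h3 h4 := h.eq_of_face hn ((M.faceOf_eq_iff _ _).2 hd) h1 h2 h3 h4
  pole_of_out d d' h1 h2 h3 := by
    have := h.isPole_of_outer hn h1 h2
    have hv := ((M.vertexOf_eq_iff _ _).2 h3).symm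
    cases hb : d.2 <;> rw [hb] at this
    · exact IsSink.snd_eq this hv
    · exact IsSource.snd_eq this hv

theorem exists_out (hn : 1 ≤ n) (d : HalfEdge n)
    (hd : ∀ d', (h.localMap hn).rot.SameCycle d d' → d'.2 = true) :
    ∃ d', (h.localMap hn).rot.SameCycle d d' ∧ (h.localMap hn).out d' := by
  obtain ⟨d', hv, ho⟩ := h.source_outer _ (isSource_of_forall hd)
  exact ⟨d', (M.vertexOf_eq_iff _ _).1 hv.symm, ho⟩

theorem sameCycle_of_out (hn : 1 ≤ n) (d d' : HalfEdge n) (hd : (h.localMap hn).out d)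
    (hd' : (h.localMap hn).out d') : (h.localMap hn).face.SameCycle d d' :=
  (M.faceOf_eq_iff _ _).1 (hd.trans hd'.symm)

end IsPlaneBipolar

end OrientedMap


/-! ### The permutation of a plane bipolar orientation -/

open Relation (TransGen ReflTransGen)

/-- The rank of an element is the number of its predecessors. -/
theorem exists_perm_of_strictTotal {n : ℕ} {r : Fin n → Fin n → Prop}
    (trans : ∀ {a b c}, r a b → r b c → r a c) (irrefl : ∀ a, ¬ r a a)
    (total : ∀ a b, a = b ∨ r a b ∨ r b a) : ∃ τ : Perm (Fin n), ∀ a b, r a b ↔ τ a < τ b := by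
  classical
  let f : Fin n → Fin n := fun a => ⟨({b | r b a} : Finset (Fin n)).card, by
    refine (Finset.card_lt_card (t := Finset.univ) ?_).trans_eq (Finset.card_fin n)
    exact (Finset.ssubset_univ_iff).2 fun h => irrefl a (by simpa using h.ge (Finset.mem_univ a))⟩
  have hf : ∀ {a b}, r a b → f a < f b := fun {a b} hab => by
    refine Fin.lt_def.2 (Finset.card_lt_card (s := {c | r c a}) (t := {c | r c b})
      ⟨fun c hc => ?_, fun h => ?_⟩)
    · simp only [Finset.mem_filter, Finset.mem_univ, true_and] at hc ⊢
      exact trans hc hab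
    · exact irrefl a (by simpa using h (by simpa using hab))
  have hinj : Function.Injective f := fun a b hab => by
    rcases total a b with h | h | h
    · exact h
    · exact absurd hab (hf h).ne
    · exact absurd hab (hf h).ne'
  refine ⟨Equiv.ofBijective f (Finite.injective_iff_bijective.1 hinj), fun a b => ⟨hf, fun h => ?_⟩⟩
  rcases total a b with rfl | h' | h'
  · exact absurd h (lt_irrefl _)
  · exact h'
  · exact absurd (hf h') (not_lt.2 (le_of_lt h))

/-! ### The two rankings of the edges as the coordinates of a permutation. -/

namespace LocalMap

variable {n : ℕ} {L : LocalMap n} {τ ρ π : Perm (Fin n)} {a b c e g i j l : Fin n}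

/-- The ranks of the edges in the two orders. -/
structure IsRanking (L : LocalMap n) (τ ρ : Perm (Fin n)) : Prop where
  above_iff : ∀ e g, TransGen L.Above e g ↔ τ e < τ g ∧ ρ e < ρ g
  beside_iff : ∀ e g, TransGen L.Beside e g ↔ τ e < τ g ∧ ρ g < ρ e

theorem precedes_mirror_iff :
    L.mirror.Precedes e g ↔ TransGen L.Above e g ∨ TransGen L.Beside g e := by
  rw [Precedes, above_mirror, beside_mirror, Relation.transGen_swap (r := L.Beside)]

/-- `τ` ranks by `Precedes`, and `ρ` by the same order of the mirror image, in which `Beside` is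
turned around. The two agree on pairs related by `Above` and disagree on pairs related by `Beside`.
-/
theorem exists_isRanking (hout : ∀ d d', L.out d → L.out d' → L.face.SameCycle d d')
    {f : Fin n → ℤ} (hf : ∀ x y, L.Beside x y → f x < f y) : ∃ τ ρ, L.IsRanking τ ρ := by
  have hf' : ∀ x y, L.mirror.Beside x y → - f x < - f y := fun x y h => by
    rw [beside_mirror] at h
    exact neg_lt_neg (hf _ _ h)
  have htotal := precedes_total hout hf
  obtain ⟨τ, hτ⟩ := exists_perm_of_strictTotal (r := L.Precedes) Precedes.trans (precedes_irrefl hf)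
    htotal
  obtain ⟨ρ, hρ⟩ := exists_perm_of_strictTotal (r := L.mirror.Precedes) Precedes.trans
    (precedes_irrefl hf') fun a b => by
      rw [precedes_mirror_iff, precedes_mirror_iff]
      have := htotal a b
      unfold Precedes at this
      tauto
  refine ⟨τ, ρ, fun e g => ?_, fun e g => ?_⟩ <;> rw [← hτ, ← hρ, precedes_mirror_iff]
  · refine ⟨fun h => ⟨Or.inl h, Or.inl h⟩, fun ⟨h, h'⟩ => ?_⟩
    rcases h with h | h
    · exact h
    rcases h' with h' | h'
    · exact h'
    · exact absurd (Or.inr (h.trans h')) (precedes_irrefl hf e)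
  · refine ⟨fun h => ⟨Or.inr h, Or.inr h⟩, fun ⟨h, h'⟩ => ?_⟩
    rcases h with h | h
    · rcases h' with h' | h'
      · exact absurd (Or.inl (h.trans h')) (precedes_irrefl hf e)
      · exact h'
    · exact h

namespace IsRanking

variable (h : L.IsRanking τ ρ)
include h

theorem trichotomy (hlt : τ e < τ g) :
    (ρ e < ρ g ∧ TransGen L.Above e g) ∨ (ρ g < ρ e ∧ TransGen L.Beside e g) := by
  rcases lt_trichotomy (ρ e) (ρ g) with h1 | h1 | h1
  · exact Or.inl ⟨h1, (h.above_iff e g).2 ⟨hlt, h1⟩⟩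
  · exact absurd hlt (ρ.injective h1 ▸ lt_irrefl _)
  · exact Or.inr ⟨h1, (h.beside_iff e g).2 ⟨hlt, h1⟩⟩

theorem lt_of_above (hP : L.Above e g) : τ e < τ g ∧ ρ e < ρ g := (h.above_iff e g).1 (.single hP)

theorem lt_of_beside (hQ : L.Beside e g) : τ e < τ g ∧ ρ g < ρ e := (h.beside_iff e g).1 (.single hQ)

theorem le_of_above (hP : ReflTransGen L.Above e g) : τ e ≤ τ g := by
  rcases Relation.reflTransGen_iff_eq_or_transGen.1 hP with rfl | hP
  · exact le_rfl
  · exact ((h.above_iff e g).1 hP).1.le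

theorem above_of_succ (hs : (τ b : ℕ) = τ a + 1) (hlt : ρ a < ρ b) : L.Above a b := by
  obtain ⟨c, hac, hcb⟩ := Relation.TransGen.tail'_iff.1
    ((h.above_iff a b).2 ⟨Fin.lt_def.2 (by omega), hlt⟩)
  rcases Relation.reflTransGen_iff_eq_or_transGen.1 hac with rfl | hac
  · exact hcb
  · have h1 := Fin.lt_def.1 ((h.above_iff a c).1 hac).1
    have h2 := Fin.lt_def.1 (h.lt_of_above hcb).1
    omega

theorem beside_of_succ (hs : (τ b : ℕ) = τ a + 1) (hlt : ρ b < ρ a) : L.Beside a b := by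
  obtain ⟨c, hac, hcb⟩ := Relation.TransGen.tail'_iff.1
    ((h.beside_iff a b).2 ⟨Fin.lt_def.2 (by omega), hlt⟩)
  rcases Relation.reflTransGen_iff_eq_or_transGen.1 hac with rfl | hac
  · exact hcb
  · have h1 := Fin.lt_def.1 ((h.beside_iff a c).1 hac).1
    have h2 := Fin.lt_def.1 (h.lt_of_beside hcb).1
    omega

/-- In a pattern at the consecutive positions of `a` and `b`, these edges share an inner face or a
vertex. The chain from `e` to `b` enters through it and the chain from `a` to `g` leaves through it,
so together they join `e` to `g` by the same relation. This contradicts the order of the values of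
`e` and `g`. -/
theorem isBaxter (hπ : ∀ e, π (τ e) = ρ e) : IsBaxter π := by
  rintro ⟨i, j, j', k, hij, hjk, hjj, hcon⟩
  obtain ⟨e, rfl⟩ := τ.surjective i
  obtain ⟨a, rfl⟩ := τ.surjective j
  obtain ⟨b, rfl⟩ := τ.surjective j'
  obtain ⟨g, rfl⟩ := τ.surjective k
  simp only [hπ] at hcon
  have heb : τ e < τ b := Fin.lt_def.2 (by have := Fin.lt_def.1 hij; omega)
  rcases hcon with ⟨h1, h2, h3⟩ | ⟨h1, h2, h3⟩
  · have hab := h.beside_of_succ hjj (h1.trans (h2.trans h3))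
    obtain ⟨l, hel, hlb⟩ := Relation.TransGen.tail'_iff.1 ((h.beside_iff e b).2 ⟨heb, h1⟩)
    obtain ⟨r, har, hrg⟩ := Relation.TransGen.head'_iff.1 ((h.beside_iff a g).2 ⟨hjk, h3⟩)
    have hlr : L.Beside l r := ⟨hlb.1.trans (hab.1.symm.trans har.1), hlb.2⟩
    exact lt_asymm h2 ((h.beside_iff e g).1 ((TransGen.tail' hel hlr).trans_left hrg)).2
  · have hab := h.above_of_succ hjj (h1.trans (h2.trans h3))
    obtain ⟨l, hel, hlb⟩ := Relation.TransGen.tail'_iff.1 ((h.above_iff e b).2 ⟨heb, h3⟩)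
    obtain ⟨r, har, hrg⟩ := Relation.TransGen.head'_iff.1 ((h.above_iff a g).2 ⟨hjk, h1⟩)
    have hlr : L.Above l r := hlb.trans (hab.symm.trans har)
    exact lt_asymm h2 ((h.above_iff e g).1 ((TransGen.tail' hel hlr).trans_left hrg)).2

theorem le_of_last_in (hi : L.rot.SameCycle (l, false) (i, false))
    (hi' : (L.rot (i, false)).2 = true) : τ l ≤ τ i := by
  rcases eq_or_beside_of_last_in hi hi' with rfl | hli
  · exact le_rfl
  · exact ((h.beside_iff l i).1 (Relation.TransGen.mono (fun _ _ h => h.1) _ _ hli)).1.le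

theorem le_of_last_out (hj : L.rot.SameCycle (l, true) (j, true))
    (hj' : (L.rot (j, true)).2 = false) : τ j ≤ τ l := by
  rcases eq_or_beside_of_last_out hj hj' with rfl | hli
  · exact le_rfl
  · exact ((h.beside_iff j l).1 (Relation.TransGen.mono (fun _ _ h => h.1) _ _ hli)).1.le

/-- An edge ranked in between could not be above `i`, nor have `j` above it, since it would then
pass the leftmost outgoing or the rightmost incoming edge of the vertex. It would be to the right of
`i` and to the left of `j`, which forces `ρ j < ρ i`. -/
theorem succ_of_last (hij : L.Above i j) (hi : (L.rot (i, false)).2 = true)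
    (hj : (L.rot (j, true)).2 = false) : (τ j : ℕ) = τ i + 1 := by
  have h1 := h.lt_of_above hij
  by_contra hne
  have hlt := Fin.lt_def.1 h1.1
  obtain ⟨c, hc⟩ := τ.surjective ⟨τ i + 1, by omega⟩
  have hic : τ i < τ c := Fin.lt_def.2 (by rw [hc]; simp)
  have hcj : τ c < τ j := Fin.lt_def.2 (by rw [hc]; simp; omega)
  rcases h.trichotomy hic with ⟨-, hP⟩ | ⟨hρ, -⟩
  · obtain ⟨r, hir, hrc⟩ := Relation.TransGen.head'_iff.1 hP
    exact absurd ((h.le_of_last_out (hir.symm.trans hij) hj).trans (h.le_of_above hrc))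
      (not_le.2 hcj)
  · rcases h.trichotomy hcj with ⟨-, hP⟩ | ⟨hρ', -⟩
    · obtain ⟨l, hcl, hlj⟩ := Relation.TransGen.tail'_iff.1 hP
      exact absurd ((h.le_of_above hcl).trans (h.le_of_last_in (hlj.trans hij.symm) hi))
        (not_le.2 hic)
    · exact lt_asymm h1.2 (hρ'.trans hρ)

/-- All edges at an inner vertex see the gap between the consecutive ranks of its last incoming edge
`i` and its leftmost outgoing edge `j`. -/
theorem tailGap_eq (hπ : ∀ e, π (τ e) = ρ e) (hij : L.Above i j)
    (hi : (L.rot (i, false)).2 = true) (hj : (L.rot (j, true)).2 = false)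
    (hg : L.rot.SameCycle (g, true) (j, true)) : tailGap π (τ g) = τ j := by
  refine tailGap_eq_iff.2 ⟨h.le_of_last_out hg hj, fun k hk => ?_, fun k hk hk' => ?_⟩
  · obtain rfl : k = τ i := Fin.ext (by have := h.succ_of_last hij hi hj; omega)
    rw [hπ, hπ]
    exact (h.lt_of_above (g := g) (hij.trans hg.symm)).2
  · obtain ⟨c, rfl⟩ := τ.surjective k
    rw [hπ, hπ]
    rcases h.trichotomy (Fin.lt_def.2 hk) with ⟨-, hP⟩ | ⟨hρ, -⟩
    · obtain ⟨l, hcl, hlg⟩ := Relation.TransGen.tail'_iff.1 hP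
      have h1 := Fin.le_def.1 ((h.le_of_above hcl).trans
        (h.le_of_last_in (hlg.trans (hg.trans hij.symm)) hi))
      have := h.succ_of_last hij hi hj
      omega
    · exact hρ

theorem headGap_eq (hπ : ∀ e, π (τ e) = ρ e) (hij : L.Above i j)
    (hj : (L.rot (j, true)).2 = false)
    (hg : L.rot.SameCycle (g, false) (i, false)) : headGap π (τ g) = τ j := by
  have hgj := h.lt_of_above (e := g) (hg.trans hij)
  refine headGap_eq_iff.2 ⟨hgj.1, (τ j).2.le, fun k hk => ?_, fun k hk hk' => ?_⟩
  · obtain rfl : k = τ j := Fin.ext hk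
    rw [hπ, hπ]
    exact hgj.2
  · obtain ⟨c, rfl⟩ := τ.surjective k
    rw [hπ, hπ]
    rcases h.trichotomy (Fin.lt_def.2 hk) with ⟨-, hP⟩ | ⟨hρ, -⟩
    · obtain ⟨r, hgr, hrc⟩ := Relation.TransGen.head'_iff.1 hP
      have h1 := Fin.le_def.1 ((h.le_of_last_out (hgr.symm.trans (hg.trans hij)) hj).trans
        (h.le_of_above hrc))
      omega
    · exact hρ

theorem tailGap_eq_zero (hπ : ∀ e, π (τ e) = ρ e) (hg : ∀ l, ¬ L.Above l g) :
    tailGap π (τ g) = 0 := by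
  refine tailGap_eq_iff.2 ⟨Nat.zero_le _, fun k hk => by omega, fun k hk _ => ?_⟩
  obtain ⟨c, rfl⟩ := τ.surjective k
  rw [hπ, hπ]
  rcases h.trichotomy (Fin.lt_def.2 hk) with ⟨-, hP⟩ | ⟨hρ, -⟩
  · obtain ⟨l, -, hlg⟩ := Relation.TransGen.tail'_iff.1 hP
    exact absurd hlg (hg l)
  · exact hρ

theorem headGap_eq_last (hπ : ∀ e, π (τ e) = ρ e) (hg : ∀ l, ¬ L.Above g l) :
    headGap π (τ g) = n := by
  refine headGap_eq_iff.2 ⟨(τ g).2, le_rfl, fun k hk => absurd k.2 (by omega), fun k hk _ => ?_⟩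
  obtain ⟨c, rfl⟩ := τ.surjective k
  rw [hπ, hπ]
  rcases h.trichotomy (Fin.lt_def.2 hk) with ⟨-, hP⟩ | ⟨hρ, -⟩
  · obtain ⟨l, hlg, -⟩ := Relation.TransGen.head'_iff.1 hP
    exact absurd hlg (hg l)
  · exact hρ

end IsRanking

/-- The rotation descends only from the last incoming to the first outgoing edge, and at the outer
corners of the poles. -/
theorem of_dartKey_le (h : L.IsRanking τ ρ) {d : HalfEdge n}
    (hd : dartKey (Prod.map τ id (L.rot d)) ≤ dartKey (Prod.map τ id d)) :
    (d.2 = false ∧ (L.rot d).2 = true) ∨ ((L.rot d).2 = d.2 ∧ L.out d) := by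
  obtain ⟨⟨g, c⟩, hg⟩ : ∃ z, L.rot d = z := ⟨_, rfl⟩
  obtain ⟨e, b⟩ := d
  have hf := sameCycle_face hg
  rw [hg] at hd ⊢
  cases b <;> cases c <;> simp only [Prod.map, id, dartKey_true, dartKey_false] at hd ⊢
  · refine Or.inr ⟨trivial, by_contra fun ho => ?_⟩
    have := Fin.lt_def.1 (h.lt_of_beside ⟨hf, ho⟩).1
    omega
  · simp
  · omega
  · refine Or.inr ⟨trivial, by_contra fun ho => ?_⟩
    have := Fin.lt_def.1 (h.lt_of_beside ⟨hf.symm, fun h' => ho ((out_iff hf).2 h')⟩).1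
    omega

/-- At an inner vertex the only descent is the corner from incoming to outgoing edges. An outer
corner between edges of the same kind makes the vertex a pole, which has no such corner and just one
outer one. -/
theorem eq_of_dartKey_le (h : L.IsRanking τ ρ)
    (hout : ∀ d d', L.out d → L.out d' → L.face.SameCycle d d') {d d' : HalfEdge n}
    (hdd : L.rot.SameCycle d d')
    (hd : dartKey (Prod.map τ id (L.rot d)) ≤ dartKey (Prod.map τ id d))
    (hd' : dartKey (Prod.map τ id (L.rot d')) ≤ dartKey (Prod.map τ id d')) : d = d' := by
  have hpole : ∀ {x y}, L.rot.SameCycle x y → (L.rot x).2 = x.2 → L.out x →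
      y.2 = x.2 ∧ (L.rot y).2 = x.2 := fun hxy h1 h2 =>
    ⟨L.pole_of_out _ _ h1 h2 hxy, L.pole_of_out _ _ h1 h2 (Perm.sameCycle_apply_right.2 hxy)⟩
  rcases of_dartKey_le h hd with ⟨h1, h2⟩ | ⟨h1, h2⟩ <;>
  rcases of_dartKey_le h hd' with ⟨h3, h4⟩ | ⟨h3, h4⟩
  · exact L.unique_vertex false _ _ hdd h1 h2 h3 h4
  · obtain ⟨h5, h6⟩ := hpole hdd.symm h3 h4
    rw [h1] at h5
    rw [h2, ← h5] at h6
    simp at h6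
  · obtain ⟨h5, h6⟩ := hpole hdd h1 h2
    rw [h3] at h5
    rw [h4, ← h5] at h6
    simp at h6
  · obtain ⟨h5, h6⟩ := hpole hdd h1 h2
    exact L.unique_face d.2 _ _ (hout _ _ h2 h4) rfl h1 h5 h6

end LocalMap

/-! ### Recovering the map from its permutation. -/

namespace OrientedMap.IsPlaneBipolar

variable {n : ℕ} {M : OrientedMap n} {τ ρ π : Perm (Fin n)}

/-- The second clause allows `g` to be traced back to `v`: the value 0 names the source, `n` the
sink, and any other value is the rank of an edge leaving `v`. -/
theorem exists_gap (h : M.IsPlaneBipolar) (hn : 1 ≤ n) (hr : (h.localMap hn).IsRanking τ ρ)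
    (hπ : ∀ e, π (τ e) = ρ e) (v : M.Vertex) :
    ∃ g, (∀ d, M.vertexOf d = v → vertexGap π (Prod.map τ id d) = g) ∧
      ((M.IsSource v ∧ g = 0) ∨ (M.IsSink v ∧ g = n) ∨
        ∃ j : Fin n, M.tail j = v ∧ g = τ j ∧ 0 < g) := by
  by_cases hs : M.IsSource v
  · refine ⟨0, ?_, Or.inl ⟨hs, rfl⟩⟩
    rintro ⟨e, _ | _⟩ hd
    · exact absurd hd (hs e)
    · exact hr.tailGap_eq_zero hπ fun l hl => hs l (((M.vertexOf_eq_iff _ _).2 hl).trans hd)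
  by_cases ht : M.IsSink v
  · refine ⟨n, ?_, Or.inr (Or.inl ⟨ht, rfl⟩)⟩
    rintro ⟨e, _ | _⟩ hd
    · exact hr.headGap_eq_last hπ fun l hl => ht l (((M.vertexOf_eq_iff _ _).2 hl).symm.trans hd)
    · exact absurd hd (ht e)
  simp only [IsSource, IsSink, not_forall, not_not] at hs ht
  obtain ⟨x, hx⟩ := hs
  obtain ⟨y, hy⟩ := ht
  have hxy := (M.vertexOf_eq_iff (x, false) (y, true)).1 (hx.trans hy.symm)
  obtain ⟨⟨j, b⟩, hj1, hj2, hj3⟩ := hxy.symm.exists_change Prod.snd rfl rfl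
  obtain rfl : b = true := hj2
  obtain ⟨⟨i, b⟩, hi1, hi2, hi3⟩ := hxy.exists_change (fun d => !d.2) rfl rfl
  obtain rfl : b = false := by simpa using hi2
  replace hi3 : (M.rot (i, false)).2 = true := by simpa using hi3
  have hij : (h.localMap hn).Above i j := hi1.symm.trans (hxy.trans hj1)
  have hjv : M.vertexOf (j, true) = v := ((M.vertexOf_eq_iff _ _).2 hj1).symm.trans hy
  have hiv : M.vertexOf (i, false) = v := ((M.vertexOf_eq_iff _ _).2 hi1).symm.trans hx
  refine ⟨τ j, ?_, Or.inr (Or.inr ⟨j, hjv, rfl, ?_⟩)⟩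
  · rintro ⟨e, _ | _⟩ hd
    · exact hr.headGap_eq hπ hij hj3 ((M.vertexOf_eq_iff _ _).1 (hd.trans hiv.symm))
    · exact hr.tailGap_eq hπ hij hi3 hj3 ((M.vertexOf_eq_iff _ _).1 (hd.trans hjv.symm))
  · have := hr.succ_of_last hij hi3 hj3
    omega

theorem vertexGap_eq_iff (h : M.IsPlaneBipolar) (hn : 1 ≤ n)
    (hr : (h.localMap hn).IsRanking τ ρ) (hπ : ∀ e, π (τ e) = ρ e) (d d' : HalfEdge n) :
    M.rot.SameCycle d d' ↔ vertexGap π (Prod.map τ id d) = vertexGap π (Prod.map τ id d') := by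
  rw [← M.vertexOf_eq_iff]
  obtain ⟨g, hg, hv⟩ := h.exists_gap hn hr hπ (M.vertexOf d)
  obtain ⟨g', hg', hv'⟩ := h.exists_gap hn hr hπ (M.vertexOf d')
  rw [hg d rfl, hg' d' rfl]
  constructor
  · intro hd
    rw [← hg d rfl, hg' d hd]
  · rintro rfl
    rcases hv with ⟨h1, h2⟩ | ⟨h1, h2⟩ | ⟨j, h1, h2, h3⟩ <;>
    rcases hv' with ⟨k1, k2⟩ | ⟨k1, k2⟩ | ⟨j', k1, k2, k3⟩
    · exact h.unique_source.unique h1 k1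
    · omega
    · omega
    · omega
    · exact h.unique_sink.unique h1 k1
    · have := (τ j').2
      omega
    · omega
    · have := (τ j).2
      omega
    · rw [← h1, ← k1, τ.injective (Fin.ext (h2.symm.trans k2))]

theorem exists_isBaxter_iso (h : M.IsPlaneBipolar) (hn : 1 ≤ n) :
    ∃ π, IsBaxter π ∧ OrientedMap.Iso M (permMap π hn) := by
  obtain ⟨f, hf⟩ := LocalMap.exists_strictMono_beside (h.exists_out hn)
  obtain ⟨τ, ρ, hr⟩ := LocalMap.exists_isRanking (h.sameCycle_of_out hn) hf
  have hπ : ∀ e, (ρ * τ⁻¹) (τ e) = ρ e := fun e => by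
    rw [Perm.mul_apply, Perm.inv_apply_apply]
  generalize ρ * τ⁻¹ = π at hπ
  have hinj : Function.Injective (Prod.map τ id : HalfEdge n → HalfEdge n) :=
    τ.injective.prodMap Function.injective_id
  have hsurj : Function.Surjective (Prod.map τ id : HalfEdge n → HalfEdge n) :=
    τ.surjective.prodMap Function.surjective_id
  have hrot : ∀ d, (permMap π hn).rot (Prod.map τ id d) = Prod.map τ id (M.rot d) := fun d => by
    -- `M.rot` has one descent of the key at each vertex, so it is the cyclic successor, like the
    -- rotation of `permMap`.
    have h1 := isCyclicNext_of_unique_descent (σ := M.rot)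
      (f := fun d => vertexGap π (Prod.map τ id d)) (κ := fun d => dartKey (Prod.map τ id d))
      (h.vertexGap_eq_iff hn hr hπ)
      (fun d d' hdd hd hd' => LocalMap.eq_of_dartKey_le hr (h.sameCycle_of_out hn)
        ((h.vertexGap_eq_iff hn hr hπ d d').2 hdd) hd hd') d
    obtain ⟨z, hz⟩ := hsurj ((permMap π hn).rot (Prod.map τ id d))
    obtain ⟨h2, h3⟩ : IsCyclicNext (vertexGap π) dartKey (Prod.map τ id d) (Prod.map τ id z) :=
      hz ▸ isCyclicNext_cyclicNext dartKey_injective _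
    rw [← hz, h1.right_unique (dartKey_injective.comp hinj) ⟨h2, h3.imp
      (fun h => ⟨h.1, fun d' => h.2 _⟩) fun h d' => h _⟩]
  refine ⟨π, hr.isBaxter hπ, τ, hrot, fun d => ?_⟩
  -- The edge of rank 0 has the outer face on its left: an inner face would have an edge on its
  -- other side, of smaller rank.
  obtain ⟨e, he⟩ := τ.surjective ⟨0, hn⟩
  have houter : M.faceOf (e, true) = M.outerFace := by
    by_contra hcon
    obtain ⟨⟨i, b⟩, hi, hb⟩ := h.exists_snd_eq_of_face false (e, true)
    obtain rfl : b = false := hb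
    have hb : (h.localMap hn).Beside i e := ⟨hi.symm, fun ho =>
      hcon (((M.faceOf_eq_iff _ _).2 hi).trans ho)⟩
    have := Fin.lt_def.1 (hr.lt_of_beside hb).1
    rw [he] at this
    simp at this
  have : (permMap π hn).outerFace = (permMap π hn).faceOf (Prod.map τ id (e, true)) := by
    simp only [Prod.map, he]
    rfl
  rw [this, OrientedMap.faceOf_map_eq_iff hrot, houter]

end OrientedMap.IsPlaneBipolar


/-! ### The bijection -/

section Bijection

variable {n : ℕ} {π π' : Perm (Fin n)} {M : OrientedMap n}

theorem isModel_of_iso (hπ : IsBaxter π) (hn : 1 ≤ n)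
    (h : OrientedMap.Iso M (permMap π hn)) : ∃ τ, IsModel π M τ :=
  let ⟨τ, h1, h2⟩ := h
  ⟨τ, isModel_of_rot hπ hn h1 h2⟩

theorem permMap_isPlaneBipolar (hπ : IsBaxter π) (hn : 1 ≤ n) : (permMap π hn).IsPlaneBipolar :=
  let ⟨_, h⟩ := isModel_of_iso hπ hn (OrientedMap.Iso.refl _)
  h.isPlaneBipolar hn

/-- The plane bipolar orientation of a Baxter permutation. -/
noncomputable def baxterOrientation (hn : 1 ≤ n) (π : {π : Perm (Fin n) // IsBaxter π}) :
    PlaneBipolarOrientation n :=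
  (permMap_isPlaneBipolar π.2 hn).toOrientation

theorem OrientedMap.IsPlaneBipolar.toOrientation_eq_iff {M N : OrientedMap n}
    {h : M.IsPlaneBipolar} {h' : N.IsPlaneBipolar} :
    h.toOrientation = h'.toOrientation ↔ OrientedMap.Iso M N :=
  Quotient.eq

theorem baxterOrientation_eq_iff {hn : 1 ≤ n} {π : {π : Perm (Fin n) // IsBaxter π}}
    {h : M.IsPlaneBipolar} :
    baxterOrientation hn π = h.toOrientation ↔ OrientedMap.Iso M (permMap π.1 hn) :=
  OrientedMap.IsPlaneBipolar.toOrientation_eq_iff.trans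
    ⟨OrientedMap.Iso.symm, OrientedMap.Iso.symm⟩

theorem baxterOrientation_bijective (hn : 1 ≤ n) :
    Function.Bijective (baxterOrientation (n := n) hn) := by
  constructor
  · rintro ⟨π, hπ⟩ ⟨π', hπ'⟩ h
    obtain ⟨τ, h1⟩ := isModel_of_iso hπ hn (OrientedMap.Iso.refl _)
    obtain ⟨τ', h2⟩ := isModel_of_iso hπ' hn
      (OrientedMap.IsPlaneBipolar.toOrientation_eq_iff.1 h)
    exact Subtype.ext (IsModel.perm_unique hπ hπ' h1 h2)
  · rintro ⟨M, h⟩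
    obtain ⟨π, hπ, hiso⟩ := h.exists_isBaxter_iso hn
    exact ⟨⟨π, hπ⟩, baxterOrientation_eq_iff (h := h).2 hiso⟩

theorem Realization.isSource_iff (hπ : IsBaxter π) (hn : 1 ≤ n) (R : Realization π M)
    (v : M.Vertex) : M.IsSource v ↔ (R.position v : ℝ × ℝ) = firstPoint := by
  obtain ⟨d, rfl⟩ := M.vertexOf_surjective v
  rw [(R.isModel hπ hn).isSource_iff, R.position_vertexOf hπ, ← whitePoint_zero π,
    (whitePoint_injective π).eq_iff]
  rfl

theorem Realization.isSink_iff (hπ : IsBaxter π) (hn : 1 ≤ n) (R : Realization π M)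
    (v : M.Vertex) : M.IsSink v ↔ (R.position v : ℝ × ℝ) = lastPoint n := by
  obtain ⟨d, rfl⟩ := M.vertexOf_surjective v
  rw [(R.isModel hπ hn).isSink_iff, R.position_vertexOf hπ, ← whitePoint_last π,
    (whitePoint_injective π).eq_iff]
  rfl

end Bijection

theorem mainTheorem1 (n : ℕ) (hn : 1 ≤ n) :
    -- the drawing `φ(π)`
    (∀ π : Equiv.Perm (Fin n), IsBaxter π →
      HasNoCrossing π ∧ IsBicolored π ∧
      (∀ b ∈ blackPoints π, (∃! p, HasseEdge π p b) ∧ ∃! q, HasseEdge π b q)) ∧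
    ∃ Φ : {π : Equiv.Perm (Fin n) // IsBaxter π} → PlaneBipolarOrientation n,
      -- `Φ(π)` is obtained from `φ(π)` by erasing the black points
      (∀ (π : {π : Equiv.Perm (Fin n) // IsBaxter π}) (M : OrientedMap n),
        Nonempty (Realization π.1 M) ↔ ∃ h : M.IsPlaneBipolar, Φ π = h.toOrientation) ∧
      -- its poles are `w_0` and `w_n`
      (∀ (π : {π : Equiv.Perm (Fin n) // IsBaxter π}) (M : OrientedMap n)
        (R : Realization π.1 M) (v : M.Vertex),
        (M.IsSource v ↔ (R.position v : ℝ × ℝ) = firstPoint) ∧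
        (M.IsSink v ↔ (R.position v : ℝ × ℝ) = lastPoint n)) ∧
      Function.Bijective Φ ∧
      -- the parameters
      ∀ (π : {π : Equiv.Perm (Fin n) // IsBaxter π}) (M : OrientedMap n) (h : M.IsPlaneBipolar),
        Φ π = h.toOrientation →
        M.nonPolarCount = (ascents π.1).card ∧
        (∃! p, M.IsLeftBorder p) ∧
        (∀ p, M.IsLeftBorder p → p.length = (lrMaxima π.1).card) ∧
        (∃! p, M.IsRightBorder p) ∧
        (∀ p, M.IsRightBorder p → p.length = (rlMinima π.1).card) ∧
        (∀ t, M.IsSink t → M.degree t = (rlMaxima π.1).card) ∧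
        (∀ s, M.IsSource s → M.degree s = (lrMinima π.1).card) := by
  refine ⟨fun π hπ => ⟨hasNoCrossing hπ, isBicolored hπ, fun b hb => existsUnique_hasseEdge hπ hb⟩,
    baxterOrientation hn, fun π M => ?_, fun π M R v => ?_, baxterOrientation_bijective hn,
    fun π M h hΦ => ?_⟩
  · constructor
    · rintro ⟨R⟩
      exact ⟨(R.isModel π.2 hn).isPlaneBipolar hn, baxterOrientation_eq_iff.2 (R.iso π.2 hn)⟩
    · rintro ⟨h, hΦ⟩
      exact Realization.exists_of_iso π.2 hn (baxterOrientation_eq_iff.1 hΦ)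
  · exact ⟨R.isSource_iff π.2 hn v, R.isSink_iff π.2 hn v⟩
  · obtain ⟨τ, hm⟩ := isModel_of_iso π.2 hn (baxterOrientation_eq_iff.1 hΦ)
    exact ⟨hm.nonPolarCount_eq hn, (hm.leftBorder hn).1, (hm.leftBorder hn).2,
      (hm.rightBorder hn).1, (hm.rightBorder hn).2, fun t ht => hm.degree_sink ht,
      fun s hs => hm.degree_source hs⟩
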